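/- Let $\mathbb{T}^2=(\mathbb{R}/2\pi\mathbb{Z})^2$ with normalized Lebesgue measure, and for $s\in\mathbb{R}$, $1<p<\infty$ let $\mathcal{F}L^{s,p}(\mathbb{T}^2)$ be the space of distributions $f$ on $\mathbb{T}^2$ with $$\|f\|_{\mathcal{F}L^{s,p}}=\Big(\sum_{n\in\mathbb{Z}^2}\big((1+|n|^2)^{s/2}|\widehat f(n)|\big)^p\Big)^{1/p}<\infty .$$ Suppose that $1<p\le 3$ and $s>1-\frac1p$, or that $3\le p<\infty$ and $s>\frac43-\frac2p$. Then $\mathcal{F}L^{s,p}(\mathbb{T}^2)\subset L^3(\mathbb{T}^2)$ (so that the nonlinearity below makes sense), and the cubic hyperbolic nonlinear Schrödinger equation $$i\partial_t u+(\partial_{x_1}^2-\partial_{x_2}^2)u+|u|^2u=0$$ is unconditionally locally well-posed in $\mathcal{F}L^{s,p}(\mathbb{T}^2)$: for every $u_0\in\mathcal{F}L^{s,p}(\mathbb{T}^2)$ there exist $T>0$ and a unique $u\in C([0,T];\mathcal{F}L^{s,p}(\mathbb{T}^2))$ with $u|_{t=0}=u_0$ that satisfies the equation in the sense of distributions on $(0,T)\times\mathbb{T}^2$;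 the uniqueness holds in the entire class $C([0,T];\mathcal{F}L^{s,p}(\mathbb{T}^2))$. -/

import Mathlib

open MeasureTheory

noncomputable section

namespace HNLS

/-- The period `2π` is positive. -/
instance fact_two_pi_pos : Fact ((0 : ℝ) < 2 * Real.pi) := ⟨Real.two_pi_pos⟩

/-- The torus `𝕋² = (ℝ / 2πℤ)²`. -/
abbrev Torus : Type := AddCircle (2 * Real.pi) × AddCircle (2 * Real.pi)

/-- The normalized Lebesgue measure `(2π)⁻² dx` on `𝕋²`. -/
def torusMeasure : Measure Torus :=
  (AddCircle.haarAddCircle : Measure (AddCircle (2 * Real.pi))).prod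
    (AddCircle.haarAddCircle : Measure (AddCircle (2 * Real.pi)))

/-- `L¹(𝕋²)`, with complex values. -/
abbrev L1 : Type := Lp ℂ 1 torusMeasure

/-- The character `x ↦ e^{i n·x}` of `𝕋²`, for `n ∈ ℤ²`. -/
def character (n : ℤ × ℤ) (x : Torus) : ℂ := fourier n.1 x.1 * fourier n.2 x.2

/-- The Fourier coefficient `f̂(n) = ∫ f(x) e^{-i n·x} dx` (normalized measure). -/
def fourierCoefficient (f : L1) (n : ℤ × ℤ) : ℂ :=
  ∫ x, f x * character (-n) x ∂torusMeasure

/-- The bracket `⟨n⟩ = (1 + |n|²)^{1/2}`. -/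
def bracket (n : ℤ × ℤ) : ℝ := Real.sqrt (1 + (n.1 : ℝ) ^ 2 + (n.2 : ℝ) ^ 2)

/-- The (possibly infinite) weighted norm `‖⟨n⟩^s a(n)‖_{ℓ^p(ℤ²)}` of a sequence,
for `1 ≤ p < ∞`. -/
def weightedNorm (s p : ℝ) (a : ℤ × ℤ → ℂ) : ENNReal :=
  (∑' n : ℤ × ℤ, ENNReal.ofReal (bracket n ^ s * ‖a n‖) ^ p) ^ (1 / p)

/-- The (possibly infinite) Fourier-Lebesgue norm
`‖f‖_{𝓕L^{s,p}} = ‖⟨n⟩^s f̂(n)‖_{ℓ^p(ℤ²)}`. -/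
def flNorm (s p : ℝ) (f : L1) : ENNReal := weightedNorm s p (fourierCoefficient f)

/-- `f` belongs to the Fourier-Lebesgue space `𝓕L^{s,p}(𝕋²)`. Here the space is realized
inside `L¹(𝕋²)`; this loses nothing as soon as every distribution with finite
`𝓕L^{s,p}` norm is an integrable function, which is `FLEmbedsInL3` below. -/
def MemFL (s p : ℝ) (f : L1) : Prop := flNorm s p f < ⊤

/-- The embedding `𝓕L^{s,p}(𝕋²) ⊂ L³(𝕋²)`: every (distribution given by its) sequence of
Fourier coefficients with finite weighted `ℓ^p` norm is a function in `L³(𝕋²)`. -/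
def FLEmbedsInL3 (s p : ℝ) : Prop :=
  ∀ a : ℤ × ℤ → ℂ, weightedNorm s p a < ⊤ →
    ∃ f : L1, fourierCoefficient f = a ∧ MemLp f 3 torusMeasure

/-- `u ∈ C([0,T]; 𝓕L^{s,p}(𝕋²))` (the values of `u` outside `[0,T]` are irrelevant). -/
def ContinuousInFL (s p T : ℝ) (u : ℝ → L1) : Prop :=
  (∀ t ∈ Set.Icc 0 T, MemFL s p (u t)) ∧
  ∀ t₀ ∈ Set.Icc 0 T,
    Filter.Tendsto (fun t => flNorm s p (u t - u t₀)) (nhdsWithin t₀ (Set.Icc 0 T)) (nhds 0)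

/-- Test functions: smooth functions on `(0,T) × 𝕋²`, compactly supported in time. -/
structure IsTestFunction (T : ℝ) (φ : ℝ → Torus → ℂ) : Prop where
  /-- Smoothness of the lift of `φ` to `ℝ × ℝ²`. -/
  smooth : ContDiff ℝ ((⊤ : ℕ∞) : WithTop ℕ∞)
    (fun z : ℝ × ℝ × ℝ => φ z.1 ((z.2.1 : AddCircle (2 * Real.pi)), (z.2.2 : AddCircle (2 * Real.pi))))
  /-- The support is contained in some `[a,b] × 𝕋²` with `0 < a` and `b < T`. -/
  support : ∃ a b : ℝ, 0 < a ∧ b < T ∧ ∀ t, t ∉ Set.Icc a b → ∀ x, φ t x = 0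

/-- The hyperbolic Laplacian `□ = ∂_{x₁}² - ∂_{x₂}²` of a (smooth) function on `𝕋²`. -/
def box (ψ : Torus → ℂ) (x : Torus) : ℂ :=
  iteratedDeriv 2 (fun h : ℝ => ψ (x.1 + (h : AddCircle (2 * Real.pi)), x.2)) 0
    - iteratedDeriv 2 (fun h : ℝ => ψ (x.1, x.2 + (h : AddCircle (2 * Real.pi)))) 0

/-- `i ∂_t u + □ u + |u|² u = 0` in the sense of distributions on `(0,T) × 𝕋²`. -/
def SolvesHNLS (T : ℝ) (u : ℝ → L1) : Prop :=
  ∀ φ : ℝ → Torus → ℂ, IsTestFunction T φ →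
    ∫ t in (0 : ℝ)..T, ∫ x, (u t x * (-Complex.I * deriv (fun τ => φ τ x) t + box (φ t) x)
      + (‖u t x‖ : ℂ) ^ 2 * u t x * φ t x) ∂torusMeasure = 0

/-- `u` is a solution in `C([0,T]; 𝓕L^{s,p}(𝕋²))` with initial data `u₀`. -/
structure IsSolution (s p T : ℝ) (u₀ : L1) (u : ℝ → L1) : Prop where
  continuous : ContinuousInFL s p T u
  initial : u 0 = u₀
  equation : SolvesHNLS T u

/-- Unconditional local well-posedness in `𝓕L^{s,p}(𝕋²)`: for all data in the space there are
`T > 0` and a unique solution in `C([0,T]; 𝓕L^{s,p}(𝕋²))`, uniqueness holding in this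
entire class. -/
def UnconditionallyLocallyWellPosed (s p : ℝ) : Prop :=
  ∀ u₀ : L1, MemFL s p u₀ →
    ∃ T : ℝ, 0 < T ∧ ∃ u : ℝ → L1, IsSolution s p T u₀ u ∧
      ∀ v : ℝ → L1, IsSolution s p T u₀ v → ∀ t ∈ Set.Icc 0 T, v t = u t

end HNLS

end

open scoped ENNReal

noncomputable section

namespace HNLS

/-! In Fourier coefficients, with the linear flow removed, the cubic term couples `n` to `n₁, n₂,
n₃` with `n = n₁ - n₂ + n₃` and oscillates with frequency `2ν`, where `ν = B(n - n₁, n - n₃)` and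
`B` is the bilinear form `hform`. The pairs with `n₁ = n` or `n₃ = n` sum to `2 · mass · a(n)` minus
a diagonal term, and a phase built from the time integral of the mass removes the mass term
(`cubicSum_eq`, `isRough_gauge`).

What remains obeys an arithmetic bound (`exists_kernel_bound`): for every `n` and every level `ν`,
zero included, the sum of `⟨·⟩^{-σ} ⟨·⟩^{-σ}` over any two of the three input frequencies is bounded
uniformly as soon as `σ > 1`. At fixed level one frequency runs over a line when another is fixed,
or over a hyperbola, and both carry few lattice points. Hölder's inequality with `σ = s p'`, which
is where `s > 1 - 1/p` enters, turns this into trilinear estimates in `ℓ^r` over `ν` and `n`, with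
one input in plain `ℓ^r` and two in the strong space (`exists_level_bound`).

Solutions are first sought as absolutely convergent series `∑ e^{iτt} x(τ)` with `x` in `ℓ¹_τ
𝓕L^{s,p}`. On a short interval integration in time is given by a kernel whose column sums are at
most `min(C √T, 2/|τ|)`, small in `ℓ^{p'}`; pairing it with the level estimate gives a contraction
(`exists_fixedPoint`) and Lipschitz dependence on the data in the weak norm `ℓ^r`
(`weak_lipschitz`).

For uniqueness a solution `b` is merely continuous with values in `𝓕L^{s,p}`. The condition `s > 4/3
- 2/p` embeds this space in some `ℓ^q` with `q < 3/2`. Hence it embeds in `L³`, and by Young's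
inequality the cubic term is locally Lipschitz into some `ℓ^r`. The series solution is restarted
from `b` at the points of a fine grid: over one step of length `h` it departs from `b` by `o(h)` in
`ℓ^r`, the Lipschitz dependence transports this error to the final time, and the total tends to zero
(`rough_eq_good`). Testing against plane waves identifies distributional solutions with solutions of
the Fourier system. -/

/-! ### Brackets, weights and their sums over `ℤ` and `ℤ²`. -/

lemma one_le_bracket (n : ℤ × ℤ) : 1 ≤ bracket n := by
  unfold bracket
  rw [Real.one_le_sqrt]
  nlinarith [sq_nonneg (n.1 : ℝ), sq_nonneg (n.2 : ℝ)]

lemma bracket_pos (n : ℤ × ℤ) : 0 < bracket n := lt_of_lt_of_le one_pos (one_le_bracket n)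

lemma abs_fst_le_bracket (n : ℤ × ℤ) : |(n.1 : ℝ)| ≤ bracket n := by
  unfold bracket
  apply Real.abs_le_sqrt
  nlinarith [sq_nonneg (n.1 : ℝ), sq_nonneg (n.2 : ℝ)]

lemma abs_snd_le_bracket (n : ℤ × ℤ) : |(n.2 : ℝ)| ≤ bracket n := by
  unfold bracket
  apply Real.abs_le_sqrt
  nlinarith [sq_nonneg (n.1 : ℝ), sq_nonneg (n.2 : ℝ)]

lemma one_le_norm_int_prod {v : ℤ × ℤ} (hv : v ≠ 0) : 1 ≤ ‖v‖ := by
  rw [Prod.norm_def, le_max_iff, Int.norm_eq_abs, Int.norm_eq_abs]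
  by_contra! h
  apply hv
  have h1 : |v.1| < 1 := by exact_mod_cast h.1
  have h2 : |v.2| < 1 := by exact_mod_cast h.2
  ext
  · exact Int.abs_lt_one_iff.mp h1
  · exact Int.abs_lt_one_iff.mp h2

/-- The weight `⟨n⟩^{-σ}`. -/
def wt (σ : ℝ) (n : ℤ × ℤ) : ℝ≥0∞ := ENNReal.ofReal (bracket n ^ (-σ))

lemma wt_add (a b : ℝ) (n : ℤ × ℤ) : wt (a + b) n = wt a n * wt b n := by
  unfold wt
  rw [← ENNReal.ofReal_mul (Real.rpow_nonneg (bracket_pos n).le _),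
    ← Real.rpow_add (bracket_pos n)]
  congr 2; ring

lemma wt_anti {σ : ℝ} (hσ : 0 ≤ σ) {m n : ℤ × ℤ} (h : bracket m ≤ bracket n) :
    wt σ n ≤ wt σ m :=
  ENNReal.ofReal_le_ofReal
    (Real.rpow_le_rpow_of_nonpos (bracket_pos m) h (by linarith))

lemma wt_le_wt {a b : ℝ} (h : a ≤ b) (n : ℤ × ℤ) : wt b n ≤ wt a n :=
  ENNReal.ofReal_le_ofReal
    (Real.rpow_le_rpow_of_exponent_le (one_le_bracket n) (by linarith))

lemma wt_zero (n : ℤ × ℤ) : wt 0 n = 1 := by simp [wt]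

lemma wt_le_one {σ : ℝ} (hσ : 0 ≤ σ) (n : ℤ × ℤ) : wt σ n ≤ 1 :=
  (wt_le_wt hσ n).trans_eq (wt_zero n)

lemma wt_ne_top (σ : ℝ) (n : ℤ × ℤ) : wt σ n ≠ ⊤ := ENNReal.ofReal_ne_top

/-- Uniformity in the shift is the point. Translation by `⌊t⌋` reduces to `0 ≤ t < 1`, where `1 + |j
+ t| ≥ (1 + |j|) / 2`. -/
lemma exists_tsum_shift_le {ρ : ℝ} (hρ : 1 < ρ) : ∃ C : ℝ≥0∞, C ≠ ⊤ ∧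
    ∀ t : ℝ, ∑' j : ℤ, ENNReal.ofReal ((1 + |(j : ℝ) + t|) ^ (-ρ)) ≤ C := by
  have hs : Summable fun j : ℤ => (1 + |(j : ℝ)|) ^ (-ρ) := by
    have h1 := (Real.summable_abs_int_rpow hρ).add
      (summable_of_hasFiniteSupport (f := fun j : ℤ => if j = 0 then (1 : ℝ) else 0)
        ((Set.finite_singleton (0 : ℤ)).subset (by intro j; simp)))
    refine Summable.of_nonneg_of_le (fun j => by positivity) (fun j => ?_) h1
    by_cases hj : j = 0
    · subst hj
      simp
      positivity
    · simp only [hj, if_false, add_zero]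
      have : 0 < |(j : ℝ)| := by positivity
      exact Real.rpow_le_rpow_of_nonpos this (by linarith) (by linarith)
  refine ⟨∑' j : ℤ, ENNReal.ofReal (2 ^ ρ * (1 + |(j : ℝ)|) ^ (-ρ)), ?_, fun t => ?_⟩
  · rw [← ENNReal.ofReal_tsum_of_nonneg (fun j => by positivity) (hs.mul_left _)]
    exact ENNReal.ofReal_ne_top
  · rw [← (Equiv.subRight ⌊t⌋).tsum_eq]
    refine ENNReal.tsum_le_tsum fun j => ENNReal.ofReal_le_ofReal ?_
    simp only [Equiv.subRight_apply, Int.cast_sub]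
    have h2 : (j : ℝ) - ⌊t⌋ + t = j + Int.fract t := by rw [Int.fract]; ring
    rw [h2]
    have h0 := Int.fract_nonneg t
    have h1 := Int.fract_lt_one t
    have h3 : (1 + |(j : ℝ)|) / 2 ≤ 1 + |(j : ℝ) + Int.fract t| := by
      have : |(j : ℝ)| ≤ |(j : ℝ) + Int.fract t| + 1 := by
        calc |(j : ℝ)| = |((j : ℝ) + Int.fract t) - Int.fract t| := by ring_nf
          _ ≤ |(j : ℝ) + Int.fract t| + |Int.fract t| := abs_sub _ _
          _ ≤ _ := by rw [abs_of_nonneg h0]; linarith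
      linarith [abs_nonneg ((j : ℝ) + Int.fract t)]
    calc (1 + |(j : ℝ) + Int.fract t|) ^ (-ρ) ≤ ((1 + |(j : ℝ)|) / 2) ^ (-ρ) :=
          Real.rpow_le_rpow_of_nonpos (by positivity) h3 (by linarith)
      _ = 2 ^ ρ * (1 + |(j : ℝ)|) ^ (-ρ) := by
          rw [Real.div_rpow (by positivity) (by norm_num), Real.rpow_neg (by norm_num : (0:ℝ) ≤ 2)]
          field_simp

/-- Since `(1 + a)(1 + b) / 2 ≤ 1 + a² + b²`, the weight is dominated by a product of
one-dimensional weights with exponent `ρ / 2 > 1`. -/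
lemma tsum_wt_ne_top {ρ : ℝ} (hρ : 2 < ρ) : ∑' n, wt ρ n ≠ ⊤ := by
  obtain ⟨C, hC, h⟩ := exists_tsum_shift_le (ρ := ρ / 2) (by linarith)
  have key : ∑' n, wt ρ n ≤ ∑' n : ℤ × ℤ, ENNReal.ofReal (2 ^ (ρ / 2)) *
      (ENNReal.ofReal ((1 + |(n.1 : ℝ) + 0|) ^ (-(ρ / 2))) *
        ENNReal.ofReal ((1 + |(n.2 : ℝ) + 0|) ^ (-(ρ / 2)))) := by
    refine ENNReal.tsum_le_tsum fun n => ?_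
    rw [wt, ← ENNReal.ofReal_mul (by positivity), ← ENNReal.ofReal_mul (by positivity)]
    refine ENNReal.ofReal_le_ofReal ?_
    rw [add_zero, add_zero, ← Real.mul_rpow (by positivity) (by positivity)]
    set a := |(n.1 : ℝ)|
    set b := |(n.2 : ℝ)|
    have hb : bracket n ^ (-ρ) = (1 + a ^ 2 + b ^ 2) ^ (-(ρ / 2)) := by
      rw [bracket, Real.sqrt_eq_rpow, ← Real.rpow_mul (by positivity)]
      simp only [a, b, sq_abs]
      congr 1; ring
    rw [hb]
    have h3 : (1 + a) * (1 + b) / 2 ≤ 1 + a ^ 2 + b ^ 2 := by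
      nlinarith [sq_nonneg (a - b), sq_nonneg (a - 1), sq_nonneg (b - 1)]
    calc (1 + a ^ 2 + b ^ 2) ^ (-(ρ / 2)) ≤ ((1 + a) * (1 + b) / 2) ^ (-(ρ / 2)) :=
          Real.rpow_le_rpow_of_nonpos (by positivity) h3 (by linarith)
      _ = _ := by
        rw [Real.div_rpow (by positivity) (by norm_num), Real.rpow_neg (by norm_num : (0:ℝ) ≤ 2)]
        field_simp
  refine ne_top_of_le_ne_top ?_ key
  rw [ENNReal.tsum_mul_left, ENNReal.tsum_prod']
  simp_rw [ENNReal.tsum_mul_left, ENNReal.tsum_mul_right]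
  exact ENNReal.mul_ne_top ENNReal.ofReal_ne_top
    (ENNReal.mul_ne_top (ne_top_of_le_ne_top hC (h 0)) (ne_top_of_le_ne_top hC (h 0)))

/-! ### Sums of weights along lattice lines. -/

/-- The coordinate in which `v` attains its sup norm is, along the line, an affine function of `j`
with slope `±‖v‖`; `-t` is its zero. -/
lemma exists_norm_mul_shift_le (c : ℤ × ℤ) {v : ℤ × ℤ} (hv : v ≠ 0) :
    ∃ t : ℝ, ∀ j : ℤ, ‖v‖ * |(j : ℝ) + t| ≤ bracket (c + j • v) := by
  have hpos := one_le_norm_int_prod hv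
  rcases max_cases ‖v.1‖ ‖v.2‖ with ⟨h, -⟩ | ⟨h, -⟩
  · rw [← Prod.norm_def] at h
    have h0 : (v.1 : ℝ) ≠ 0 := by
      intro h0; rw [h, Int.norm_eq_abs, h0] at hpos; norm_num at hpos
    refine ⟨c.1 / v.1, fun j => le_trans ?_ (abs_fst_le_bracket _)⟩
    rw [h, Int.norm_eq_abs, ← abs_mul]
    apply le_of_eq
    congr 1
    rw [mul_add, mul_div_cancel₀ _ h0]
    simp
    ring
  · rw [← Prod.norm_def] at h
    have h0 : (v.2 : ℝ) ≠ 0 := by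
      intro h0; rw [h, Int.norm_eq_abs, h0] at hpos; norm_num at hpos
    refine ⟨c.2 / v.2, fun j => le_trans ?_ (abs_snd_le_bracket _)⟩
    rw [h, Int.norm_eq_abs, ← abs_mul]
    apply le_of_eq
    congr 1
    rw [mul_add, mul_div_cancel₀ _ h0]
    simp
    ring

/-- Away from the origin the step length is gained in full. The cut at `‖v‖ / 2` is needed because
one point of the line may lie near the origin, where nothing is gained. -/
lemma exists_tsum_line_far_le {ρ : ℝ} (hρ : 1 < ρ) : ∃ C : ℝ≥0∞, C ≠ ⊤ ∧
    ∀ c v : ℤ × ℤ, v ≠ 0 →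
      ∑' j : ℤ, (if ‖v‖ / 2 ≤ bracket (c + j • v) then wt ρ (c + j • v) else 0)
        ≤ C * ENNReal.ofReal (‖v‖ ^ (-ρ)) := by
  obtain ⟨C, hC, h⟩ := exists_tsum_shift_le hρ
  refine ⟨ENNReal.ofReal (3 ^ ρ) * C, ENNReal.mul_ne_top ENNReal.ofReal_ne_top hC,
    fun c v hv => ?_⟩
  obtain ⟨t, ht⟩ := exists_norm_mul_shift_le c hv
  have hpos := one_le_norm_int_prod hv
  calc _ ≤ ∑' j : ℤ, ENNReal.ofReal (3 ^ ρ * ‖v‖ ^ (-ρ)) *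
        ENNReal.ofReal ((1 + |(j : ℝ) + t|) ^ (-ρ)) := by
        refine ENNReal.tsum_le_tsum fun j => ?_
        split_ifs with hj
        · rw [wt, ← ENNReal.ofReal_mul (by positivity)]
          refine ENNReal.ofReal_le_ofReal ?_
          -- Two thirds of the cut condition `‖v‖ / 2 ≤ ⟨x⟩` plus one third of `‖v‖ |j + t| ≤ ⟨x⟩`.
          have h3 : ‖v‖ * (1 + |(j : ℝ) + t|) / 3 ≤ bracket (c + j • v) := by
            have := ht j
            nlinarith
          calc _ ≤ (‖v‖ * (1 + |(j : ℝ) + t|) / 3) ^ (-ρ) :=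
                Real.rpow_le_rpow_of_nonpos (by positivity) h3 (by linarith)
            _ = _ := by
              rw [Real.div_rpow (by positivity) (by norm_num),
                Real.mul_rpow (by positivity) (by positivity),
                Real.rpow_neg (by norm_num : (0:ℝ) ≤ 3)]
              field_simp
        · exact zero_le
    _ ≤ _ := by
        rw [ENNReal.tsum_mul_left, ENNReal.ofReal_mul (by positivity)]
        calc _ ≤ ENNReal.ofReal (3 ^ ρ) * ENNReal.ofReal (‖v‖ ^ (-ρ)) * C := by gcongr; exact h t
          _ = _ := by ring

/-- A point counted here has `|j + t| < 1/2`, which at most one integer satisfies. -/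
lemma tsum_line_near_le (c : ℤ × ℤ) {v : ℤ × ℤ} (hv : v ≠ 0) (a : ℝ≥0∞) :
    ∑' j : ℤ, (if bracket (c + j • v) < ‖v‖ / 2 then a else 0) ≤ a := by
  obtain ⟨t, ht⟩ := exists_norm_mul_shift_le c hv
  have hpos := one_le_norm_int_prod hv
  have huniq : ∀ i j : ℤ, bracket (c + i • v) < ‖v‖ / 2 → bracket (c + j • v) < ‖v‖ / 2 →
      i = j := by
    intro i j hi hj
    have h1 : |(i : ℝ) + t| < 1 / 2 := by
      have := ht i; by_contra! h; nlinarith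
    have h2 : |(j : ℝ) + t| < 1 / 2 := by
      have := ht j; by_contra! h; nlinarith
    rw [abs_lt] at h1 h2
    have h3 : |i - j| < 1 := by
      rw [abs_lt]
      constructor
      · have : (-1 : ℝ) < i - j := by linarith
        exact_mod_cast this
      · have : (i - j : ℝ) < 1 := by linarith
        exact_mod_cast this
    have := Int.abs_lt_one_iff.mp h3
    omega
  by_cases hex : ∃ j : ℤ, bracket (c + j • v) < ‖v‖ / 2
  · obtain ⟨j, hj⟩ := hex
    rw [tsum_eq_single j]
    · rw [if_pos hj]
    · intro i hi
      rw [if_neg]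
      exact fun h => hi (huniq i j h hj)
  · push Not at hex
    have : ∀ j : ℤ, (if bracket (c + j • v) < ‖v‖ / 2 then a else 0) = 0 :=
      fun j => if_neg (not_lt.mpr (hex j))
    rw [tsum_congr this, tsum_zero]
    exact zero_le

/-! ### Level sets of the hyperbolic form as lattice lines. -/

/-- The bilinear form of the hyperbolic Laplacian. -/
def hform (k m : ℤ × ℤ) : ℤ := k.1 * m.1 - k.2 * m.2

/-- The primitive vector in the direction of `k`. -/
def prim (k : ℤ × ℤ) : ℤ × ℤ := (k.1 / (Int.gcd k.1 k.2 : ℤ), k.2 / (Int.gcd k.1 k.2 : ℤ))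

lemma gcd_smul_prim (k : ℤ × ℤ) : (Int.gcd k.1 k.2 : ℤ) • prim k = k := by
  ext
  · simp [prim, Int.mul_ediv_cancel' (Int.gcd_dvd_left k.1 k.2)]
  · simp [prim, Int.mul_ediv_cancel' (Int.gcd_dvd_right k.1 k.2)]

lemma prim_ne_zero {k : ℤ × ℤ} (hk : k ≠ 0) : prim k ≠ 0 := by
  intro h
  apply hk
  rw [← gcd_smul_prim k, h, smul_zero]

lemma norm_swap_int (v : ℤ × ℤ) : ‖v.swap‖ = ‖v‖ := by
  simp [Prod.norm_def, max_comm]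

/-- Two points of a line `B(k,·) = ν` differ by a multiple of the swapped primitive vector. -/
lemma exists_smul_of_hform_eq {k x y : ℤ × ℤ} (hk : k ≠ 0) (h : hform k x = hform k y) :
    ∃ j : ℤ, x = y + j • (prim k).swap := by
  have hg : 0 < Int.gcd k.1 k.2 := by
    rw [Nat.pos_iff_ne_zero, Ne, Int.gcd_eq_zero_iff]
    rintro ⟨h1, h2⟩
    exact hk (Prod.ext h1 h2)
  have hg' : (Int.gcd k.1 k.2 : ℤ) ≠ 0 := by exact_mod_cast hg.ne'
  have hcop : IsCoprime (prim k).1 (prim k).2 := by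
    rw [Int.isCoprime_iff_gcd_eq_one]
    exact Int.gcd_ediv_gcd_ediv_gcd hg
  have h1 : k.1 = Int.gcd k.1 k.2 * (prim k).1 := by
    have := congrArg Prod.fst (gcd_smul_prim k)
    simpa using this.symm
  have h2 : k.2 = Int.gcd k.1 k.2 * (prim k).2 := by
    have := congrArg Prod.snd (gcd_smul_prim k)
    simpa using this.symm
  -- Dividing out the gcd leaves a relation with coprime coefficients, so each coordinate of `x - y`
  -- is divisible by the opposite coordinate of `prim k`.
  have h3 : (prim k).1 * (x.1 - y.1) = (prim k).2 * (x.2 - y.2) := by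
    apply mul_left_cancel₀ hg'
    unfold hform at h
    have e1 := congrArg (· * (x.1 - y.1)) h1
    have e2 := congrArg (· * (x.2 - y.2)) h2
    linear_combination h - e1 + e2
  have h4 : (prim k).2 ∣ (x.1 - y.1) := by
    apply hcop.symm.dvd_of_dvd_mul_left
    exact ⟨_, h3⟩
  by_cases hz : (prim k).2 = 0
  · have h5 : (prim k).1 ∣ (x.2 - y.2) := by
      apply hcop.dvd_of_dvd_mul_left
      exact ⟨_, h3.symm⟩
    obtain ⟨j, hj⟩ := h5
    refine ⟨j, ?_⟩
    have hx : x.1 - y.1 = 0 := by rw [hz] at h4; simpa using h4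
    ext
    · simp [hz]; omega
    · simp; linarith [mul_comm j (prim k).1]
  · obtain ⟨j, hj⟩ := h4
    refine ⟨j, ?_⟩
    have h6 : x.2 - y.2 = (prim k).1 * j := by
      apply mul_left_cancel₀ hz
      rw [← h3, hj]; ring
    ext
    · simp; linarith [mul_comm j (prim k).2]
    · simp; linarith [mul_comm j (prim k).1]

/-- A nonempty level set is contained in one line with step `(prim k).swap`, which `j` parametrizes
injectively. For an empty one any base point serves. -/
lemma tsum_hform_eq_le {k : ℤ × ℤ} (hk : k ≠ 0) (ν : ℤ) (F : ℤ × ℤ → ℝ≥0∞) :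
    ∃ c, ∑' x, (if hform k x = ν then F x else 0) ≤ ∑' j : ℤ, F (c + j • (prim k).swap) := by
  by_cases hex : ∃ c, hform k c = ν
  · obtain ⟨c, hc⟩ := hex
    refine ⟨c, ?_⟩
    have hinj : Function.Injective fun j : ℤ => c + j • (prim k).swap := by
      have hne : (prim k).swap ≠ 0 := by
        intro h
        apply prim_ne_zero hk
        rw [← Prod.swap_swap (prim k), h]; rfl
      intro i j hij
      exact smul_left_injective ℤ hne (add_left_cancel hij)
    have hsupp : Function.support (fun x => if hform k x = ν then F x else 0) ⊆
        Set.range fun j : ℤ => c + j • (prim k).swap := by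
      intro x hx
      have hx' : hform k x = ν := by
        by_contra h; simp [h] at hx
      obtain ⟨j, hj⟩ := exists_smul_of_hform_eq hk (hx'.trans hc.symm)
      exact ⟨j, hj.symm⟩
    rw [← hinj.tsum_eq hsupp]
    refine ENNReal.tsum_le_tsum fun j => ?_
    split_ifs
    · exact le_rfl
    · exact zero_le
  · push Not at hex
    refine ⟨0, ?_⟩
    simp [hex]

/-- The ordering `⟨y⟩ ≤ ⟨x⟩` lets decay in `x` be traded for decay in `y`. The single near point is
bounded by the weight of `y`; the far points yield the exponent `ε` to `y` and keep `1 + ε` for the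
sum along the line, which gains a power of `‖prim k‖`. -/
lemma exists_tsum_line_le {ε : ℝ} (hε : 0 < ε) : ∃ C : ℝ≥0∞, C ≠ ⊤ ∧
    ∀ (k : ℤ × ℤ) (ν : ℤ) (y : ℤ × ℤ), k ≠ 0 →
      ∑' x, (if hform k x = ν then (if bracket y ≤ bracket x then wt (1 + 2 * ε) x else 0) else 0)
        ≤ wt (1 + 2 * ε) y + wt ε y * (C * ENNReal.ofReal (‖prim k‖ ^ (-(1 + ε)))) := by
  obtain ⟨C, hC, h⟩ := exists_tsum_line_far_le (ρ := 1 + ε) (by linarith)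
  refine ⟨C, hC, fun k ν y hk => ?_⟩
  obtain ⟨c, hc⟩ := tsum_hform_eq_le hk ν
    (fun x => if bracket y ≤ bracket x then wt (1 + 2 * ε) x else 0)
  refine hc.trans ?_
  have hv : (prim k).swap ≠ 0 := by
    intro h
    apply prim_ne_zero hk
    rw [← Prod.swap_swap (prim k), h]; rfl
  have h1 := tsum_line_near_le c hv (wt (1 + 2 * ε) y)
  have h2 := h c _ hv
  rw [norm_swap_int] at h1 h2
  refine le_trans ?_ (add_le_add h1 (mul_le_mul_right h2 (wt ε y)))
  rw [← ENNReal.tsum_mul_left, ← ENNReal.tsum_add]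
  refine ENNReal.tsum_le_tsum fun j => ?_
  set x := c + j • (prim k).swap
  by_cases hxy : bracket y ≤ bracket x
  · by_cases hx : bracket x < ‖prim k‖ / 2
    · simp only [hxy, hx, if_true]
      exact (wt_anti (by linarith) hxy).trans (le_add_of_nonneg_right zero_le)
    · simp only [hxy, hx, if_true, if_false, not_lt.mp hx, zero_add]
      rw [show 1 + 2 * ε = ε + (1 + ε) by ring, wt_add]
      gcongr
      exact wt_anti hε.le hxy
  · simp [hxy]

/-- Writing `n - x = g v` with `v` primitive, the sum becomes a sum over directions of sums along
lines through `n`. If `⟨x⟩ < ‖v‖ / 2` the factor in `‖v‖` is itself decay in `x`; otherwise the line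
sum gives `‖v‖^{-ρ}`, and `ρ + 1 + ε > 2` makes the sum over `v` converge. -/
lemma exists_tsum_prim_le {ρ ε : ℝ} (hρ : 1 < ρ) (hε : 0 < ε) : ∃ C : ℝ≥0∞, C ≠ ⊤ ∧
    ∀ n : ℤ × ℤ, ∑' x, (if x ≠ n then wt ρ x * ENNReal.ofReal (‖prim (n - x)‖ ^ (-(1 + ε))) else 0)
      ≤ C := by
  obtain ⟨C, hC, h⟩ := exists_tsum_line_far_le hρ
  have hS := tsum_wt_ne_top (ρ := ρ + (1 + ε)) (by linarith)
  have hnorm : ∀ v : ℤ × ℤ, v ≠ 0 → ENNReal.ofReal (‖v‖ ^ (-(ρ + (1 + ε)))) ≤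
      ENNReal.ofReal (2 ^ (ρ + (1 + ε))) * wt (ρ + (1 + ε)) v := by
    intro v hv
    have h1 := one_le_norm_int_prod hv
    rw [wt, ← ENNReal.ofReal_mul (by positivity)]
    refine ENNReal.ofReal_le_ofReal ?_
    have hb : bracket v / 2 ≤ ‖v‖ := by
      have h3 : |(v.1 : ℝ)| ≤ ‖v‖ := by
        rw [Prod.norm_def, ← Int.norm_eq_abs]; exact le_max_left _ _
      have h4 : |(v.2 : ℝ)| ≤ ‖v‖ := by
        rw [Prod.norm_def, ← Int.norm_eq_abs]; exact le_max_right _ _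
      rw [div_le_iff₀ (by norm_num), bracket]
      apply Real.sqrt_le_iff.mpr
      refine ⟨by positivity, ?_⟩
      have h5 := sq_le_sq' (by linarith [abs_nonneg (v.1 : ℝ)]) h3
      have h6 := sq_le_sq' (by linarith [abs_nonneg (v.2 : ℝ)]) h4
      rw [sq_abs] at h5 h6
      nlinarith
    have hbp := bracket_pos v
    calc ‖v‖ ^ (-(ρ + (1 + ε))) ≤ (bracket v / 2) ^ (-(ρ + (1 + ε))) :=
          Real.rpow_le_rpow_of_nonpos (by positivity) hb (by linarith)
      _ = _ := by
          rw [Real.div_rpow hbp.le (by norm_num), Real.rpow_neg (by norm_num : (0:ℝ) ≤ 2)]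
          field_simp
  refine ⟨∑' n, wt (ρ + (1 + ε)) n + C * (ENNReal.ofReal (2 ^ (ρ + (1 + ε))) *
    ∑' n, wt (ρ + (1 + ε)) n), ?_, fun n => ?_⟩
  · exact ENNReal.add_ne_top.mpr ⟨hS, ENNReal.mul_ne_top hC
      (ENNReal.mul_ne_top ENNReal.ofReal_ne_top hS)⟩
  -- `H` is summed over all nonzero directions and all multiples; injectivity of `e` bounds the
  -- original sum by this larger one.
  let H : (ℤ × ℤ) × ℤ → ℝ≥0∞ := fun z => if z.1 ≠ 0 then
    ENNReal.ofReal (‖z.1‖ ^ (-(1 + ε))) *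
      (if ‖-z.1‖ / 2 ≤ bracket (n + z.2 • (-z.1)) then wt ρ (n + z.2 • (-z.1)) else 0) else 0
  let e : ℤ × ℤ → (ℤ × ℤ) × ℤ := fun x => (prim (n - x), (Int.gcd (n - x).1 (n - x).2 : ℤ))
  have hback : ∀ x, n + (e x).2 • (-(e x).1) = x := by
    intro x
    simp only [e, smul_neg, gcd_smul_prim]; abel
  have he : Function.Injective e := by
    intro x y hxy
    rw [← hback x, ← hback y, hxy]
  have hle : ∀ x, (if x ≠ n then wt ρ x * ENNReal.ofReal (‖prim (n - x)‖ ^ (-(1 + ε))) else 0) ≤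
      wt (ρ + (1 + ε)) x + H (e x) := by
    intro x
    by_cases hx : x ≠ n
    · have hv : prim (n - x) ≠ 0 := prim_ne_zero (sub_ne_zero.mpr hx.symm)
      have h1 := one_le_norm_int_prod hv
      simp only [hx, ne_eq, not_false_eq_true, if_true, H, hback]
      by_cases hb : ‖prim (n - x)‖ / 2 ≤ bracket x
      · have hv' : (e x).1 ≠ 0 := hv
        rw [norm_neg, if_pos hv']
        simp only [e, hb, if_true]
        rw [mul_comm]
        exact le_add_of_nonneg_left zero_le
      · refine le_trans ?_ (le_add_of_nonneg_right zero_le)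
        rw [wt_add]
        gcongr
        refine ENNReal.ofReal_le_ofReal ?_
        refine Real.rpow_le_rpow_of_nonpos (bracket_pos x) ?_ (by linarith)
        linarith
    · simp [hx]
  calc _ ≤ ∑' x, (wt (ρ + (1 + ε)) x + H (e x)) := ENNReal.tsum_le_tsum hle
    _ = ∑' x, wt (ρ + (1 + ε)) x + ∑' x, H (e x) := ENNReal.tsum_add
    _ ≤ ∑' x, wt (ρ + (1 + ε)) x + ∑' z, H z := by
        gcongr
        exact ENNReal.tsum_comp_le_tsum_of_injective he H
    _ ≤ _ := by
        gcongr
        rw [ENNReal.tsum_prod', ← ENNReal.tsum_mul_left, ← ENNReal.tsum_mul_left]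
        refine ENNReal.tsum_le_tsum fun v => ?_
        by_cases hv : v ≠ 0
        · simp only [H, hv, ne_eq, not_false_eq_true, if_true]
          rw [ENNReal.tsum_mul_left]
          have h1 := one_le_norm_int_prod hv
          calc _ ≤ ENNReal.ofReal (‖v‖ ^ (-(1 + ε))) * (C * ENNReal.ofReal (‖-v‖ ^ (-ρ))) := by
                gcongr
                exact h n (-v) (neg_ne_zero.mpr hv)
            _ = C * ENNReal.ofReal (‖v‖ ^ (-(ρ + (1 + ε)))) := by
                rw [norm_neg, mul_left_comm, ← ENNReal.ofReal_mul (by positivity),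
                  ← Real.rpow_add (by linarith)]
                congr 3; ring
            _ ≤ _ := by gcongr; exact hnorm v hv
        · have h0 : ∀ b : ℤ, H (v, b) = 0 := fun b => if_neg hv
          rw [tsum_congr h0, tsum_zero]
          exact zero_le

/-! ### The divisor bound and lattice points on hyperbolas. -/

/-- The divisor bound `d(n) ≪ n^ε`. -/
lemma exists_card_divisors_le {ε : ℝ} (hε : 0 < ε) : ∃ C : ℝ, 0 ≤ C ∧
    ∀ n : ℕ, n ≠ 0 → (n.divisors.card : ℝ) ≤ C * (n : ℝ) ^ ε := by
  -- Bernoulli's inequality for `2^ε = 1 + (2^ε - 1)`: exponential growth beats linear growth up to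
  -- a constant.
  obtain ⟨K, hK1, hK⟩ : ∃ K : ℝ, 1 ≤ K ∧ ∀ a : ℕ, (a + 1 : ℝ) ≤ K * ((2 : ℝ) ^ ε) ^ a := by
    have hb : 0 < (2 : ℝ) ^ ε - 1 := by
      have := Real.one_lt_rpow (by norm_num : (1 : ℝ) < 2) hε
      linarith
    refine ⟨max 1 (1 / ((2 : ℝ) ^ ε - 1)), le_max_left _ _, fun a => ?_⟩
    have h1 := one_add_mul_le_pow (a := (2 : ℝ) ^ ε - 1) (by linarith) a
    rw [add_sub_cancel] at h1
    have h2 : (a : ℝ) + 1 ≤ max 1 (1 / ((2 : ℝ) ^ ε - 1)) * (1 + a * ((2 : ℝ) ^ ε - 1)) := by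
      have h3 : 1 ≤ max 1 (1 / ((2 : ℝ) ^ ε - 1)) * ((2 : ℝ) ^ ε - 1) := by
        calc 1 = 1 / ((2 : ℝ) ^ ε - 1) * ((2 : ℝ) ^ ε - 1) := by field_simp
          _ ≤ _ := by gcongr; exact le_max_right _ _
      have h4 : 1 ≤ max 1 (1 / ((2 : ℝ) ^ ε - 1)) := le_max_left _ _
      nlinarith [(Nat.cast_nonneg a : (0 : ℝ) ≤ a)]
    exact h2.trans (by gcongr)
  -- For primes beyond `P` the bound `a + 1 ≤ 2^a ≤ (p^ε)^a` needs no constant, so only the primes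
  -- below `P` contribute a factor `K`, altogether at most `K ^ P`.
  obtain ⟨P, hP⟩ : ∃ P : ℕ, ∀ p : ℕ, P ≤ p → 2 ≤ (p : ℝ) ^ ε := by
    refine ⟨⌈(2 : ℝ) ^ (1 / ε)⌉₊, fun p hp => ?_⟩
    have h1 : (2 : ℝ) ^ (1 / ε) ≤ p := (Nat.le_ceil _).trans (by exact_mod_cast hp)
    calc (2 : ℝ) = ((2 : ℝ) ^ (1 / ε)) ^ ε := by
          rw [← Real.rpow_mul (by norm_num), one_div_mul_cancel hε.ne', Real.rpow_one]
      _ ≤ _ := by gcongr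
  have hstep : ∀ p a : ℕ, p.Prime → (a + 1 : ℝ) ≤ (if p < P then K else 1) * ((p : ℝ) ^ ε) ^ a := by
    intro p a hp
    split_ifs with h
    · refine (hK a).trans ?_
      gcongr
      exact_mod_cast hp.two_le
    · rw [one_mul]
      calc (a + 1 : ℝ) ≤ 2 ^ a := by exact_mod_cast Nat.lt_two_pow_self
        _ ≤ _ := by gcongr; exact hP p (not_lt.mp h)
  have hprod : ∀ n : ℕ, n ≠ 0 →
      (n.divisors.card : ℝ) ≤ (∏ p ∈ n.primeFactors, if p < P then K else 1) * (n : ℝ) ^ ε := by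
    intro n hn
    rw [Nat.card_divisors hn]
    have hfac : (n : ℝ) ^ ε = ∏ p ∈ n.primeFactors, ((p : ℝ) ^ ε) ^ n.factorization p := by
      conv_lhs => rw [← Nat.prod_factorization_pow_eq_self hn]
      rw [Finsupp.prod, Nat.support_factorization, Nat.cast_prod,
        ← Real.finsetProd_rpow _ _ (fun _ _ => Nat.cast_nonneg _)]
      refine Finset.prod_congr rfl fun p _ => ?_
      rw [Nat.cast_pow, ← Real.rpow_natCast, ← Real.rpow_natCast, ← Real.rpow_mul (by positivity),
        ← Real.rpow_mul (by positivity), mul_comm]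
    rw [hfac, ← Finset.prod_mul_distrib]
    push_cast
    refine Finset.prod_le_prod (fun _ _ => by positivity) fun p hp => ?_
    exact hstep p _ (Nat.prime_of_mem_primeFactors hp)
  refine ⟨K ^ P, by positivity, fun n hn => (hprod n hn).trans ?_⟩
  gcongr
  rw [Finset.prod_ite, Finset.prod_const, Finset.prod_const, one_pow, mul_one]
  refine pow_le_pow_right₀ hK1 ?_
  calc _ ≤ (Finset.range P).card := Finset.card_le_card (by
        intro p hp; simp at hp; simp [hp.2])
    _ = P := by simp

/-- A root different from `y₁` and `y₂` would satisfy two linear equations whose difference is `α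
(y₂ - y₁) = 0`. It says that a vertical line meets the conics below in at most two points. -/
lemma sq_sub_eq_two_values {α : ℤ} (hα : α ≠ 0) (d e : ℤ) :
    ∃ y₁ y₂ : ℤ, ∀ y, (α * y - d) ^ 2 = e → y = y₁ ∨ y = y₂ := by
  by_cases h : ∃ y₁, (α * y₁ - d) ^ 2 = e
  · obtain ⟨y₁, h1⟩ := h
    by_cases h' : ∃ y₂, (α * y₂ - d) ^ 2 = e ∧ y₂ ≠ y₁
    · obtain ⟨y₂, h2, hne⟩ := h'
      refine ⟨y₁, y₂, fun y hy => ?_⟩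
      by_contra! hy'
      have e1 : α * ((y - y₁) * (α * (y + y₁) - 2 * d)) = 0 := by linear_combination hy - h1
      have e2 : α * ((y - y₂) * (α * (y + y₂) - 2 * d)) = 0 := by linear_combination hy - h2
      have f1 := (mul_eq_zero.mp ((mul_eq_zero.mp e1).resolve_left hα)).resolve_left
        (sub_ne_zero.mpr hy'.1)
      have f2 := (mul_eq_zero.mp ((mul_eq_zero.mp e2).resolve_left hα)).resolve_left
        (sub_ne_zero.mpr hy'.2)
      have f3 : α * (y₂ - y₁) = 0 := by linear_combination f2 - f1
      exact (mul_ne_zero hα (sub_ne_zero.mpr hne)) f3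
    · push Not at h'
      exact ⟨y₁, y₁, fun y hy => Or.inl (h' y hy)⟩
  · push Not at h
    exact ⟨0, 0, fun y hy => absurd hy (h y)⟩

/-- A subset of `ℤ²` with at most two points in each column carries a summable weight. -/
lemma exists_tsum_two_per_column_le {ρ : ℝ} (hρ : 1 < ρ) : ∃ C : ℝ≥0∞, C ≠ ⊤ ∧
    ∀ S : ℤ × ℤ → Prop, ∀ _ : DecidablePred S,
      (∀ x, ∃ y₁ y₂ : ℤ, ∀ y, S (x, y) → y = y₁ ∨ y = y₂) →
      ∑' n, (if S n then wt ρ n else 0) ≤ C := by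
  obtain ⟨C, hC, h⟩ := exists_tsum_shift_le hρ
  refine ⟨ENNReal.ofReal (2 ^ ρ) * C * 2, ENNReal.mul_ne_top
    (ENNReal.mul_ne_top ENNReal.ofReal_ne_top hC) (by norm_num), fun S _ hS => ?_⟩
  rw [ENNReal.tsum_prod']
  calc _ ≤ ∑' x : ℤ, ENNReal.ofReal (2 ^ ρ) * ENNReal.ofReal ((1 + |(x : ℝ) + 0|) ^ (-ρ)) * 2 := by
        refine ENNReal.tsum_le_tsum fun x => ?_
        obtain ⟨y₁, y₂, hy⟩ := hS x
        have hb : ∀ y : ℤ, wt ρ (x, y) ≤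
            ENNReal.ofReal (2 ^ ρ) * ENNReal.ofReal ((1 + |(x : ℝ) + 0|) ^ (-ρ)) := by
          intro y
          rw [wt, ← ENNReal.ofReal_mul (by positivity), add_zero]
          refine ENNReal.ofReal_le_ofReal ?_
          have h1 : (1 + |(x : ℝ)|) / 2 ≤ bracket (x, y) := by
            have := abs_fst_le_bracket (x, y)
            have := one_le_bracket (x, y)
            simp only at *
            linarith
          calc _ ≤ ((1 + |(x : ℝ)|) / 2) ^ (-ρ) :=
                Real.rpow_le_rpow_of_nonpos (by positivity) h1 (by linarith)
            _ = _ := by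
              rw [Real.div_rpow (by positivity) (by norm_num),
                Real.rpow_neg (by norm_num : (0:ℝ) ≤ 2)]
              field_simp
        set A := ENNReal.ofReal (2 ^ ρ) * ENNReal.ofReal ((1 + |(x : ℝ) + 0|) ^ (-ρ))
        calc _ ≤ ∑' y : ℤ, ((if y = y₁ then A else 0) + (if y = y₂ then A else 0)) := by
              refine ENNReal.tsum_le_tsum fun y => ?_
              split_ifs with h1 h2 h3 h3
              · exact (hb y).trans (le_add_of_nonneg_right zero_le)
              · exact (hb y).trans (le_add_of_nonneg_right zero_le)
              · exact (hb y).trans (le_add_of_nonneg_left zero_le)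
              · rcases hy y h1 with h4 | h4
                · exact absurd h4 h2
                · exact absurd h4 h3
              all_goals exact zero_le
          _ = A * 2 := by
              rw [ENNReal.tsum_add, tsum_ite_eq, tsum_ite_eq, mul_two]
    _ ≤ _ := by
        rw [ENNReal.tsum_mul_right, ENNReal.tsum_mul_left]
        gcongr
        exact h 0

/-- Three points of the hyperbola `YZ = c` in a box of side `A` force `|c| ≤ A⁶`. -/
lemma abs_le_pow_six_of_three_points {c A Y₁ Y₂ Y₃ Z₁ Z₂ Z₃ : ℤ} (hc : c ≠ 0)
    (h1 : Y₁ * Z₁ = c) (h2 : Y₂ * Z₂ = c) (h3 : Y₃ * Z₃ = c)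
    (h12 : Y₁ ≠ Y₂) (h13 : Y₁ ≠ Y₃) (h23 : Y₂ ≠ Y₃)
    (hY12 : |Y₁ - Y₂| ≤ A) (hY13 : |Y₁ - Y₃| ≤ A) (hY23 : |Y₂ - Y₃| ≤ A)
    (hZ12 : |Z₁ - Z₂| ≤ A) (hZ13 : |Z₁ - Z₃| ≤ A) (hZ23 : |Z₂ - Z₃| ≤ A) : |c| ≤ A ^ 6 := by
  have hA : 0 ≤ A := (abs_nonneg _).trans hY12
  -- `D` is twice the signed area of the triangle formed by the three points. It is a nonzero
  -- integer, since no three points of the hyperbola are collinear, and therefore at least `1` in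
  -- absolute value.
  obtain ⟨D, hD⟩ : ∃ D : ℤ, D = (Y₂ - Y₁) * (Z₃ - Z₁) - (Y₃ - Y₁) * (Z₂ - Z₁) := ⟨_, rfl⟩
  have hY0 : Y₁ * Y₂ * Y₃ ≠ 0 := by
    intro h
    rcases mul_eq_zero.mp h with h | h
    · rcases mul_eq_zero.mp h with h | h
      · rw [h, zero_mul] at h1; exact hc h1.symm
      · rw [h, zero_mul] at h2; exact hc h2.symm
    · rw [h, zero_mul] at h3; exact hc h3.symm
  -- Substituting `Z = c / Y` makes the determinant a Vandermonde product, whose factors are the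
  -- differences bounded by `A`.
  have eY : D * (Y₁ * Y₂ * Y₃) = -c * ((Y₁ - Y₂) * (Y₁ - Y₃) * (Y₂ - Y₃)) := by
    rw [hD]
    linear_combination -(Y₂ ^ 2 * Y₃ - Y₂ * Y₃ ^ 2) * h1 - (Y₃ ^ 2 * Y₁ - Y₃ * Y₁ ^ 2) * h2
      - (Y₁ ^ 2 * Y₂ - Y₁ * Y₂ ^ 2) * h3
  have eZ : D * (Z₁ * Z₂ * Z₃) = c * ((Z₁ - Z₂) * (Z₁ - Z₃) * (Z₂ - Z₃)) := by
    rw [hD]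
    linear_combination (Z₂ ^ 2 * Z₃ - Z₂ * Z₃ ^ 2) * h1 + (Z₃ ^ 2 * Z₁ - Z₃ * Z₁ ^ 2) * h2
      + (Z₁ ^ 2 * Z₂ - Z₁ * Z₂ ^ 2) * h3
  have hD0 : D ≠ 0 := by
    intro h
    rw [h, zero_mul] at eY
    exact mul_ne_zero (neg_ne_zero.mpr hc) (mul_ne_zero (mul_ne_zero (sub_ne_zero.mpr h12) (sub_ne_zero.mpr h13))
      (sub_ne_zero.mpr h23)) eY.symm
  have hD1 : 1 ≤ |D| := Int.one_le_abs hD0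
  have bY : |Y₁ * Y₂ * Y₃| ≤ |c| * A ^ 3 := by
    calc |Y₁ * Y₂ * Y₃| ≤ |D| * |Y₁ * Y₂ * Y₃| := le_mul_of_one_le_left (abs_nonneg _) hD1
      _ = |c| * (|Y₁ - Y₂| * |Y₁ - Y₃| * |Y₂ - Y₃|) := by
          rw [← abs_mul, eY]; simp only [abs_mul, abs_neg]
      _ ≤ |c| * (A * A * A) := by gcongr
      _ = _ := by ring
  have bZ : |Z₁ * Z₂ * Z₃| ≤ |c| * A ^ 3 := by
    calc |Z₁ * Z₂ * Z₃| ≤ |D| * |Z₁ * Z₂ * Z₃| := le_mul_of_one_le_left (abs_nonneg _) hD1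
      _ = |c| * (|Z₁ - Z₂| * |Z₁ - Z₃| * |Z₂ - Z₃|) := by
          rw [← abs_mul, eZ]; simp only [abs_mul]
      _ ≤ |c| * (A * A * A) := by gcongr
      _ = _ := by ring
  -- Multiplying the three equations `Y Z = c` joins the bounds for the `Y`'s and the `Z`'s.
  have hprod : |c| ^ 3 ≤ |c| ^ 2 * A ^ 6 := by
    calc |c| ^ 3 = |Y₁ * Y₂ * Y₃| * |Z₁ * Z₂ * Z₃| := by
          rw [← abs_mul, ← abs_pow]; congr 1
          calc c ^ 3 = (Y₁ * Z₁) * (Y₂ * Z₂) * (Y₃ * Z₃) := by rw [h1, h2, h3]; ring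
            _ = _ := by ring
      _ ≤ (|c| * A ^ 3) * (|c| * A ^ 3) := by gcongr
      _ = _ := by ring
  have hcpos : 0 < |c| ^ 2 := by positivity
  have : |c| ^ 2 * |c| ≤ |c| ^ 2 * A ^ 6 := by linarith [show |c| ^ 2 * |c| = |c| ^ 3 by ring]
  exact le_of_mul_le_mul_left this hcpos

/-- In the coordinates `Y`, `Z` the conic is `Y Z = c`, but `c` may be huge compared with `N`, so
the divisor bound alone is not enough. Either there are at most two points, or three of them force
`|c| ≤ (8N)^6`, and the divisor bound with exponent `ε / 6` gives `N^ε` uniformly in `c` and `d`. -/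
lemma exists_card_conic_le {ε : ℝ} (hε : 0 < ε) : ∃ C : ℝ, 0 ≤ C ∧
    ∀ (c : ℤ) (d : ℤ × ℤ) (N : ℕ) (F : Finset (ℤ × ℤ)), c ≠ 0 → 1 ≤ N →
      (∀ x ∈ F, (2 * x.1 - d.1) ^ 2 - (2 * x.2 - d.2) ^ 2 = c ∧ |x.1| ≤ N ∧ |x.2| ≤ N) →
      (F.card : ℝ) ≤ C * (N : ℝ) ^ ε := by
  obtain ⟨C, hC, h⟩ := exists_card_divisors_le (ε := ε / 6) (by positivity)
  refine ⟨max 2 (2 * C * 8 ^ ε), by positivity, fun c d N F hc hN hF => ?_⟩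
  have hN1 : (1 : ℝ) ≤ (N : ℝ) ^ ε := Real.one_le_rpow (by exact_mod_cast hN) hε.le
  let Y : ℤ × ℤ → ℤ := fun x => (2 * x.1 - d.1) + (2 * x.2 - d.2)
  let Z : ℤ × ℤ → ℤ := fun x => (2 * x.1 - d.1) - (2 * x.2 - d.2)
  have hYZ : ∀ x ∈ F, Y x * Z x = c := by
    intro x hx
    rw [← (hF x hx).1]; simp only [Y, Z]; ring
  have hYinj : ∀ x ∈ F, ∀ y ∈ F, Y x = Y y → x = y := by
    intro x hx y hy hxy
    have hY0 : Y x ≠ 0 := by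
      intro h0
      have := hYZ x hx
      rw [h0, zero_mul] at this
      exact hc this.symm
    have hZ : Z x = Z y := by
      apply mul_left_cancel₀ hY0
      rw [hYZ x hx, hxy, hYZ y hy]
    simp only [Y, Z] at hxy hZ
    ext <;> omega
  by_cases hcard : F.card ≤ 2
  · calc (F.card : ℝ) ≤ 2 := by exact_mod_cast hcard
      _ ≤ max 2 (2 * C * 8 ^ ε) * 1 := by rw [mul_one]; exact le_max_left _ _
      _ ≤ _ := by gcongr
  · push Not at hcard
    obtain ⟨x, hx, y, hy, z, hz, hxy, hxz, hyz⟩ := Finset.two_lt_card.mp hcard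
    have hdiff : ∀ a ∈ F, ∀ b ∈ F, |Y a - Y b| ≤ 8 * N ∧ |Z a - Z b| ≤ 8 * N := by
      intro a ha b hb
      obtain ⟨-, a1, a2⟩ := hF a ha
      obtain ⟨-, b1, b2⟩ := hF b hb
      rw [abs_le] at a1 a2 b1 b2
      simp only [Y, Z]
      constructor <;> rw [abs_le] <;> constructor <;> linarith
    have hc6 : |c| ≤ (8 * N : ℤ) ^ 6 := by
      apply abs_le_pow_six_of_three_points hc (hYZ x hx) (hYZ y hy) (hYZ z hz)
      · exact fun e => hxy (hYinj x hx y hy e)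
      · exact fun e => hxz (hYinj x hx z hz e)
      · exact fun e => hyz (hYinj y hy z hz e)
      · exact (hdiff x hx y hy).1
      · exact (hdiff x hx z hz).1
      · exact (hdiff y hy z hz).1
      · exact (hdiff x hx y hy).2
      · exact (hdiff x hx z hz).2
      · exact (hdiff y hy z hz).2
    have hcn : c.natAbs ≠ 0 := Int.natAbs_ne_zero.mpr hc
    -- A point is determined by `Y`, a divisor of `c`; the Boolean records the sign lost in
    -- `natAbs`.
    have hcard2 : F.card ≤ (c.natAbs.divisors ×ˢ (Finset.univ : Finset Bool)).card := by
      apply Finset.card_le_card_of_injOn (fun a => ((Y a).natAbs, decide (0 ≤ Y a)))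
      · intro a ha
        simp only [Finset.coe_product, Set.mem_prod, Finset.mem_coe, Nat.mem_divisors,
          Finset.mem_univ, and_true]
        refine ⟨Int.natAbs_dvd_natAbs.mpr ⟨_, (hYZ a ha).symm⟩, hcn⟩
      · intro a ha b hb hab
        simp only [Prod.mk.injEq, decide_eq_decide] at hab
        apply hYinj a ha b hb
        omega
    rw [Finset.card_product, Finset.card_univ, Fintype.card_bool] at hcard2
    have hcR : (c.natAbs : ℝ) ≤ (8 * N : ℝ) ^ 6 := by
      have : (c.natAbs : ℤ) ≤ (8 * N : ℤ) ^ 6 := by rw [Int.natCast_natAbs]; exact hc6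
      exact_mod_cast this
    calc (F.card : ℝ) ≤ c.natAbs.divisors.card * 2 := by exact_mod_cast hcard2
      _ ≤ C * (c.natAbs : ℝ) ^ (ε / 6) * 2 := by gcongr; exact h _ hcn
      _ ≤ C * ((8 * N : ℝ) ^ 6) ^ (ε / 6) * 2 := by gcongr
      _ = 2 * C * 8 ^ ε * (N : ℝ) ^ ε := by
          rw [← Real.rpow_natCast, ← Real.rpow_mul (by positivity),
            show ((6 : ℕ) : ℝ) * (ε / 6) = ε by push_cast; ring,
            Real.mul_rpow (by norm_num) (by positivity)]
          ring
      _ ≤ _ := by gcongr; exact le_max_right _ _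

/-- Dyadic shells: the shell of size `2^i` carries `O(2^{iε})` points of weight at most `2^{-2iε}`,
which leaves a geometric series. -/
lemma exists_tsum_conic_le {ε : ℝ} (hε : 0 < ε) : ∃ C : ℝ≥0∞, C ≠ ⊤ ∧
    ∀ (c : ℤ) (d : ℤ × ℤ), c ≠ 0 →
      ∑' x : ℤ × ℤ, (if (2 * x.1 - d.1) ^ 2 - (2 * x.2 - d.2) ^ 2 = c then wt (2 * ε) x else 0)
        ≤ C := by
  obtain ⟨C, hC, h⟩ := exists_card_conic_le hε
  have hr0 : 0 < (2 : ℝ) ^ (-ε) := by positivity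
  have hr1 : (2 : ℝ) ^ (-ε) < 1 :=
    Real.rpow_lt_one_of_one_lt_of_neg (by norm_num) (by linarith)
  refine ⟨∑' i : ℕ, ENNReal.ofReal (C * 2 ^ ε * ((2 : ℝ) ^ (-ε)) ^ i), ?_, fun c d hc => ?_⟩
  · rw [← ENNReal.ofReal_tsum_of_nonneg (fun i => by positivity)
      ((summable_geometric_of_lt_one hr0.le hr1).mul_left _)]
    exact ENNReal.ofReal_ne_top
  · let P : ℤ × ℤ → Prop := fun x => (2 * x.1 - d.1) ^ 2 - (2 * x.2 - d.2) ^ 2 = c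
    have hsplit : ∀ x : ℤ × ℤ, (if P x then wt (2 * ε) x else 0) ≤ ∑' i : ℕ,
        (if P x ∧ (2 : ℝ) ^ i ≤ bracket x ∧ bracket x < 2 ^ (i + 1) then wt (2 * ε) x else 0) := by
      intro x
      obtain ⟨i, hi⟩ := exists_nat_pow_near (one_le_bracket x) (by norm_num : (1 : ℝ) < 2)
      refine le_trans ?_ (ENNReal.le_tsum i)
      by_cases hP : P x
      · simp [hP, hi.1, hi.2]
      · simp [hP]
    refine (ENNReal.tsum_le_tsum hsplit).trans ?_
    rw [ENNReal.tsum_comm]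
    refine ENNReal.tsum_le_tsum fun i => ?_
    rw [ENNReal.tsum_eq_iSup_sum]
    refine iSup_le fun F => ?_
    rw [← Finset.sum_filter]
    have hw : ∀ x ∈ F.filter (fun x => P x ∧ (2 : ℝ) ^ i ≤ bracket x ∧ bracket x < 2 ^ (i + 1)),
        wt (2 * ε) x ≤ ENNReal.ofReal (((2 : ℝ) ^ i) ^ (-(2 * ε))) := by
      intro x hx
      refine ENNReal.ofReal_le_ofReal ?_
      exact Real.rpow_le_rpow_of_nonpos (by positivity) (Finset.mem_filter.mp hx).2.2.1 (by linarith)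
    refine (Finset.sum_le_card_nsmul _ _ _ hw).trans ?_
    have hcard := h c d (2 ^ (i + 1)) (F.filter fun x => P x ∧ (2 : ℝ) ^ i ≤ bracket x ∧
      bracket x < 2 ^ (i + 1)) hc Nat.one_le_two_pow (by
        intro x hx
        obtain ⟨-, h1, -, h3⟩ := Finset.mem_filter.mp hx
        refine ⟨h1, ?_, ?_⟩
        · have := (abs_fst_le_bracket x).trans h3.le
          exact_mod_cast this
        · have := (abs_snd_le_bracket x).trans h3.le
          exact_mod_cast this)
    rw [nsmul_eq_mul, ← ENNReal.ofReal_natCast, ← ENNReal.ofReal_mul (by positivity)]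
    refine ENNReal.ofReal_le_ofReal ?_
    calc _ ≤ C * ((2 ^ (i + 1) : ℕ) : ℝ) ^ ε * ((2 : ℝ) ^ i) ^ (-(2 * ε)) := by gcongr
      _ = _ := by
        push_cast
        rw [pow_succ, Real.mul_rpow (by positivity) (by positivity), ← Real.rpow_natCast,
          ← Real.rpow_mul (by positivity), ← Real.rpow_mul (by positivity), ← Real.rpow_natCast,
          ← Real.rpow_mul (by positivity)]
        have : (2 : ℝ) ^ ((i : ℝ) * ε) * 2 ^ ((i : ℝ) * -(2 * ε)) = 2 ^ (-ε * i) := by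
          rw [← Real.rpow_add (by norm_num)]; congr 1; ring
        rw [← this]; ring

/-! ### Sums of two weights over a level set of the resonance function. -/

/-- For each `y` the variable `x` runs over a line whose offset may depend on `y`. The near point
leaves the exponent `2 + 4ε` on `y`, summable by itself; the far points leave `1 + 3ε` and a power
of `‖prim (n - y)‖`. -/
lemma exists_tsum_tsum_line_le {ε : ℝ} (hε : 0 < ε) : ∃ C : ℝ≥0∞, C ≠ ⊤ ∧
    ∀ (n : ℤ × ℤ) (ν : ℤ × ℤ → ℤ), ∑' y : ℤ × ℤ, ∑' x : ℤ × ℤ,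
      (if y ≠ n ∧ hform (n - y) x = ν y ∧ bracket y ≤ bracket x then
        wt (1 + 2 * ε) x * wt (1 + 2 * ε) y else 0) ≤ C := by
  obtain ⟨C₁, hC₁, h₁⟩ := exists_tsum_line_le hε
  obtain ⟨C₂, hC₂, h₂⟩ := exists_tsum_prim_le (ρ := 1 + 2 * ε + ε) (ε := ε) (by linarith) hε
  have hS := tsum_wt_ne_top (ρ := 1 + 2 * ε + (1 + 2 * ε)) (by linarith)
  refine ⟨∑' y, wt (1 + 2 * ε + (1 + 2 * ε)) y + C₁ * C₂,
    ENNReal.add_ne_top.mpr ⟨hS, ENNReal.mul_ne_top hC₁ hC₂⟩, fun n ν => ?_⟩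
  calc _ ≤ ∑' y, (wt (1 + 2 * ε + (1 + 2 * ε)) y + C₁ * (if y ≠ n then
        wt (1 + 2 * ε + ε) y * ENNReal.ofReal (‖prim (n - y)‖ ^ (-(1 + ε))) else 0)) := by
        refine ENNReal.tsum_le_tsum fun y => ?_
        by_cases hy : y ≠ n
        · have h := mul_le_mul_left (h₁ (n - y) (ν y) y (sub_ne_zero.mpr hy.symm)) (wt (1 + 2 * ε) y)
          rw [← ENNReal.tsum_mul_right] at h
          refine le_trans (le_of_eq (tsum_congr fun x => ?_)) (h.trans (le_of_eq ?_))
          · by_cases ha : hform (n - y) x = ν y <;> by_cases hb : bracket y ≤ bracket x <;>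
              simp [hy, ha, hb]
          · rw [if_pos hy, wt_add (1 + 2 * ε) (1 + 2 * ε), wt_add (1 + 2 * ε) ε]
            ring
        · simp [hy]
    _ ≤ _ := by
        rw [ENNReal.tsum_add, ENNReal.tsum_mul_left]
        gcongr
        exact h₂ n

/-- The level condition is affine in each of the two outer frequencies when the other is fixed, so
the one with the smaller bracket is fixed. -/
lemma exists_tsum_kernel_outer_le {σ : ℝ} (hσ : 1 < σ) : ∃ C : ℝ≥0∞, C ≠ ⊤ ∧
    ∀ (n : ℤ × ℤ) (ν : ℤ), ∑' z : (ℤ × ℤ) × (ℤ × ℤ),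
      (if z.1 ≠ n ∧ z.2 ≠ n ∧ hform (n - z.1) (n - z.2) = ν then wt σ z.1 * wt σ z.2 else 0)
        ≤ C := by
  obtain ⟨ε, hε, rfl⟩ : ∃ ε, 0 < ε ∧ σ = 1 + 2 * ε := ⟨(σ - 1) / 2, by linarith, by ring⟩
  obtain ⟨C, hC, h⟩ := exists_tsum_tsum_line_le hε
  refine ⟨C + C, ENNReal.add_ne_top.mpr ⟨hC, hC⟩, fun n ν => ?_⟩
  have key := h n fun y => hform (n - y) n - ν
  have h1 : ∀ x y : ℤ × ℤ, hform (n - x) (n - y) = ν → hform (n - y) x = hform (n - y) n - ν := by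
    intro x y hxy
    simp only [hform, Prod.fst_sub, Prod.snd_sub] at hxy ⊢
    linear_combination -hxy
  have h2 : ∀ x y : ℤ × ℤ, hform (n - x) (n - y) = ν → hform (n - x) y = hform (n - x) n - ν := by
    intro x y hxy
    simp only [hform, Prod.fst_sub, Prod.snd_sub] at hxy ⊢
    linear_combination -hxy
  refine le_trans ?_ (add_le_add key key)
  conv_rhs => arg 1; rw [ENNReal.tsum_comm]
  rw [ENNReal.tsum_prod', ← ENNReal.tsum_add]
  refine ENNReal.tsum_le_tsum fun x => ?_
  rw [← ENNReal.tsum_add]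
  refine ENNReal.tsum_le_tsum fun y => ?_
  dsimp only
  split_ifs with ha hb hc hd he <;> try exact zero_le
  · exact le_add_of_nonneg_right zero_le
  · exact le_add_of_nonneg_right zero_le
  · rw [zero_add, mul_comm]
  · exfalso
    rcases le_total (bracket x) (bracket y) with h3 | h3
    · exact hd ⟨ha.1, h2 x y ha.2.2, h3⟩
    · exact hb ⟨ha.2.1, h1 x y ha.2.2, h3⟩

/-- With `x` fixed, completing squares turns the condition on `y` into a conic with right side
`hform (n - x) (n - x) - 4ν`. If this is nonzero, the conic costs only `⟨y⟩^{-ε}`, and the rest of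
the decay goes to `x`. If it vanishes, the conic may be a pair of lines, but then `x` itself lies on
a conic; both curves have at most two points per column, so exponents above `1` suffice for each. -/
lemma exists_tsum_kernel_conic_le {ε : ℝ} (hε : 0 < ε) : ∃ C : ℝ≥0∞, C ≠ ⊤ ∧
    ∀ (n : ℤ × ℤ) (ν : ℤ), ∑' x : ℤ × ℤ, ∑' y : ℤ × ℤ,
      (if hform (y - x) (n - y) = ν ∧ bracket x ≤ bracket y then
        wt (1 + 2 * ε) x * wt (1 + 2 * ε) y else 0) ≤ C := by
  obtain ⟨C₁, hC₁, h₁⟩ := exists_tsum_conic_le (ε := ε / 2) (by linarith)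
  obtain ⟨C₂, hC₂, h₂⟩ := exists_tsum_two_per_column_le (ρ := 1 + ε) (by linarith)
  obtain ⟨C₃, hC₃, h₃⟩ := exists_tsum_two_per_column_le (ρ := 1 + 2 * ε + ε) (by linarith)
  have hS := tsum_wt_ne_top (ρ := 1 + 2 * ε + (1 + ε)) (by linarith)
  rw [show 2 * (ε / 2) = ε by ring] at h₁
  refine ⟨(∑' x, wt (1 + 2 * ε + (1 + ε)) x) * C₁ + C₃ * C₂,
    ENNReal.add_ne_top.mpr ⟨ENNReal.mul_ne_top hS hC₁, ENNReal.mul_ne_top hC₃ hC₂⟩,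
    fun n ν => ?_⟩
  have hform4 : ∀ x y : ℤ × ℤ, hform (y - x) (n - y) = ν →
      (2 * y.1 - (n + x).1) ^ 2 - (2 * y.2 - (n + x).2) ^ 2 = hform (n - x) (n - x) - 4 * ν := by
    intro x y hxy
    simp only [hform, Prod.fst_sub, Prod.snd_sub, Prod.fst_add, Prod.snd_add] at hxy ⊢
    linear_combination -4 * hxy
  calc _ ≤ ∑' x, (wt (1 + 2 * ε + (1 + ε)) x * C₁ +
        (if hform (n - x) (n - x) = 4 * ν then wt (1 + 2 * ε + ε) x else 0) * C₂) := by
        refine ENNReal.tsum_le_tsum fun x => ?_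
        by_cases hx : hform (n - x) (n - x) = 4 * ν
        · refine le_trans ?_ (le_add_of_nonneg_left zero_le)
          let S : ℤ × ℤ → Prop := fun y =>
            (2 * y.1 - (n + x).1) ^ 2 - (2 * y.2 - (n + x).2) ^ 2 = hform (n - x) (n - x) - 4 * ν
          have hcol : ∀ a, ∃ y₁ y₂ : ℤ, ∀ y, S (a, y) → y = y₁ ∨ y = y₂ := by
            intro a
            obtain ⟨y₁, y₂, hy⟩ := sq_sub_eq_two_values (α := 2) (by norm_num) (n + x).2
              ((2 * a - (n + x).1) ^ 2 - (hform (n - x) (n - x) - 4 * ν))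
            refine ⟨y₁, y₂, fun y hSy => hy y ?_⟩
            simp only [S] at hSy
            linear_combination -hSy
          rw [if_pos hx]
          refine le_trans ?_ (mul_le_mul_right (h₂ S inferInstance hcol) _)
          rw [← ENNReal.tsum_mul_left]
          refine ENNReal.tsum_le_tsum fun y => ?_
          split_ifs with h1 h2
          · calc wt (1 + 2 * ε) x * wt (1 + 2 * ε) y
                = wt (1 + 2 * ε) x * (wt ε y * wt (1 + ε) y) := by rw [← wt_add]; congr 2; ring
              _ ≤ wt (1 + 2 * ε) x * (wt ε x * wt (1 + ε) y) := by
                  gcongr; exact wt_anti hε.le h1.2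
              _ = _ := by rw [wt_add (1 + 2 * ε) ε]; ring
          · exact absurd (hform4 x y h1.1) h2
          all_goals exact zero_le
        · refine le_trans ?_ (le_add_of_nonneg_right zero_le)
          refine le_trans ?_ (mul_le_mul_right (h₁ (hform (n - x) (n - x) - 4 * ν) (n + x)
            (sub_ne_zero.mpr hx)) _)
          rw [← ENNReal.tsum_mul_left]
          refine ENNReal.tsum_le_tsum fun y => ?_
          split_ifs with h1 h2
          · calc wt (1 + 2 * ε) x * wt (1 + 2 * ε) y
                = wt (1 + 2 * ε) x * (wt (1 + ε) y * wt ε y) := by rw [← wt_add]; congr 2; ring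
              _ ≤ wt (1 + 2 * ε) x * (wt (1 + ε) x * wt ε y) := by
                  gcongr; exact wt_anti (by linarith) h1.2
              _ = _ := by rw [wt_add (1 + 2 * ε) (1 + ε)]; ring
          · exact absurd (hform4 x y h1.1) h2
          all_goals exact zero_le
    _ ≤ _ := by
        rw [ENNReal.tsum_add, ENNReal.tsum_mul_right, ENNReal.tsum_mul_right]
        gcongr
        refine h₃ _ inferInstance fun a => ?_
        obtain ⟨y₁, y₂, hy⟩ := sq_sub_eq_two_values (α := 1) (by norm_num) n.2
          ((n.1 - a) ^ 2 - 4 * ν)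
        refine ⟨y₁, y₂, fun y hSy => hy y ?_⟩
        simp only [hform, Prod.fst_sub, Prod.snd_sub] at hSy
        linear_combination -hSy

/-- Here one weight sits at the middle frequency, which is made the variable `x`. If `⟨y⟩ ≤ ⟨x⟩`,
fixing `y` leaves an affine condition on `x`; otherwise fixing `x` leaves a conic in `y`. -/
lemma exists_tsum_kernel_inner_le {σ : ℝ} (hσ : 1 < σ) : ∃ C : ℝ≥0∞, C ≠ ⊤ ∧
    ∀ (n : ℤ × ℤ) (ν : ℤ), ∑' z : (ℤ × ℤ) × (ℤ × ℤ),
      (if z.1 ≠ n ∧ z.2 ≠ n ∧ hform (n - z.1) (n - z.2) = ν then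
        wt σ (z.1 + z.2 - n) * wt σ z.2 else 0) ≤ C := by
  obtain ⟨ε, hε, rfl⟩ : ∃ ε, 0 < ε ∧ σ = 1 + 2 * ε := ⟨(σ - 1) / 2, by linarith, by ring⟩
  obtain ⟨C, hC, h⟩ := exists_tsum_tsum_line_le hε
  obtain ⟨C', hC', h'⟩ := exists_tsum_kernel_conic_le hε
  refine ⟨C + C', ENNReal.add_ne_top.mpr ⟨hC, hC'⟩, fun n ν => ?_⟩
  have key := h n fun y => hform (n - y) y - ν
  refine le_trans ?_ (add_le_add key (h' n ν))
  rw [ENNReal.tsum_prod', ENNReal.tsum_comm]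
  conv_rhs => arg 2; rw [ENNReal.tsum_comm]
  rw [← ENNReal.tsum_add]
  refine ENNReal.tsum_le_tsum fun y => ?_
  -- After this translation the middle frequency is `x` and `n - n₁` is `y - x`.
  rw [← (Equiv.addRight (n - y)).tsum_eq, ← ENNReal.tsum_add]
  refine ENNReal.tsum_le_tsum fun x => ?_
  have hx : x + (n - y) + y - n = x := by abel
  have hx2 : n - (x + (n - y)) = y - x := by abel
  simp only [Equiv.coe_addRight, hx, hx2]
  have h1 : hform (y - x) (n - y) = ν → hform (n - y) x = hform (n - y) y - ν := by
    intro hxy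
    simp only [hform, Prod.fst_sub, Prod.snd_sub] at hxy ⊢
    linear_combination -hxy
  split_ifs with ha hb hc hd he <;> try exact zero_le
  · exact le_add_of_nonneg_right zero_le
  · exact le_add_of_nonneg_right zero_le
  · rw [zero_add]
  · exfalso
    rcases le_total (bracket y) (bracket x) with h3 | h3
    · exact hb ⟨ha.2.1, h1 ha.2.2, h3⟩
    · exact hd ⟨ha.2.2, h3⟩

/-! ### The interactions of the gauged equation and the uniform kernel bound. -/

/-- The interactions kept in the gauged equation: the pairs `(n₁, n₃)` that are not resonant
with `n`, and the pair `(n, n)`. -/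
def Interacts (n : ℤ × ℤ) (z : (ℤ × ℤ) × (ℤ × ℤ)) : Prop :=
  (z.1 ≠ n ∧ z.2 ≠ n) ∨ (z.1 = n ∧ z.2 = n)

instance (n : ℤ × ℤ) : DecidablePred (Interacts n) := fun _ => by
  unfold Interacts; infer_instance

/-- The middle frequency `n₂ = n₁ + n₃ - n`. -/
def mid (n : ℤ × ℤ) (z : (ℤ × ℤ) × (ℤ × ℤ)) : ℤ × ℤ := z.1 + z.2 - n

/-- Half of the resonance function. -/
def halfPhase (n : ℤ × ℤ) (z : (ℤ × ℤ) × (ℤ × ℤ)) : ℤ := hform (n - z.1) (n - z.2)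

/-- The diagonal pair `(n, n)` is one extra term, at level `0`. -/
lemma tsum_interacts_le {n : ℤ × ℤ} {ν : ℤ} {F : (ℤ × ℤ) × (ℤ × ℤ) → ℝ≥0∞} {C : ℝ≥0∞}
    (hF : F (n, n) ≤ 1)
    (h : ∑' z, (if z.1 ≠ n ∧ z.2 ≠ n ∧ hform (n - z.1) (n - z.2) = ν then F z else 0) ≤ C) :
    ∑' z, (if Interacts n z ∧ halfPhase n z = ν then F z else 0) ≤ C + 1 := by
  have h1 : ∑' z, (if z = (n, n) then F (n, n) else 0) ≤ 1 := by
    rw [tsum_ite_eq]; exact hF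
  refine le_trans ?_ (add_le_add h h1)
  rw [← ENNReal.tsum_add]
  refine ENNReal.tsum_le_tsum fun z => ?_
  unfold Interacts halfPhase
  split_ifs with ha hb hc hd hd
  · exact le_add_of_nonneg_right zero_le
  · exact le_add_of_nonneg_right zero_le
  · rw [hd, zero_add]
  · rcases ha.1 with h2 | h2
    · exact absurd ⟨h2.1, h2.2, ha.2⟩ hb
    · exact absurd (Prod.ext h2.1 h2.2) hd
  all_goals exact zero_le

/-- The arithmetic core: one bound for each choice of two of the three input frequencies, uniform in
the output and in the level. The third case is the second after exchanging `n₁` and `n₃`. -/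
lemma exists_kernel_bound {σ : ℝ} (hσ : 1 < σ) : ∃ C : ℝ≥0∞, C ≠ ⊤ ∧ ∀ (n : ℤ × ℤ) (ν : ℤ),
    (∑' z, (if Interacts n z ∧ halfPhase n z = ν then wt σ z.1 * wt σ z.2 else 0) ≤ C) ∧
    (∑' z, (if Interacts n z ∧ halfPhase n z = ν then wt σ (mid n z) * wt σ z.2 else 0) ≤ C) ∧
    (∑' z, (if Interacts n z ∧ halfPhase n z = ν then wt σ z.1 * wt σ (mid n z) else 0) ≤ C) := by
  obtain ⟨C, hC, h⟩ := exists_tsum_kernel_outer_le hσ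
  obtain ⟨C', hC', h'⟩ := exists_tsum_kernel_inner_le hσ
  have hone : ∀ a b : ℤ × ℤ, wt σ a * wt σ b ≤ 1 := fun a b =>
    mul_le_one' (wt_le_one (by linarith) a) (wt_le_one (by linarith) b)
  refine ⟨(C + 1) + (C' + 1), by simp [hC, hC'], fun n ν => ⟨?_, ?_, ?_⟩⟩
  · exact (tsum_interacts_le (hone _ _) (h n ν)).trans (le_add_of_nonneg_right zero_le)
  · exact (tsum_interacts_le (hone _ _) (h' n ν)).trans (le_add_of_nonneg_left zero_le)
  · refine (tsum_interacts_le (hone _ _) ?_).trans (le_add_of_nonneg_left zero_le)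
    refine le_trans (le_of_eq ?_) (h' n ν)
    rw [← (Equiv.prodComm (ℤ × ℤ) (ℤ × ℤ)).tsum_eq]
    refine tsum_congr fun z => ?_
    have h1 : hform (n - z.2) (n - z.1) = hform (n - z.1) (n - z.2) := by
      simp only [hform]; ring
    have h2 : mid n z.swap = z.1 + z.2 - n := by simp [mid, add_comm]
    simp only [Equiv.prodComm_apply, Prod.fst_swap, Prod.snd_swap, h1, h2]
    congr 1
    · exact propext ⟨fun ⟨a, b, c⟩ => ⟨b, a, c⟩, fun ⟨a, b, c⟩ => ⟨b, a, c⟩⟩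
    · rw [mul_comm]

lemma tsum_mul_prod {α β : Type*} (f : α → ℝ≥0∞) (g : β → ℝ≥0∞) :
    ∑' y : α × β, f y.1 * g y.2 = (∑' a, f a) * ∑' b, g b := by
  rw [ENNReal.tsum_prod']
  simp_rw [ENNReal.tsum_mul_left, ENNReal.tsum_mul_right]

/-! ### The `ℓ^r` norms of nonnegative families, with Minkowski's and Hölder's inequalities. -/

section Norms

variable {ι β : Type*}

/-- The `ℓ^r` norm of a nonnegative family. -/
def lnorm (r : ℝ) (f : ι → ℝ≥0∞) : ℝ≥0∞ := (∑' n, f n ^ r) ^ (1 / r)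

lemma lnorm_rpow {r : ℝ} (hr : 0 < r) (f : ι → ℝ≥0∞) : lnorm r f ^ r = ∑' n, f n ^ r := by
  rw [lnorm, ← ENNReal.rpow_mul, one_div_mul_cancel hr.ne', ENNReal.rpow_one]

lemma lnorm_le_iff {r : ℝ} (hr : 0 < r) (f : ι → ℝ≥0∞) (A : ℝ≥0∞) :
    lnorm r f ≤ A ↔ ∑' n, f n ^ r ≤ A ^ r := by
  rw [← lnorm_rpow hr, ENNReal.rpow_le_rpow_iff hr]

lemma lnorm_mono {r : ℝ} (hr : 0 < r) {f g : ι → ℝ≥0∞} (h : ∀ n, f n ≤ g n) :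
    lnorm r f ≤ lnorm r g :=
  ENNReal.rpow_le_rpow (ENNReal.tsum_le_tsum fun n => ENNReal.rpow_le_rpow (h n) hr.le)
    (by positivity)

lemma le_lnorm {r : ℝ} (hr : 0 < r) (f : ι → ℝ≥0∞) (n : ι) : f n ≤ lnorm r f := by
  rw [← ENNReal.rpow_le_rpow_iff hr, lnorm_rpow hr]
  exact ENNReal.le_tsum n

lemma lnorm_const_mul {r : ℝ} (hr : 0 < r) (c : ℝ≥0∞) (f : ι → ℝ≥0∞) :
    lnorm r (fun n => c * f n) = c * lnorm r f := by
  simp only [lnorm, ENNReal.mul_rpow_of_nonneg _ _ hr.le]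
  rw [ENNReal.tsum_mul_left, ENNReal.mul_rpow_of_nonneg _ _ (by positivity), ← ENNReal.rpow_mul,
    mul_one_div_cancel hr.ne', ENNReal.rpow_one]

lemma lnorm_zero {r : ℝ} (hr : 0 < r) : lnorm r (fun _ : ι => (0 : ℝ≥0∞)) = 0 := by
  simp [lnorm, hr]

lemma lnorm_le_lnorm {p r : ℝ} (hp : 0 < p) (hpr : p ≤ r) (f : ι → ℝ≥0∞) :
    lnorm r f ≤ lnorm p f := by
  have hr := hp.trans_le hpr
  rw [lnorm_le_iff hr]
  calc ∑' n, f n ^ r ≤ ∑' n, f n ^ p * lnorm p f ^ (r - p) := by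
        refine ENNReal.tsum_le_tsum fun n => ?_
        rw [show r = p + (r - p) by ring, ENNReal.rpow_add_of_nonneg _ _ hp.le (by linarith)]
        rw [show p + (r - p) - p = r - p by ring]
        gcongr
        exact le_lnorm hp f n
    _ = lnorm p f ^ r := by
        rw [ENNReal.tsum_mul_right, ← lnorm_rpow hp,
          ← ENNReal.rpow_add_of_nonneg _ _ hp.le (by linarith)]
        congr 1; ring

lemma lnorm_add_le {r : ℝ} (hr : 1 ≤ r) (f g : ι → ℝ≥0∞) :
    lnorm r (fun n => f n + g n) ≤ lnorm r f + lnorm r g := by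
  let _ : MeasurableSpace ι := ⊤
  have h := ENNReal.lintegral_Lp_add_le (μ := Measure.count) (f := f) (g := g)
    measurable_from_top.aemeasurable measurable_from_top.aemeasurable hr
  simpa [lnorm, lintegral_count' measurable_from_top] using h

lemma lnorm_sum_le {r : ℝ} (hr : 1 ≤ r) (s : Finset β) (f : β → ι → ℝ≥0∞) :
    lnorm r (fun n => ∑ b ∈ s, f b n) ≤ ∑ b ∈ s, lnorm r (f b) := by
  classical
  induction s using Finset.induction with
  | empty => simp [lnorm_zero (one_pos.trans_le hr)]
  | insert b s hb ih =>
    simp only [Finset.sum_insert hb]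
    exact (lnorm_add_le hr _ _).trans (add_le_add le_rfl ih)

lemma lnorm_tsum_le {r : ℝ} (hr : 1 ≤ r) (f : β → ι → ℝ≥0∞) :
    lnorm r (fun n => ∑' b, f b n) ≤ ∑' b, lnorm r (f b) := by
  have hr0 : 0 < r := one_pos.trans_le hr
  rw [lnorm_le_iff hr0, ENNReal.tsum_eq_iSup_sum]
  refine iSup_le fun s => ?_
  have ht : Filter.Tendsto (fun F : Finset β => ∑ n ∈ s, (∑ b ∈ F, f b n) ^ r) Filter.atTop
      (nhds (∑ n ∈ s, (∑' b, f b n) ^ r)) := by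
    refine tendsto_finsetSum _ fun n _ => ?_
    exact ((ENNReal.continuous_rpow_const).tendsto _).comp ENNReal.summable.hasSum
  refine le_of_tendsto ht (Filter.Eventually.of_forall fun F => ?_)
  calc ∑ n ∈ s, (∑ b ∈ F, f b n) ^ r ≤ ∑' n, (∑ b ∈ F, f b n) ^ r := ENNReal.sum_le_tsum s
    _ ≤ (∑ b ∈ F, lnorm r (f b)) ^ r := (lnorm_le_iff hr0 _ _).mp (lnorm_sum_le hr F f)
    _ ≤ _ := by gcongr; exact ENNReal.sum_le_tsum F

lemma tsum_prod_rpow_le {κ : Type*} (s : Finset κ) (f : κ → ι → ℝ≥0∞) (p : κ → ℝ)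
    (hp : ∑ k ∈ s, p k = 1) (h2p : ∀ k ∈ s, 0 ≤ p k) :
    ∑' n, ∏ k ∈ s, f k n ^ p k ≤ ∏ k ∈ s, (∑' n, f k n) ^ p k := by
  let _ : MeasurableSpace ι := ⊤
  have h := ENNReal.lintegral_prod_norm_pow_le (μ := Measure.count) s (f := f)
    (fun k _ => measurable_from_top.aemeasurable) hp h2p
  simpa [lintegral_count' measurable_from_top] using h

lemma tsum_mul_le_lnorm_mul_lnorm {p q : ℝ} (hpq : p.HolderConjugate q) (f g : ι → ℝ≥0∞) :
    ∑' n, f n * g n ≤ lnorm p f * lnorm q g := by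
  let _ : MeasurableSpace ι := ⊤
  have h := ENNReal.lintegral_mul_le_Lp_mul_Lq (Measure.count : Measure ι) hpq (f := f) (g := g)
    measurable_from_top.aemeasurable measurable_from_top.aemeasurable
  simpa [lnorm, lintegral_count' measurable_from_top] using h

/-- Hölder's inequality with three factors, the last two of which share two exponents. -/
lemma tsum_trilinear_holder {p r : ℝ} (hp : 1 < p) (hpr : p ≤ r) (w F G V : ι → ℝ≥0∞) :
    (∑' z, w z * (F z * G z) * V z ^ (1 - 1 / p)) ^ r ≤
      (∑' z, w z ^ r * (F z ^ p * G z ^ p)) * (∑' z, F z ^ p * G z ^ p) ^ (r / p - 1) *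
        (∑' z, V z) ^ (r * (1 - 1 / p)) := by
  have hp0 : 0 < p := by linarith
  have hr0 : 0 < r := by linarith
  have hinv : 1 / r ≤ 1 / p := one_div_le_one_div_of_le hp0 hpr
  have hp1 : 1 / p ≤ 1 := by rw [div_le_one hp0]; exact hp.le
  -- The exponents `1/r`, `1/p - 1/r` and `1 - 1/p` add up to `1`; in the first two factors the
  -- powers of `F^p G^p` recombine to `F G`.
  have h := tsum_prod_rpow_le (Finset.univ : Finset (Fin 3))
    ![fun z => w z ^ r * (F z ^ p * G z ^ p), fun z => F z ^ p * G z ^ p, V]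
    ![1 / r, 1 / p - 1 / r, 1 - 1 / p]
    (by simp [Fin.sum_univ_three])
    (by
      intro k _
      fin_cases k
      · simp; positivity
      · simpa using hinv
      · simpa using hp1)
  simp only [Fin.prod_univ_three, Matrix.cons_val_zero, Matrix.cons_val_one, Matrix.cons_val] at h
  have hpt : ∀ z, w z * (F z * G z) * V z ^ (1 - 1 / p) =
      (w z ^ r * (F z ^ p * G z ^ p)) ^ (1 / r) * (F z ^ p * G z ^ p) ^ (1 / p - 1 / r) *
        V z ^ (1 - 1 / p) := by
    intro z
    congr 1
    rw [ENNReal.mul_rpow_of_nonneg _ _ (by positivity), ← ENNReal.rpow_mul,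
      mul_one_div_cancel hr0.ne', ENNReal.rpow_one, mul_assoc,
      ← ENNReal.rpow_add_of_nonneg _ _ (by positivity) (by linarith),
      show 1 / r + (1 / p - 1 / r) = 1 / p by ring,
      ← ENNReal.mul_rpow_of_nonneg _ _ hp0.le, ← ENNReal.rpow_mul, mul_one_div_cancel hp0.ne',
      ENNReal.rpow_one]
  rw [tsum_congr hpt]
  refine (ENNReal.rpow_le_rpow h hr0.le).trans (le_of_eq ?_)
  rw [ENNReal.mul_rpow_of_nonneg _ _ hr0.le, ENNReal.mul_rpow_of_nonneg _ _ hr0.le,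
    ← ENNReal.rpow_mul, ← ENNReal.rpow_mul, ← ENNReal.rpow_mul, one_div_mul_cancel hr0.ne',
    ENNReal.rpow_one, show (1 / p - 1 / r) * r = r / p - 1 by field_simp,
    mul_comm (1 - 1 / p) r]

end Norms

/-! ### Weighted norms and the trilinear form at one resonance level. -/

/-- The weighted norm `‖⟨n⟩^s f(n)‖_{ℓ^p}` of a nonnegative sequence. -/
def xnorm (s p : ℝ) (f : ℤ × ℤ → ℝ≥0∞) : ℝ≥0∞ := lnorm p fun n => wt (-s) n * f n

lemma wt_mul_wt_neg (s : ℝ) (n : ℤ × ℤ) : wt s n * wt (-s) n = 1 := by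
  rw [← wt_add, add_neg_cancel, wt_zero]

lemma wt_rpow (s : ℝ) {a : ℝ} (ha : 0 ≤ a) (n : ℤ × ℤ) : wt s n ^ a = wt (s * a) n := by
  rw [wt, ENNReal.ofReal_rpow_of_nonneg (Real.rpow_nonneg (bracket_pos n).le _) ha,
    ← Real.rpow_mul (bracket_pos n).le, wt]
  congr 2; ring

lemma one_le_wt_neg {s : ℝ} (hs : 0 ≤ s) (n : ℤ × ℤ) : 1 ≤ wt (-s) n :=
  (wt_zero n).symm.trans_le (wt_le_wt (by linarith) n)

lemma lnorm_le_xnorm {s p : ℝ} (hs : 0 ≤ s) (hp : 0 < p) (f : ℤ × ℤ → ℝ≥0∞) :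
    lnorm p f ≤ xnorm s p f :=
  lnorm_mono hp fun n => le_mul_of_one_le_left zero_le (one_le_wt_neg hs n)

/-- The part of the trilinear interaction at resonance level `ν`, for weights `W₁, W₂, W₃`. -/
def levelSum (f g h : ℤ × ℤ → ℝ≥0∞) (ν : ℤ) (n : ℤ × ℤ) : ℝ≥0∞ :=
  ∑' z, if Interacts n z ∧ halfPhase n z = ν then f z.1 * g (mid n z) * h z.2 else 0

/-- Abstract trilinear bound; `i`, `j`, `l` assign the three inputs to the frequencies. -/
lemma lnorm_lnorm_level_le {p r s : ℝ} (hp : 1 < p) (hpr : p ≤ r) {K : ℝ≥0∞}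
    (i j l : ℤ × ℤ → (ℤ × ℤ) × (ℤ × ℤ) → ℤ × ℤ)
    (hinj : ∀ n, Function.Injective fun z => (j n z, l n z))
    (hinj' : Function.Injective fun y : (ℤ × ℤ) × ((ℤ × ℤ) × (ℤ × ℤ)) =>
      (i y.1 y.2, j y.1 y.2, l y.1 y.2))
    (hK : ∀ n ν, ∑' z, (if Interacts n z ∧ halfPhase n z = ν then
      wt (s * (1 - 1 / p)⁻¹) (j n z) * wt (s * (1 - 1 / p)⁻¹) (l n z) else 0) ≤ K)
    (w f g : ℤ × ℤ → ℝ≥0∞) :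
    lnorm r (fun ν : ℤ => lnorm r fun n => ∑' z, if Interacts n z ∧ halfPhase n z = ν then
      w (i n z) * (f (j n z) * g (l n z)) else 0) ≤
      K ^ (1 - 1 / p) * (lnorm r w * xnorm s p f * xnorm s p g) := by
  have hp0 : 0 < p := by linarith
  have hr0 : 0 < r := by linarith
  have hp1 : 0 < 1 - 1 / p := by
    rw [sub_pos, div_lt_one hp0]; exact hp
  have hrp : 0 ≤ r / p - 1 := by rw [sub_nonneg, le_div_iff₀ hp0]; linarith
  set F : ℤ × ℤ → ℝ≥0∞ := fun n => wt (-s) n * f n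
  set G : ℤ × ℤ → ℝ≥0∞ := fun n => wt (-s) n * g n
  have hF : ∀ n, f n = F n * wt s n := fun n => by
    simp only [F]; rw [mul_right_comm, mul_comm (wt (-s) n), wt_mul_wt_neg, one_mul]
  have hG : ∀ n, g n = G n * wt s n := fun n => by
    simp only [G]; rw [mul_right_comm, mul_comm (wt (-s) n), wt_mul_wt_neg, one_mul]
  set Φ := ∑' n, F n ^ p
  set Γ := ∑' n, G n ^ p
  have hFG : ∀ n, ∑' z, F (j n z) ^ p * G (l n z) ^ p ≤ Φ * Γ := by
    intro n
    calc _ ≤ ∑' y : (ℤ × ℤ) × (ℤ × ℤ), F y.1 ^ p * G y.2 ^ p :=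
          ENNReal.tsum_comp_le_tsum_of_injective (hinj n) fun y => F y.1 ^ p * G y.2 ^ p
      _ = Φ * Γ := tsum_mul_prod (fun n => F n ^ p) (fun n => G n ^ p)
  -- Hölder at fixed `(ν, n)`. The weights of `f` and `g` are collected into the third factor, where
  -- the exponent `s (1 - 1/p)⁻¹ = s p'` makes it the kernel sum bounded by `K`.
  have hpoint : ∀ ν n, (∑' z, if Interacts n z ∧ halfPhase n z = ν then
      w (i n z) * (f (j n z) * g (l n z)) else 0) ^ r ≤
      (∑' z, if Interacts n z ∧ halfPhase n z = ν then
        w (i n z) ^ r * (F (j n z) ^ p * G (l n z) ^ p) else 0) *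
        ((Φ * Γ) ^ (r / p - 1) * K ^ (r * (1 - 1 / p))) := by
    intro ν n
    have h := tsum_trilinear_holder hp hpr
      (fun z => if Interacts n z ∧ halfPhase n z = ν then w (i n z) else 0)
      (fun z => F (j n z)) (fun z => G (l n z))
      (fun z => if Interacts n z ∧ halfPhase n z = ν then
        wt (s * (1 - 1 / p)⁻¹) (j n z) * wt (s * (1 - 1 / p)⁻¹) (l n z) else 0)
    refine le_trans (le_of_eq ?_) (h.trans ?_)
    · congr 1
      refine tsum_congr fun z => ?_
      split_ifs with hz
      · rw [ENNReal.mul_rpow_of_nonneg _ _ hp1.le, wt_rpow _ hp1.le, wt_rpow _ hp1.le,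
          mul_assoc s, inv_mul_cancel₀ hp1.ne', mul_one, hF, hG]
        ring
      · simp
    · rw [mul_assoc]
      gcongr ?_ * (?_ ^ _ * ?_ ^ _)
      · refine ENNReal.tsum_le_tsum fun z => ?_
        split_ifs with hz
        · exact le_rfl
        · simp [hr0]
      · exact hFG n
      · exact hK n ν
  -- Each `(n, z)` lies on exactly one level, so the sum over `ν` is free; the remaining sum factors
  -- because `(n, z)` is recovered from the three inputs.
  have htot : ∑' ν : ℤ, ∑' n, ∑' z, (if Interacts n z ∧ halfPhase n z = ν then
        w (i n z) ^ r * (F (j n z) ^ p * G (l n z) ^ p) else 0) ≤ (∑' n, w n ^ r) * (Φ * Γ) := by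
    calc _ = ∑' n, ∑' z, ∑' ν : ℤ, (if Interacts n z ∧ halfPhase n z = ν then
        w (i n z) ^ r * (F (j n z) ^ p * G (l n z) ^ p) else 0) := by
          rw [ENNReal.tsum_comm]
          refine tsum_congr fun n => ?_
          rw [ENNReal.tsum_comm]
      _ ≤ ∑' n, ∑' z, w (i n z) ^ r * (F (j n z) ^ p * G (l n z) ^ p) := by
          refine ENNReal.tsum_le_tsum fun n => ENNReal.tsum_le_tsum fun z => ?_
          rw [tsum_eq_single (halfPhase n z)]
          · split_ifs
            · exact le_rfl
            · exact zero_le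
          · intro ν hν
            rw [if_neg]
            exact fun h => hν h.2.symm
      _ = ∑' y : (ℤ × ℤ) × ((ℤ × ℤ) × (ℤ × ℤ)),
            w (i y.1 y.2) ^ r * (F (j y.1 y.2) ^ p * G (l y.1 y.2) ^ p) :=
          (ENNReal.tsum_prod' (f := fun y : (ℤ × ℤ) × ((ℤ × ℤ) × (ℤ × ℤ)) =>
            w (i y.1 y.2) ^ r * (F (j y.1 y.2) ^ p * G (l y.1 y.2) ^ p))).symm
      _ ≤ ∑' y : (ℤ × ℤ) × ((ℤ × ℤ) × (ℤ × ℤ)), w y.1 ^ r * (F y.2.1 ^ p * G y.2.2 ^ p) :=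
          ENNReal.tsum_comp_le_tsum_of_injective hinj'
            fun y => w y.1 ^ r * (F y.2.1 ^ p * G y.2.2 ^ p)
      _ = _ := by
          rw [tsum_mul_prod (fun n => w n ^ r)
            (fun y : (ℤ × ℤ) × (ℤ × ℤ) => F y.1 ^ p * G y.2 ^ p),
            tsum_mul_prod (fun n => F n ^ p) (fun n => G n ^ p)]
  rw [lnorm_le_iff hr0]
  simp_rw [lnorm_rpow hr0]
  calc _ ≤ ∑' ν : ℤ, ∑' n, (∑' z, if Interacts n z ∧ halfPhase n z = ν then
        w (i n z) ^ r * (F (j n z) ^ p * G (l n z) ^ p) else 0) *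
        ((Φ * Γ) ^ (r / p - 1) * K ^ (r * (1 - 1 / p))) :=
        ENNReal.tsum_le_tsum fun ν => ENNReal.tsum_le_tsum fun n => hpoint ν n
    _ ≤ (∑' n, w n ^ r) * (Φ * Γ) * ((Φ * Γ) ^ (r / p - 1) * K ^ (r * (1 - 1 / p))) := by
        simp_rw [ENNReal.tsum_mul_right]
        gcongr
    _ = (∑' n, w n ^ r) * (Φ * Γ) ^ (r / p) * K ^ (r * (1 - 1 / p)) := by
        have : (Φ * Γ) ^ (r / p) = (Φ * Γ) * (Φ * Γ) ^ (r / p - 1) := by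
          conv_rhs => rw [← ENNReal.rpow_one (Φ * Γ), ← ENNReal.rpow_mul, one_mul]
          rw [← ENNReal.rpow_add_of_nonneg _ _ zero_le_one hrp]
          congr 1; ring
        rw [this]; ring
    _ = _ := by
        have e1 : ∀ A : ℝ≥0∞, (A ^ (1 / p)) ^ r = A ^ (r / p) := fun A => by
          rw [← ENNReal.rpow_mul]; congr 1; ring
        rw [ENNReal.mul_rpow_of_nonneg _ _ hr0.le, ENNReal.mul_rpow_of_nonneg _ _ hr0.le,
          ENNReal.mul_rpow_of_nonneg _ _ hr0.le, lnorm_rpow hr0, xnorm, xnorm, lnorm, lnorm,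
          e1, e1, ← ENNReal.rpow_mul, mul_comm (1 - 1 / p) r,
          ENNReal.mul_rpow_of_nonneg _ _ (by positivity)]
        ring

lemma xnorm_mono {s p : ℝ} (hp : 0 < p) {f g : ℤ × ℤ → ℝ≥0∞} (h : ∀ n, f n ≤ g n) :
    xnorm s p f ≤ xnorm s p g :=
  lnorm_mono hp fun n => by gcongr; exact h n

lemma xnorm_zero_left (r : ℝ) (f : ℤ × ℤ → ℝ≥0∞) : xnorm 0 r f = lnorm r f := by
  simp [xnorm, wt_zero]

lemma xnorm_const_mul {s p : ℝ} (hp : 0 < p) (c : ℝ≥0∞) (f : ℤ × ℤ → ℝ≥0∞) :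
    xnorm s p (fun n => c * f n) = c * xnorm s p f := by
  rw [xnorm, xnorm, ← lnorm_const_mul hp]
  congr 1; funext n; ring

lemma xnorm_tsum_le {β : Type*} {s p : ℝ} (hp : 1 ≤ p) (f : β → ℤ × ℤ → ℝ≥0∞) :
    xnorm s p (fun n => ∑' b, f b n) ≤ ∑' b, xnorm s p (f b) := by
  simp only [xnorm, ← ENNReal.tsum_mul_left]
  exact lnorm_tsum_le hp fun b n => wt (-s) n * f b n

lemma xnorm_add_le {s p : ℝ} (hp : 1 ≤ p) (f g : ℤ × ℤ → ℝ≥0∞) :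
    xnorm s p (fun n => f n + g n) ≤ xnorm s p f + xnorm s p g := by
  simp only [xnorm, mul_add]
  exact lnorm_add_le hp _ _

lemma le_xnorm {s p : ℝ} (hs : 0 ≤ s) (hp : 0 < p) (f : ℤ × ℤ → ℝ≥0∞) (n : ℤ × ℤ) :
    f n ≤ xnorm s p f :=
  (le_lnorm hp f n).trans (lnorm_le_xnorm hs hp f)

lemma xnorm_zero_left_le {s p r : ℝ} (hs : 0 ≤ s) (hp : 0 < p) (hpr : p ≤ r)
    (f : ℤ × ℤ → ℝ≥0∞) : xnorm 0 r f ≤ xnorm s p f := by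
  rw [xnorm_zero_left]
  exact (lnorm_le_lnorm hp hpr f).trans (lnorm_le_xnorm hs hp f)

/-! ### Trilinear bounds on the level sets of the resonance function -/

/-- `⟨m⟩` is the Euclidean length of `(1, m)` in `ℝ³`, and `(1, n) = (1, n₁) - (1, n₂) + (1, n₃)`.
-/
lemma bracket_le_add_mid (n : ℤ × ℤ) (z : (ℤ × ℤ) × (ℤ × ℤ)) :
    bracket n ≤ bracket z.1 + bracket (mid n z) + bracket z.2 := by
  have hn : ∀ m : ℤ × ℤ, bracket m = ‖(!₂[1, (m.1 : ℝ), (m.2 : ℝ)] : EuclideanSpace ℝ (Fin 3))‖ := by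
    intro m
    simp [EuclideanSpace.norm_eq, Fin.sum_univ_three, bracket]
  have he : (!₂[1, (n.1 : ℝ), (n.2 : ℝ)] : EuclideanSpace ℝ (Fin 3)) =
      !₂[1, (z.1.1 : ℝ), (z.1.2 : ℝ)] - !₂[1, ((mid n z).1 : ℝ), ((mid n z).2 : ℝ)]
        + !₂[1, (z.2.1 : ℝ), (z.2.2 : ℝ)] := by
    ext i
    fin_cases i
    · simp
    · simp [mid]; ring
    · simp [mid]; ring
  rw [hn n, hn, hn, hn, he]
  exact (norm_add_le _ _).trans (add_le_add (norm_sub_le _ _) le_rfl)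

lemma wt_neg_le_mid {s : ℝ} (hs : 0 ≤ s) (n : ℤ × ℤ) (z : (ℤ × ℤ) × (ℤ × ℤ)) :
    wt (-s) n ≤ ENNReal.ofReal (3 ^ s) * (wt (-s) z.1 + wt (-s) (mid n z) + wt (-s) z.2) := by
  have h := bracket_le_add_mid n z
  have h1 := bracket_pos z.1
  have h2 := bracket_pos z.2
  have h3 := bracket_pos (mid n z)
  have h0 := bracket_pos n
  simp only [wt, neg_neg]
  rw [← ENNReal.ofReal_add (by positivity) (by positivity),
    ← ENNReal.ofReal_add (by positivity) (by positivity), ← ENNReal.ofReal_mul (by positivity)]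
  refine ENNReal.ofReal_le_ofReal ?_
  -- The witness is the largest of the three brackets.
  have hmax : ∃ a, 0 < a ∧ bracket n ≤ 3 * a ∧
      a ^ s ≤ bracket z.1 ^ s + bracket (mid n z) ^ s + bracket z.2 ^ s := by
    rcases le_total (bracket z.1) (bracket z.2) with ha | ha <;>
      rcases le_total (bracket (mid n z)) (bracket z.2) with hb | hb <;>
      rcases le_total (bracket z.1) (bracket (mid n z)) with hc | hc
    all_goals first
      | exact ⟨bracket z.2, h2, by linarith, le_add_of_nonneg_left (by positivity)⟩
      | exact ⟨bracket z.1, h1, by linarith, by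
          rw [add_assoc]; exact le_add_of_nonneg_right (by positivity)⟩
      | exact ⟨bracket (mid n z), h3, by linarith, by
          rw [add_right_comm]; exact le_add_of_nonneg_left (by positivity)⟩
  obtain ⟨a, ha, hna, has⟩ := hmax
  calc bracket n ^ s ≤ (3 * a) ^ s := by gcongr
    _ = 3 ^ s * a ^ s := Real.mul_rpow (by norm_num) ha.le
    _ ≤ _ := by gcongr

/-- The hypothesis on `s` says exactly that `s p' > 1`. The unweighted input `w` may sit at any of
the three frequencies, and the kernel bound is applied to the other two. The constant does not
depend on `r`. -/
lemma exists_level_bound {p s : ℝ} (hp : 1 < p) (hs : 1 - 1 / p < s) : ∃ C : ℝ≥0∞, C ≠ ⊤ ∧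
    ∀ r, p ≤ r → ∀ w f g : ℤ × ℤ → ℝ≥0∞,
      lnorm r (fun ν => lnorm r (levelSum w f g ν)) ≤ C * (lnorm r w * xnorm s p f * xnorm s p g) ∧
      lnorm r (fun ν => lnorm r (levelSum f w g ν)) ≤ C * (lnorm r w * xnorm s p f * xnorm s p g) ∧
      lnorm r (fun ν => lnorm r (levelSum f g w ν)) ≤ C * (lnorm r w * xnorm s p f * xnorm s p g) := by
  have hp0 : 0 < p := by linarith
  have hp1 : 0 < 1 - 1 / p := by
    rw [sub_pos, div_lt_one hp0]; exact hp
  have hσ : 1 < s * (1 - 1 / p)⁻¹ := by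
    rw [← div_eq_mul_inv, one_lt_div hp1]; exact hs
  obtain ⟨K, hK, h⟩ := exists_kernel_bound hσ
  refine ⟨K ^ (1 - 1 / p), ENNReal.rpow_ne_top_of_nonneg hp1.le hK, fun r hpr w f g => ⟨?_, ?_, ?_⟩⟩
  · have := lnorm_lnorm_level_le hp hpr (s := s) (fun _ z => z.1) mid (fun _ z => z.2)
      (fun n z z' hz => by
        simp only [mid, Prod.mk.injEq] at hz
        obtain ⟨h1, h2⟩ := hz
        refine Prod.ext ?_ h2
        rw [h2] at h1
        simpa using h1)
      (fun y y' hy => by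
        simp only [mid, Prod.mk.injEq] at hy
        obtain ⟨h1, h2, h3⟩ := hy
        refine Prod.ext ?_ (Prod.ext h1 h3)
        rw [h1, h3] at h2
        simpa using h2) (fun n ν => (h n ν).2.1) w f g
    refine le_trans (le_of_eq ?_) this
    congr 1; funext ν; congr 1; funext n
    exact tsum_congr fun z => by ring_nf
  · have := lnorm_lnorm_level_le hp hpr (s := s) mid (fun _ z => z.1) (fun _ z => z.2)
      (fun n z z' hz => by
        simp only [Prod.mk.injEq] at hz
        exact Prod.ext hz.1 hz.2)
      (fun y y' hy => by
        simp only [mid, Prod.mk.injEq] at hy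
        obtain ⟨h2, h1, h3⟩ := hy
        refine Prod.ext ?_ (Prod.ext h1 h3)
        rw [h1, h3] at h2
        simpa using h2) (fun n ν => (h n ν).1) w f g
    refine le_trans (le_of_eq ?_) this
    congr 1; funext ν; congr 1; funext n
    exact tsum_congr fun z => by ring_nf
  · have := lnorm_lnorm_level_le hp hpr (s := s) (fun _ z => z.2) (fun _ z => z.1) mid
      (fun n z z' hz => by
        simp only [mid, Prod.mk.injEq] at hz
        obtain ⟨h1, h2⟩ := hz
        refine Prod.ext h1 ?_
        rw [h1] at h2
        simpa using h2)
      (fun y y' hy => by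
        simp only [mid, Prod.mk.injEq] at hy
        obtain ⟨h3, h1, h2⟩ := hy
        refine Prod.ext ?_ (Prod.ext h1 h3)
        rw [h1, h3] at h2
        simpa using h2) (fun n ν => (h n ν).2.2) w f g
    refine le_trans (le_of_eq ?_) this
    congr 1; funext ν; congr 1; funext n
    exact tsum_congr fun z => by ring_nf

lemma wt_neg_mul_levelSum_le {s : ℝ} (hs : 0 ≤ s) (f g h : ℤ × ℤ → ℝ≥0∞) (ν : ℤ) (n : ℤ × ℤ) :
    wt (-s) n * levelSum f g h ν n ≤ ENNReal.ofReal (3 ^ s) *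
      (levelSum (fun n => wt (-s) n * f n) g h ν n + levelSum f (fun n => wt (-s) n * g n) h ν n
        + levelSum f g (fun n => wt (-s) n * h n) ν n) := by
  simp only [levelSum]
  rw [← ENNReal.tsum_mul_left, ← ENNReal.tsum_add, ← ENNReal.tsum_add, ← ENNReal.tsum_mul_left]
  refine ENNReal.tsum_le_tsum fun z => ?_
  split_ifs with hz
  · calc _ ≤ ENNReal.ofReal (3 ^ s) * (wt (-s) z.1 + wt (-s) (mid n z) + wt (-s) z.2) *
          (f z.1 * g (mid n z) * h z.2) := by gcongr; exact wt_neg_le_mid hs n z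
      _ = _ := by ring
  · simp

/-- The weight at the output is passed to one input at a time; that input then plays the role of
`w`, with `r = p`. -/
lemma exists_level_bound_xnorm {p s : ℝ} (hp : 1 < p) (hs : 1 - 1 / p < s) :
    ∃ C : ℝ≥0∞, C ≠ ⊤ ∧ ∀ f g h : ℤ × ℤ → ℝ≥0∞,
      lnorm p (fun ν => xnorm s p (levelSum f g h ν)) ≤
        C * (xnorm s p f * xnorm s p g * xnorm s p h) := by
  have hp0 : 0 < p := by linarith
  have hs0 : 0 ≤ s := by
    have : 1 / p < 1 := by rw [div_lt_one hp0]; exact hp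
    linarith
  obtain ⟨C, hC, hb⟩ := exists_level_bound hp hs
  refine ⟨ENNReal.ofReal (3 ^ s) * (3 * C), ENNReal.mul_ne_top ENNReal.ofReal_ne_top
    (ENNReal.mul_ne_top (by norm_num) hC), fun f g h => ?_⟩
  have h1 := (hb p le_rfl (fun n => wt (-s) n * f n) g h).1
  have h2 := (hb p le_rfl (fun n => wt (-s) n * g n) f h).2.1
  have h3 := (hb p le_rfl (fun n => wt (-s) n * h n) f g).2.2
  calc lnorm p (fun ν => xnorm s p (levelSum f g h ν))
      ≤ lnorm p (fun ν => ENNReal.ofReal (3 ^ s) *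
        (lnorm p (levelSum (fun n => wt (-s) n * f n) g h ν)
          + lnorm p (levelSum f (fun n => wt (-s) n * g n) h ν)
          + lnorm p (levelSum f g (fun n => wt (-s) n * h n) ν))) := by
        refine lnorm_mono hp0 fun ν => ?_
        refine (lnorm_mono hp0 fun n => wt_neg_mul_levelSum_le hs0 f g h ν n).trans ?_
        rw [lnorm_const_mul hp0]
        gcongr
        exact (lnorm_add_le hp.le _ _).trans (add_le_add (lnorm_add_le hp.le _ _) le_rfl)
    _ ≤ ENNReal.ofReal (3 ^ s) *
        (C * (xnorm s p f * xnorm s p g * xnorm s p h)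
          + C * (xnorm s p g * xnorm s p f * xnorm s p h)
          + C * (xnorm s p h * xnorm s p f * xnorm s p g)) := by
        rw [lnorm_const_mul hp0]
        gcongr
        refine (lnorm_add_le hp.le _ _).trans (add_le_add ((lnorm_add_le hp.le _ _).trans
          (add_le_add ?_ ?_)) ?_)
        · exact h1
        · exact h2
        · exact h3
    _ = _ := by ring

/-! ### The Duhamel operator with a given time kernel, on absolute values -/

/-- The trilinear Duhamel operator with time kernel `D`, applied to single time frequencies. -/
def duhamelAtom (D : ℤ → ℤ → ℝ≥0∞) (τ : ℤ) (f g h : ℤ × ℤ → ℝ≥0∞) (l : ℤ) (n : ℤ × ℤ) : ℝ≥0∞ :=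
  ∑' z, if Interacts n z then D l (τ + 2 * halfPhase n z) * (f z.1 * g (mid n z) * h z.2) else 0

lemma duhamelAtom_eq (D : ℤ → ℤ → ℝ≥0∞) (τ : ℤ) (f g h : ℤ × ℤ → ℝ≥0∞) (l : ℤ) (n : ℤ × ℤ) :
    duhamelAtom D τ f g h l n = ∑' ν, D l (τ + 2 * ν) * levelSum f g h ν n := by
  simp only [duhamelAtom, levelSum, ← ENNReal.tsum_mul_left]
  rw [ENNReal.tsum_comm]
  refine tsum_congr fun z => ?_
  rw [tsum_eq_single (halfPhase n z)]
  · by_cases h : Interacts n z <;> simp [h]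
  · intro ν hν
    rw [if_neg (fun h => hν h.2.symm), mul_zero]

/-- Hölder in the level: column sums of the time kernel in `ℓ^q` against level pieces in `ℓ^p`. As
`ν ↦ τ + 2ν` is injective, the bound does not see `τ`, and this is why an `ℓ¹` norm in the time
frequency closes. -/
lemma tsum_xnorm_duhamelAtom_le {s p q : ℝ} (hpq : q.HolderConjugate p) (D : ℤ → ℤ → ℝ≥0∞) (τ : ℤ)
    (f g h : ℤ × ℤ → ℝ≥0∞) :
    ∑' l, xnorm s p (duhamelAtom D τ f g h l) ≤
      lnorm q (fun τ => ∑' l, D l τ) * lnorm p (fun ν => xnorm s p (levelSum f g h ν)) := by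
  have hp : 1 ≤ p := hpq.symm.lt.le
  have hp0 : 0 < p := hpq.symm.pos
  calc _ ≤ ∑' l, ∑' ν, D l (τ + 2 * ν) * xnorm s p (levelSum f g h ν) := by
        refine ENNReal.tsum_le_tsum fun l => ?_
        rw [funext (duhamelAtom_eq D τ f g h l)]
        refine (xnorm_tsum_le hp _).trans (le_of_eq (tsum_congr fun ν => ?_))
        exact xnorm_const_mul hp0 _ _
    _ = ∑' ν, (∑' l, D l (τ + 2 * ν)) * xnorm s p (levelSum f g h ν) := by
        rw [ENNReal.tsum_comm]
        simp_rw [ENNReal.tsum_mul_right]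
    _ ≤ lnorm q (fun ν => ∑' l, D l (τ + 2 * ν)) *
          lnorm p (fun ν => xnorm s p (levelSum f g h ν)) := tsum_mul_le_lnorm_mul_lnorm hpq _ _
    _ ≤ _ := by
        gcongr
        refine ENNReal.rpow_le_rpow ?_ (by have := hpq.pos; positivity)
        exact ENNReal.tsum_comp_le_tsum_of_injective (f := fun ν : ℤ => τ + 2 * ν)
          (fun a b hab => by simpa using hab) fun τ => (∑' l, D l τ) ^ q

/-- The norm of the space `ℓ¹` in the time frequency of `𝓕L^{s,p}` sequences. -/
def znorm (s p : ℝ) (x : ℤ → ℤ × ℤ → ℝ≥0∞) : ℝ≥0∞ := ∑' τ, xnorm s p (x τ)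

/-- The trilinear Duhamel operator with time kernel `D` on nonnegative arrays. -/
def duhamelAbs (D : ℤ → ℤ → ℝ≥0∞) (x y z : ℤ → ℤ × ℤ → ℝ≥0∞) (l : ℤ) (n : ℤ × ℤ) : ℝ≥0∞ :=
  ∑' τ : ℤ × ℤ × ℤ, duhamelAtom D (τ.1 - τ.2.1 + τ.2.2) (x τ.1) (y τ.2.1) (z τ.2.2) l n

/-- The sizes `A`, `B`, `E` of the inputs are left abstract so that the strong estimate and the
three weak ones share the proof. -/
lemma znorm_duhamelAbs_le {s p q : ℝ} (hpq : q.HolderConjugate p) (D : ℤ → ℤ → ℝ≥0∞)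
    (x y z : ℤ → ℤ × ℤ → ℝ≥0∞) {C : ℝ≥0∞} (A B E : ℤ → ℝ≥0∞)
    (h : ∀ i j k, lnorm p (fun ν => xnorm s p (levelSum (x i) (y j) (z k) ν)) ≤
      C * (A i * B j * E k)) :
    znorm s p (duhamelAbs D x y z) ≤
      C * lnorm q (fun τ => ∑' l, D l τ) * ((∑' i, A i) * (∑' j, B j) * ∑' k, E k) := by
  have hp : 1 ≤ p := hpq.symm.lt.le
  calc _ ≤ ∑' l, ∑' τ : ℤ × ℤ × ℤ, xnorm s p
        (duhamelAtom D (τ.1 - τ.2.1 + τ.2.2) (x τ.1) (y τ.2.1) (z τ.2.2) l) :=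
        ENNReal.tsum_le_tsum fun l => xnorm_tsum_le hp _
    _ = ∑' τ : ℤ × ℤ × ℤ, ∑' l, xnorm s p
        (duhamelAtom D (τ.1 - τ.2.1 + τ.2.2) (x τ.1) (y τ.2.1) (z τ.2.2) l) := ENNReal.tsum_comm
    _ ≤ ∑' τ : ℤ × ℤ × ℤ, lnorm q (fun τ => ∑' l, D l τ) *
          (C * (A τ.1 * (B τ.2.1 * E τ.2.2))) := by
        refine ENNReal.tsum_le_tsum fun τ => (tsum_xnorm_duhamelAtom_le hpq D _ _ _ _).trans ?_
        gcongr
        exact (h _ _ _).trans_eq (by ring)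
    _ = _ := by
        rw [ENNReal.tsum_mul_left, ENNReal.tsum_mul_left,
          tsum_mul_prod A (fun y : ℤ × ℤ => B y.1 * E y.2), tsum_mul_prod]
        ring

lemma exists_znorm_duhamelAbs_le {p s : ℝ} (hp : 1 < p) (hs : 1 - 1 / p < s) :
    ∃ C : ℝ≥0∞, C ≠ ⊤ ∧
      (∀ q, q.HolderConjugate p → ∀ D x y z, znorm s p (duhamelAbs D x y z) ≤
        C * lnorm q (fun τ => ∑' l, D l τ) * (znorm s p x * znorm s p y * znorm s p z)) ∧
      ∀ r q, p ≤ r → q.HolderConjugate r → ∀ D w x y,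
        znorm 0 r (duhamelAbs D w x y) ≤
          C * lnorm q (fun τ => ∑' l, D l τ) * (znorm 0 r w * znorm s p x * znorm s p y) ∧
        znorm 0 r (duhamelAbs D x w y) ≤
          C * lnorm q (fun τ => ∑' l, D l τ) * (znorm 0 r w * znorm s p x * znorm s p y) ∧
        znorm 0 r (duhamelAbs D x y w) ≤
          C * lnorm q (fun τ => ∑' l, D l τ) * (znorm 0 r w * znorm s p x * znorm s p y) := by
  obtain ⟨C, hC, h⟩ := exists_level_bound hp hs
  obtain ⟨C', hC', h'⟩ := exists_level_bound_xnorm hp hs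
  refine ⟨C + C', ENNReal.add_ne_top.mpr ⟨hC, hC'⟩, fun q hpq D x y z => ?_,
    fun r q hpr hqr D w x y => ⟨?_, ?_, ?_⟩⟩
  · refine (znorm_duhamelAbs_le hpq D x y z _ _ _ fun i j k => h' _ _ _).trans ?_
    simp only [znorm]
    gcongr
    exact le_add_self
  · refine (znorm_duhamelAbs_le hqr D w x y (fun i => xnorm 0 r (w i)) (fun i => xnorm s p (x i))
      (fun i => xnorm s p (y i)) (C := C) fun i j k => ?_).trans ?_
    · simp only [xnorm_zero_left]
      exact (h r hpr _ _ _).1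
    · simp only [znorm]
      gcongr
      exact le_self_add
  · refine (znorm_duhamelAbs_le hqr D x w y (fun i => xnorm s p (x i)) (fun i => xnorm 0 r (w i))
      (fun i => xnorm s p (y i)) (C := C) fun i j k => ?_).trans ?_
    · simp only [xnorm_zero_left]
      exact (h r hpr _ _ _).2.1.trans_eq (by ring)
    · rw [mul_comm (∑' i, xnorm s p (x i))]
      simp only [znorm]
      gcongr
      exact le_self_add
  · refine (znorm_duhamelAbs_le hqr D x y w (fun i => xnorm s p (x i)) (fun i => xnorm s p (y i))
      (fun i => xnorm 0 r (w i)) (C := C) fun i j k => ?_).trans ?_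
    · simp only [xnorm_zero_left]
      exact (h r hpr _ _ _).2.2.trans_eq (by ring)
    · rw [mul_comm (_ * _) (∑' i, xnorm 0 r (w i)), ← mul_assoc (∑' i, xnorm 0 r (w i))]
      simp only [znorm]
      gcongr
      exact le_self_add

/-! ### The crude bound by Young's inequality -/

/-- The full trilinear convolution. -/
def tripleConv (f g h : ℤ × ℤ → ℝ≥0∞) (n : ℤ × ℤ) : ℝ≥0∞ :=
  ∑' z : (ℤ × ℤ) × (ℤ × ℤ), f z.1 * g (mid n z) * h z.2

/-- Young's inequality for three factors. -/
lemma lnorm_tripleConv_le {r q : ℝ} (hr : 1 ≤ r) (hq : q = 3 * r / (2 * r + 1))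
    (f g h : ℤ × ℤ → ℝ≥0∞) :
    lnorm r (tripleConv f g h) ≤ lnorm q f * lnorm q g * lnorm q h := by
  have hr0 : 0 < r := by linarith
  have hq0 : 0 < q := by rw [hq]; positivity
  have hr1 : 1 / r ≤ 1 := by rw [div_le_one hr0]; exact hr
  -- Each input is split into three powers: one for the triple product, one for each of the two
  -- pairs that contain it.
  have hqq : 1 / q = 1 / r + (1 - 1 / r) / 3 + (1 - 1 / r) / 3 := by rw [hq]; field_simp; ring
  have hc : 0 ≤ (1 - 1 / r) / 3 := by linarith
  set F := ∑' n, f n ^ q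
  set G := ∑' n, g n ^ q
  set H := ∑' n, h n ^ q
  have hroot : ∀ a : ℝ≥0∞, a = (a ^ q) ^ (1 / r) * (a ^ q) ^ ((1 - 1 / r) / 3) *
      (a ^ q) ^ ((1 - 1 / r) / 3) := by
    intro a
    rw [← ENNReal.rpow_add_of_nonneg _ _ (by positivity) hc,
      ← ENNReal.rpow_add_of_nonneg _ _ (by positivity) hc, ← hqq, ← ENNReal.rpow_mul,
      mul_one_div_cancel hq0.ne', ENNReal.rpow_one]
  have hpair : ∀ (u v : ℤ × ℤ → ℝ≥0∞) (e : (ℤ × ℤ) × (ℤ × ℤ) → (ℤ × ℤ) × (ℤ × ℤ)),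
      Function.Injective e →
      ∑' z, u (e z).1 ^ q * v (e z).2 ^ q ≤ (∑' n, u n ^ q) * ∑' n, v n ^ q := by
    intro u v e he
    calc _ ≤ ∑' y : (ℤ × ℤ) × (ℤ × ℤ), u y.1 ^ q * v y.2 ^ q :=
          ENNReal.tsum_comp_le_tsum_of_injective he fun y => u y.1 ^ q * v y.2 ^ q
      _ = _ := tsum_mul_prod (fun n => u n ^ q) (fun n => v n ^ q)
  have hpoint : ∀ n, tripleConv f g h n ≤
      (∑' z : (ℤ × ℤ) × (ℤ × ℤ), f z.1 ^ q * g (mid n z) ^ q * h z.2 ^ q) ^ (1 / r) *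
        ((F * G) ^ ((1 - 1 / r) / 3) * (G * H) ^ ((1 - 1 / r) / 3) *
          (F * H) ^ ((1 - 1 / r) / 3)) := by
    intro n
    have h4 := tsum_prod_rpow_le (ι := (ℤ × ℤ) × (ℤ × ℤ)) (Finset.univ : Finset (Fin 4))
      ![fun z => f z.1 ^ q * g (mid n z) ^ q * h z.2 ^ q, fun z => f z.1 ^ q * g (mid n z) ^ q,
        fun z => g (mid n z) ^ q * h z.2 ^ q, fun z => f z.1 ^ q * h z.2 ^ q]
      ![1 / r, (1 - 1 / r) / 3, (1 - 1 / r) / 3, (1 - 1 / r) / 3]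
      (by simp [Fin.sum_univ_four]; ring)
      (by
        intro k _
        fin_cases k
        · simp; positivity
        all_goals simpa using hc)
    simp only [Fin.prod_univ_four, Matrix.cons_val_zero, Matrix.cons_val_one, Matrix.cons_val] at h4
    refine le_trans (le_of_eq ?_) (h4.trans ?_)
    · refine tsum_congr fun z => ?_
      conv_lhs => rw [hroot (f z.1), hroot (g (mid n z)), hroot (h z.2)]
      simp only [ENNReal.mul_rpow_of_nonneg _ _ hc,
        ENNReal.mul_rpow_of_nonneg _ _ (show 0 ≤ 1 / r by positivity)]
      ring
    · rw [mul_assoc, mul_assoc, mul_assoc]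
      gcongr
      · exact hpair f g (fun z => (z.1, mid n z)) fun z z' hz => by
          simp only [mid, Prod.mk.injEq] at hz
          obtain ⟨h1, h2⟩ := hz
          refine Prod.ext h1 ?_
          rw [h1] at h2
          simpa using h2
      · exact hpair g h (fun z => (mid n z, z.2)) fun z z' hz => by
          simp only [mid, Prod.mk.injEq] at hz
          obtain ⟨h1, h2⟩ := hz
          refine Prod.ext ?_ h2
          rw [h2] at h1
          simpa using h1
      · exact hpair f h id Function.injective_id
  rw [lnorm_le_iff hr0]
  calc _ ≤ ∑' n, (∑' z : (ℤ × ℤ) × (ℤ × ℤ), f z.1 ^ q * g (mid n z) ^ q * h z.2 ^ q) *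
        ((F * G) ^ ((1 - 1 / r) / 3) * (G * H) ^ ((1 - 1 / r) / 3) *
          (F * H) ^ ((1 - 1 / r) / 3)) ^ r := by
        refine ENNReal.tsum_le_tsum fun n => (ENNReal.rpow_le_rpow (hpoint n) hr0.le).trans_eq ?_
        rw [ENNReal.mul_rpow_of_nonneg _ _ hr0.le, ← ENNReal.rpow_mul, one_div_mul_cancel hr0.ne',
          ENNReal.rpow_one]
    _ ≤ (F * G * H) * ((F * G) ^ ((1 - 1 / r) / 3) * (G * H) ^ ((1 - 1 / r) / 3) *
          (F * H) ^ ((1 - 1 / r) / 3)) ^ r := by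
        rw [ENNReal.tsum_mul_right]
        gcongr
        rw [ENNReal.tsum_comm, ENNReal.tsum_prod']
        refine le_of_eq ?_
        calc _ = ∑' a, ∑' b, f a ^ q * h b ^ q * G := by
              refine tsum_congr fun a => tsum_congr fun b => ?_
              have : ∀ n, f a ^ q * g (mid n (a, b)) ^ q * h b ^ q =
                  f a ^ q * h b ^ q * g ((Equiv.subLeft (a + b)) n) ^ q := fun n => by
                simp only [mid, Equiv.subLeft_apply]; ring
              rw [tsum_congr this, ENNReal.tsum_mul_left,
                (Equiv.subLeft (a + b)).tsum_eq fun n => g n ^ q]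
          _ = _ := by
              simp_rw [ENNReal.tsum_mul_right, ENNReal.tsum_mul_left, ENNReal.tsum_mul_right]
              ring
    _ = _ := by
        have e : ∀ a : ℝ≥0∞, (a ^ (1 / q)) ^ r = a * ((a ^ ((1 - 1 / r) / 3)) ^ r *
            (a ^ ((1 - 1 / r) / 3)) ^ r) := by
          intro a
          rw [hqq, ENNReal.rpow_add_of_nonneg _ _ (by positivity) hc,
            ENNReal.rpow_add_of_nonneg _ _ (by positivity) hc,
            ENNReal.mul_rpow_of_nonneg _ _ hr0.le, ENNReal.mul_rpow_of_nonneg _ _ hr0.le,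
            ← ENNReal.rpow_mul a (1 / r), one_div_mul_cancel hr0.ne', ENNReal.rpow_one, mul_assoc]
        simp only [lnorm, ENNReal.mul_rpow_of_nonneg _ _ hr0.le, ENNReal.mul_rpow_of_nonneg _ _ hc]
        rw [e, e, e]
        ring

/-- `𝓕L^{s,p}` embeds into some `ℓ^q` with `q < 3/2`, where `q = 3r/(2r+1)`. -/
lemma exists_lnorm_le_xnorm {p s : ℝ} (hp : 1 < p) (hs : 1 - 1 / p < s)
    (hs' : 4 / 3 - 2 / p < s) : ∃ r, p ≤ r ∧ ∃ C : ℝ≥0∞, C ≠ ⊤ ∧ ∀ f : ℤ × ℤ → ℝ≥0∞,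
      lnorm (3 * r / (2 * r + 1)) f ≤ C * xnorm s p f := by
  have hp0 : 0 < p := by linarith
  have hs0 : 0 ≤ s := by
    have : 1 / p < 1 := by rw [div_lt_one hp0]; exact hp
    linarith
  -- Below `3/2` the weight is not needed: `r` is chosen so that `3r / (2r + 1) = p`.
  by_cases hp32 : p < 3 / 2
  · have h3 : 0 < 3 - 2 * p := by linarith
    refine ⟨p / (3 - 2 * p), ?_, 1, by simp, fun f => ?_⟩
    · rw [le_div_iff₀ h3]; nlinarith
    · rw [one_mul]
      have : 3 * (p / (3 - 2 * p)) / (2 * (p / (3 - 2 * p)) + 1) = p := by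
        have h : 2 * (p / (3 - 2 * p)) + 1 = 3 / (3 - 2 * p) := by
          field_simp; ring
        rw [h, mul_div_assoc', div_div_div_cancel_right₀ h3.ne']; ring
      rw [this]
      exact lnorm_le_xnorm hs0 hp0 f
  · set δ := s - (4 / 3 - 2 / p) with hδ
    have hδ0 : 0 < δ := by linarith
    -- As `1/q = 2/3 + 1/(3r)`, taking `1/r ≤ δ` keeps `2 (1/q - 1/p)` below `s`, as Hölder against
    -- a summable weight on `ℤ²` requires.
    refine ⟨max p (1 / δ), le_max_left _ _, ?_⟩
    set r := max p (1 / δ) with hr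
    have hrp : p ≤ r := le_max_left _ _
    have hr0 : 0 < r := hp0.trans_le hrp
    have hrδ : 1 / r ≤ δ := by
      rw [div_le_iff₀ hr0]
      have : 1 / δ ≤ r := le_max_right _ _
      rw [div_le_iff₀ hδ0] at this
      linarith
    set q := 3 * r / (2 * r + 1) with hq
    have hq0 : 0 < q := by positivity
    have hqp : q < p := by
      rw [hq, div_lt_iff₀ (by positivity)]
      nlinarith
    have hqinv : 1 / q = 2 / 3 + 1 / (3 * r) := by rw [hq]; field_simp
    set θ := 1 - q / p with hθ
    have hθ0 : 0 < θ := by rw [hθ, sub_pos, div_lt_one hp0]; exact hqp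
    have hσ : 2 < s * q / θ := by
      rw [lt_div_iff₀ hθ0]
      have h1 : θ = q * (1 / q - 1 / p) := by rw [hθ]; field_simp
      have h2 : 2 * (1 / q - 1 / p) < s := by
        rw [hqinv]
        have h3 : 1 / (3 * r) = 1 / r / 3 := by field_simp
        have h4 : 2 / p = 2 * (1 / p) := by ring
        rw [h3]
        linarith
      rw [h1]
      nlinarith
    have hW := tsum_wt_ne_top hσ
    refine ⟨((∑' n, wt (s * q / θ) n) ^ θ) ^ (1 / q), ENNReal.rpow_ne_top_of_nonneg (by positivity)
      (ENNReal.rpow_ne_top_of_nonneg hθ0.le hW), fun f => ?_⟩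
    have h2 := tsum_prod_rpow_le (Finset.univ : Finset (Fin 2))
      ![wt (s * q / θ), fun n => (wt (-s) n * f n) ^ p] ![θ, q / p]
      (by simp [hθ]) (by
        intro k _
        fin_cases k
        · simpa using hθ0.le
        · simp; positivity)
    simp only [Fin.prod_univ_two, Matrix.cons_val_zero, Matrix.cons_val_one] at h2
    have h3 : ∀ n, wt (s * q / θ) n ^ θ * ((wt (-s) n * f n) ^ p) ^ (q / p) = f n ^ q := by
      intro n
      rw [← ENNReal.rpow_mul, mul_div_cancel₀ _ hp0.ne', wt_rpow _ hθ0.le,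
        div_mul_cancel₀ _ hθ0.ne', ENNReal.mul_rpow_of_nonneg _ _ hq0.le, wt_rpow _ hq0.le,
        ← mul_assoc, neg_mul, wt_mul_wt_neg, one_mul]
    rw [tsum_congr h3] at h2
    refine (ENNReal.rpow_le_rpow h2 (show 0 ≤ 1 / q by positivity)).trans (le_of_eq ?_)
    rw [ENNReal.mul_rpow_of_nonneg _ _ (by positivity), xnorm, lnorm, ← ENNReal.rpow_mul _ (q / p)]
    congr 2
    field_simp

/-! ### The time kernel of the Duhamel integral -/

/-- The exponential `e^{iτt}`. -/
def expi (τ : ℤ) (t : ℝ) : ℂ := Complex.exp (τ * t * Complex.I)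

@[fun_prop]
lemma continuous_expi (τ : ℤ) : Continuous (expi τ) := by
  unfold expi; fun_prop

lemma norm_expi (τ : ℤ) (t : ℝ) : ‖expi τ t‖ = 1 := by
  have : ((τ : ℂ) * (t : ℂ)) = ((τ * t : ℝ) : ℂ) := by push_cast; rfl
  rw [expi, this, Complex.norm_exp_ofReal_mul_I]

lemma enorm_expi (τ : ℤ) (t : ℝ) : ‖expi τ t‖ₑ = 1 := by
  rw [← ofReal_norm, norm_expi, ENNReal.ofReal_one]

lemma expi_add (τ τ' : ℤ) (t : ℝ) : expi (τ + τ') t = expi τ t * expi τ' t := by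
  simp only [expi, ← Complex.exp_add]; push_cast; congr 1; ring

lemma expi_add_right (τ : ℤ) (t t' : ℝ) : expi τ (t + t') = expi τ t * expi τ t' := by
  simp only [expi, ← Complex.exp_add]; push_cast; congr 1; ring

lemma expi_zero (t : ℝ) : expi 0 t = 1 := by simp [expi]

lemma expi_at_zero (τ : ℤ) : expi τ 0 = 1 := by simp [expi]

lemma star_expi (τ : ℤ) (t : ℝ) : star (expi τ t) = expi (-τ) t := by
  rw [expi, Complex.star_def, ← Complex.exp_conj, expi]
  congr 1
  simp

lemma fourier_coe_eq_expi (n : ℤ) (t : ℝ) :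
    fourier n (t : AddCircle (2 * Real.pi)) = expi n t := by
  rw [fourier_coe_apply, expi]
  congr 1
  push_cast
  field_simp

lemma hasDerivAt_expi (τ : ℤ) (t : ℝ) :
    HasDerivAt (expi τ) (τ * Complex.I * expi τ t) t := by
  have h : HasDerivAt (fun t : ℝ => (τ : ℂ) * t * Complex.I) (τ * Complex.I) t := by
    simpa using ((Complex.ofRealCLM.hasDerivAt (x := t)).const_mul (τ : ℂ)).mul_const Complex.I
  have h2 := h.cexp
  rw [mul_comm] at h2
  exact h2

lemma norm_integral_expi_le (τ : ℤ) {t : ℝ} (ht : 0 ≤ t) :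
    ‖∫ x in (0 : ℝ)..t, expi τ x‖ ≤ t := by
  have := intervalIntegral.norm_integral_le_of_norm_le_const (a := 0) (b := t) (C := 1)
    (f := expi τ) (fun x _ => (norm_expi τ x).le)
  simpa [abs_of_nonneg ht] using this

lemma hasDerivAt_integral_expi (τ : ℤ) (a t : ℝ) :
    HasDerivAt (fun t => ∫ x in a..t, expi τ x) (expi τ t) t :=
  intervalIntegral.integral_hasDerivAt_right ((continuous_expi τ).intervalIntegrable _ _)
    (continuous_expi τ).stronglyMeasurable.stronglyMeasurableAtFilter (continuous_expi τ).continuousAt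

/-- The primitive of `e^{iτt}`, continued linearly to a continuous function on the circle. -/
def cutPrimitive (T : ℝ) (τ : ℤ) (t : ℝ) : ℂ :=
  if t ≤ T then ∫ x in (0 : ℝ)..t, expi τ x
  else (∫ x in (0 : ℝ)..T, expi τ x) * ((2 * Real.pi - t) / (2 * Real.pi - T) : ℝ)

/-- The right derivative of `cutPrimitive`. -/
def cutPrimitiveDeriv (T : ℝ) (τ : ℤ) (t : ℝ) : ℂ :=
  if t < T then expi τ t
  else (∫ x in (0 : ℝ)..T, expi τ x) * ((-1) / (2 * Real.pi - T) : ℝ)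

lemma continuous_cutPrimitive {T : ℝ} (hT : T < 2 * Real.pi) (τ : ℤ) :
    Continuous (cutPrimitive T τ) := by
  refine Continuous.if_le ?_ ?_ continuous_id continuous_const ?_
  · exact continuous_iff_continuousAt.mpr fun t => (hasDerivAt_integral_expi τ 0 t).continuousAt
  · fun_prop
  · rintro x rfl
    rw [div_self (by linarith)]; simp

lemma hasDerivWithinAt_cutPrimitive {T : ℝ} (hT : T < 2 * Real.pi) (τ : ℤ) (t : ℝ) :
    HasDerivWithinAt (cutPrimitive T τ) (cutPrimitiveDeriv T τ t) (Set.Ioi t) t := by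
  by_cases h : t < T
  · rw [cutPrimitiveDeriv, if_pos h]
    refine ((hasDerivAt_integral_expi τ 0 t).congr_of_eventuallyEq ?_).hasDerivWithinAt
    filter_upwards [Iio_mem_nhds h] with x hx
    rw [cutPrimitive, if_pos hx.le]
  · rw [cutPrimitiveDeriv, if_neg h]
    have h1 : HasDerivAt (fun t : ℝ => (2 * Real.pi - t) / (2 * Real.pi - T))
        ((-1) / (2 * Real.pi - T)) t := by
      simpa using ((hasDerivAt_id t).const_sub (2 * Real.pi)).div_const (2 * Real.pi - T)
    have h2 := (h1.ofReal_comp.const_mul (∫ x in (0 : ℝ)..T, expi τ x)).hasDerivWithinAt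
      (s := Set.Ioi t)
    have hc : ∀ x, T < x → cutPrimitive T τ x =
        (∫ x in (0 : ℝ)..T, expi τ x) * ((2 * Real.pi - x) / (2 * Real.pi - T) : ℝ) := by
      intro x hx
      rw [cutPrimitive, if_neg hx.not_ge]
    refine h2.congr (fun x hx => hc x ((not_lt.mp h).trans_lt hx)) ?_
    rcases (not_lt.mp h).eq_or_lt with rfl | h'
    · rw [cutPrimitive, if_pos le_rfl, div_self (by linarith)]; simp
    · exact hc t h'

lemma norm_cutPrimitive_le {T : ℝ} (hT0 : 0 ≤ T) (hT : T ≤ 1) (τ : ℤ) {t : ℝ} (ht : 0 ≤ t)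
    (ht' : t ≤ 2 * Real.pi) : ‖cutPrimitive T τ t‖ ≤ T := by
  have hpi := Real.pi_gt_three
  rw [cutPrimitive]
  split_ifs with h
  · exact (norm_integral_expi_le τ ht).trans h
  · have h1 : (2 * Real.pi - t) / (2 * Real.pi - T) ≤ 1 := by
      rw [div_le_one (by linarith)]; linarith
    have h0 : 0 ≤ (2 * Real.pi - t) / (2 * Real.pi - T) :=
      div_nonneg (by linarith) (by linarith)
    rw [norm_mul, Complex.norm_real, Real.norm_of_nonneg h0]
    calc _ ≤ T * 1 := mul_le_mul (norm_integral_expi_le τ hT0) h1 h0 hT0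
      _ = T := mul_one T

/-- Beyond `T` the slope is at most `T`, since a value of size at most `T` is brought to zero over a
length of at least `1`. Integrating over a period, the squared `L²` norm is `O(T)`, the source of
the factor `√T` below. -/
lemma norm_cutPrimitiveDeriv_sq_le {T : ℝ} (hT0 : 0 ≤ T) (hT : T ≤ 1) (τ : ℤ) (t : ℝ) :
    ‖cutPrimitiveDeriv T τ t‖ ^ 2 ≤ (if t < T then 1 else 0) + T := by
  have hpi := Real.pi_gt_three
  rw [cutPrimitiveDeriv]
  split_ifs with h
  · rw [norm_expi]; linarith
  · have h1 : |(-1) / (2 * Real.pi - T)| ≤ 1 := by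
      rw [abs_div, abs_neg, abs_one, abs_of_pos (by linarith : 0 < 2 * Real.pi - T),
        div_le_one (by linarith)]
      linarith
    have h2 : ‖(∫ x in (0 : ℝ)..T, expi τ x) * (((-1) / (2 * Real.pi - T) : ℝ) : ℂ)‖ ≤ T := by
      rw [norm_mul, Complex.norm_real, Real.norm_eq_abs]
      calc _ ≤ T * 1 := mul_le_mul (norm_integral_expi_le τ hT0) h1 (abs_nonneg _) hT0
        _ = T := mul_one T
    have h3 := norm_nonneg ((∫ x in (0 : ℝ)..T, expi τ x) * (((-1) / (2 * Real.pi - T) : ℝ) : ℂ))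
    nlinarith

lemma measurable_cutPrimitiveDeriv (T : ℝ) (τ : ℤ) : Measurable (cutPrimitiveDeriv T τ) :=
  Measurable.ite measurableSet_Iio (continuous_expi τ).measurable measurable_const

lemma norm_cutPrimitiveDeriv_le {T : ℝ} (hT0 : 0 ≤ T) (hT : T ≤ 1) (τ : ℤ) (t : ℝ) :
    ‖cutPrimitiveDeriv T τ t‖ ≤ 2 := by
  have := norm_cutPrimitiveDeriv_sq_le hT0 hT τ t
  have h2 : (if t < T then (1 : ℝ) else 0) ≤ 1 := by split_ifs <;> norm_num
  nlinarith [norm_nonneg (cutPrimitiveDeriv T τ t)]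

lemma memLp_cutPrimitiveDeriv {T : ℝ} (hT0 : 0 ≤ T) (hT : T ≤ 1) (τ : ℤ) (a b : ℝ) :
    MemLp (cutPrimitiveDeriv T τ) 2 (volume.restrict (Set.Ioc a b)) :=
  MemLp.of_bound (measurable_cutPrimitiveDeriv T τ).aestronglyMeasurable 2
    (Filter.Eventually.of_forall fun t => norm_cutPrimitiveDeriv_le hT0 hT τ t)

lemma integral_norm_cutPrimitiveDeriv_sq_le {T : ℝ} (hT0 : 0 ≤ T) (hT : T ≤ 1) (τ : ℤ) :
    ∫ t in (0 : ℝ)..(0 + 2 * Real.pi), ‖cutPrimitiveDeriv T τ t‖ ^ 2 ≤ (1 + 2 * Real.pi) * T := by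
  have hpi := Real.pi_gt_three
  have hi : IntervalIntegrable (fun t : ℝ => Set.indicator (Set.Iio T) (fun _ => (1 : ℝ)) t) volume
      0 (0 + 2 * Real.pi) := by
    rw [intervalIntegrable_iff]
    exact IntegrableOn.indicator (integrableOn_const (by simp [ENNReal.mul_eq_top])) measurableSet_Iio
  have h : IntervalIntegrable (fun t : ℝ => ‖cutPrimitiveDeriv T τ t‖ ^ 2) volume
      0 (0 + 2 * Real.pi) := by
    rw [intervalIntegrable_iff_integrableOn_Ioc_of_le (by linarith)]
    exact (memLp_cutPrimitiveDeriv hT0 hT τ _ _).integrable_norm_pow (by norm_num)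
  calc _ ≤ ∫ t in (0 : ℝ)..(0 + 2 * Real.pi), (Set.indicator (Set.Iio T) (fun _ => (1 : ℝ)) t + T) :=
        intervalIntegral.integral_mono (by linarith) h (hi.add (by simp)) fun t => by
          refine (norm_cutPrimitiveDeriv_sq_le hT0 hT τ t).trans_eq ?_
          simp [Set.indicator_apply]
    _ = T + (2 * Real.pi) * T := by
        rw [intervalIntegral.integral_add hi (by simp)]
        congr 1
        · rw [intervalIntegral.integral_of_le (by linarith), integral_indicator measurableSet_Iio,
            Measure.restrict_restrict measurableSet_Iio]
          have : Set.Iio T ∩ Set.Ioc 0 (0 + 2 * Real.pi) = Set.Ioo 0 T := by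
            ext x; simp only [Set.mem_inter_iff, Set.mem_Iio, Set.mem_Ioc, Set.mem_Ioo]
            constructor
            · rintro ⟨h1, h2, h3⟩; exact ⟨h2, h1⟩
            · rintro ⟨h1, h2⟩; exact ⟨h2, h1, by linarith⟩
          rw [this]; simp [hT0]
        · simp
    _ = _ := by ring

/-- Cauchy–Schwarz for the coefficients of a primitive: the mode `0` is set apart and `1/|n|` is
square summable on the others. -/
lemma tsum_enorm_le_of_sq {c d : ℤ → ℝ≥0∞} (h : ∀ n, n ≠ 0 → c n = ‖(n : ℝ)‖ₑ⁻¹ * d n) :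
    ∑' n, c n ≤ c 0 + (∑' n : ℤ, if n = 0 then 0 else ‖(n : ℝ)‖ₑ⁻¹ ^ (2 : ℝ)) ^ (1 / 2 : ℝ) *
      (∑' n : ℤ, d n ^ (2 : ℝ)) ^ (1 / 2 : ℝ) := by
  calc ∑' n, c n ≤ ∑' n : ℤ, ((if n = 0 then c 0 else 0) +
        (if n = 0 then 0 else ‖(n : ℝ)‖ₑ⁻¹) * d n) := by
        refine ENNReal.tsum_le_tsum fun n => ?_
        by_cases hn : n = 0
        · simp [hn]
        · simp [hn, h n hn]
    _ ≤ _ := by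
        rw [ENNReal.tsum_add, tsum_ite_eq]
        gcongr
        have h2 : (2 : ℝ).HolderConjugate 2 := Real.HolderConjugate.two_two
        refine (tsum_mul_le_lnorm_mul_lnorm h2 _ _).trans_eq ?_
        simp only [lnorm]
        congr 3
        funext n
        by_cases hn : n = 0 <;> simp [hn]

lemma tsum_inv_sq_ne_top :
    (∑' n : ℤ, if n = 0 then 0 else ‖(n : ℝ)‖ₑ⁻¹ ^ (2 : ℝ) : ℝ≥0∞) ≠ ⊤ := by
  have h := (Real.summable_one_div_int_pow (p := 2)).mpr (by norm_num)
  have h2 : (∑' n : ℤ, if n = 0 then 0 else ‖(n : ℝ)‖ₑ⁻¹ ^ (2 : ℝ) : ℝ≥0∞) =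
      ∑' n : ℤ, ENNReal.ofReal (1 / (n : ℝ) ^ 2) := by
    refine tsum_congr fun n => ?_
    by_cases hn : n = 0
    · simp [hn]
    · have : (0 : ℝ) < |(n : ℝ)| := by positivity
      rw [if_neg hn, ← ofReal_norm, ← ENNReal.ofReal_inv_of_pos (by simpa using hn),
        ENNReal.ofReal_rpow_of_nonneg (by positivity) (by norm_num)]
      congr 1
      simp [Real.norm_eq_abs]
  rw [h2]
  exact h.tsum_ofReal_ne_top

/-- Fourier coefficients of the continued primitive. -/
def cutCoeff (T : ℝ) (τ n : ℤ) : ℂ :=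
  fourierCoeffOn (lt_add_of_pos_right 0 Real.two_pi_pos) (cutPrimitive T τ) n

lemma cutPrimitive_zero {T : ℝ} (hT0 : 0 ≤ T) (τ : ℤ) : cutPrimitive T τ 0 = 0 := by
  simp [cutPrimitive, hT0]

lemma cutPrimitive_two_pi {T : ℝ} (hT : T < 2 * Real.pi) (τ : ℤ) :
    cutPrimitive T τ (2 * Real.pi) = 0 := by
  simp [cutPrimitive, hT.not_ge]

/-- Integration by parts; the linear continuation was chosen to vanish at `2π`, so there is no
boundary term. -/
lemma cutCoeff_eq {T : ℝ} (hT0 : 0 ≤ T) (hT : T ≤ 1) (τ : ℤ) {n : ℤ} (hn : n ≠ 0) :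
    ‖cutCoeff T τ n‖ₑ = ‖(n : ℝ)‖ₑ⁻¹ *
      ‖fourierCoeffOn (lt_add_of_pos_right 0 Real.two_pi_pos) (cutPrimitiveDeriv T τ) n‖ₑ := by
  have hpi := Real.pi_gt_three
  have hT2 : T < 2 * Real.pi := by linarith
  have hn' : (n : ℝ) ≠ 0 := by exact_mod_cast hn
  rw [cutCoeff, fourierCoeffOn_of_hasDeriv_right (f' := cutPrimitiveDeriv T τ) _ hn
    (continuous_cutPrimitive hT2 τ).continuousOn
    (fun x _ => hasDerivWithinAt_cutPrimitive hT2 τ x)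
    ((intervalIntegrable_iff_integrableOn_Ioc_of_le (by linarith)).mpr
      ((memLp_cutPrimitiveDeriv hT0 hT τ _ _).integrable (by norm_num)))]
  simp only [zero_add, cutPrimitive_zero hT0, cutPrimitive_two_pi hT2, sub_self, mul_zero,
    Complex.ofReal_zero, sub_zero, zero_sub]
  rw [← ofReal_norm, ← ofReal_norm, ← ofReal_norm, ← ENNReal.ofReal_inv_of_pos (by positivity),
    ← ENNReal.ofReal_mul (by positivity)]
  congr 1
  simp [abs_of_pos Real.pi_pos]
  field_simp

lemma tsum_cutCoeff_le : ∃ C : ℝ, 0 < C ∧ ∀ T : ℝ, 0 ≤ T → T ≤ 1 → ∀ τ,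
    ∑' n, ‖cutCoeff T τ n‖ₑ ≤ ENNReal.ofReal (C * Real.sqrt T) := by
  have hpi := Real.pi_gt_three
  set K := (∑' n : ℤ, if n = 0 then 0 else ‖(n : ℝ)‖ₑ⁻¹ ^ (2 : ℝ) : ℝ≥0∞) ^ (1 / 2 : ℝ) with hK
  have hKt : K ≠ ⊤ := ENNReal.rpow_ne_top_of_nonneg (by norm_num) tsum_inv_sq_ne_top
  refine ⟨1 + K.toReal * 2, by positivity, fun T hT0 hT τ => ?_⟩
  have h0 : ‖cutCoeff T τ 0‖ₑ ≤ ENNReal.ofReal (Real.sqrt T) := by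
    rw [← ofReal_norm]
    refine ENNReal.ofReal_le_ofReal ?_
    have h1 : ‖cutCoeff T τ 0‖ ≤ T := by
      rw [cutCoeff, fourierCoeffOn_eq_integral, norm_smul]
      have := intervalIntegral.norm_integral_le_of_norm_le_const (a := 0) (b := 0 + 2 * Real.pi)
        (C := T) (f := fun x : ℝ => fourier (-0)
          (x : AddCircle ((0 + 2 * Real.pi) - 0)) • cutPrimitive T τ x) (fun x hx => by
            rw [Set.uIoc_of_le (by linarith)] at hx
            simpa using norm_cutPrimitive_le hT0 hT τ hx.1.le (by linarith [hx.2]))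
      refine (mul_le_mul_of_nonneg_left this (norm_nonneg _)).trans_eq ?_
      rw [zero_add, sub_zero, Real.norm_of_nonneg (by positivity), abs_of_pos (by positivity)]
      field_simp
    refine h1.trans (Real.le_sqrt_of_sq_le ?_)
    nlinarith
  have hd : (∑' n : ℤ, ‖fourierCoeffOn (lt_add_of_pos_right 0 Real.two_pi_pos)
      (cutPrimitiveDeriv T τ) n‖ₑ ^ (2 : ℝ)) ^ (1 / 2 : ℝ) ≤ ENNReal.ofReal (2 * Real.sqrt T) := by
    have hs := hasSum_sq_fourierCoeffOn (lt_add_of_pos_right 0 Real.two_pi_pos)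
      (memLp_cutPrimitiveDeriv hT0 hT τ _ _)
    have e : ∀ n : ℤ, ‖fourierCoeffOn (lt_add_of_pos_right 0 Real.two_pi_pos)
      (cutPrimitiveDeriv T τ) n‖ₑ ^ (2 : ℝ) = ENNReal.ofReal (‖fourierCoeffOn
        (lt_add_of_pos_right 0 Real.two_pi_pos) (cutPrimitiveDeriv T τ) n‖ ^ 2) := by
      intro n
      rw [← ofReal_norm, ENNReal.ofReal_rpow_of_nonneg (norm_nonneg _) (by norm_num)]
      norm_num
    rw [tsum_congr e, ← ENNReal.ofReal_tsum_of_nonneg (fun n => by positivity) hs.summable,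
      hs.tsum_eq]
    have h2 : (0 + 2 * Real.pi - 0)⁻¹ • ∫ x in (0 : ℝ)..(0 + 2 * Real.pi),
        ‖cutPrimitiveDeriv T τ x‖ ^ 2 ≤ 4 * T := by
      rw [smul_eq_mul, inv_mul_le_iff₀ (by linarith)]
      refine (integral_norm_cutPrimitiveDeriv_sq_le hT0 hT τ).trans ?_
      nlinarith
    calc _ ≤ ENNReal.ofReal (4 * T) ^ (1 / 2 : ℝ) := by gcongr
      _ = _ := by
        rw [ENNReal.ofReal_rpow_of_nonneg (by positivity) (by norm_num), ← Real.sqrt_eq_rpow,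
          Real.sqrt_mul (by norm_num)]
        congr 2
        rw [show (4 : ℝ) = 2 ^ 2 by norm_num, Real.sqrt_sq (by norm_num)]
  refine (tsum_enorm_le_of_sq (fun n hn => cutCoeff_eq hT0 hT τ hn)).trans ?_
  rw [← hK]
  calc _ ≤ ENNReal.ofReal (Real.sqrt T) + ENNReal.ofReal K.toReal * ENNReal.ofReal (2 * Real.sqrt T) := by
        rw [ENNReal.ofReal_toReal hKt]; gcongr
    _ = _ := by
        rw [← ENNReal.ofReal_mul (by positivity), ← ENNReal.ofReal_add (by positivity) (by positivity)]
        congr 1; ring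

lemma hasSum_cutCoeff {T : ℝ} (hT0 : 0 ≤ T) (hT : T ≤ 1) (τ : ℤ) {t : ℝ} (ht : 0 ≤ t)
    (htT : t ≤ T) :
    HasSum (fun n => cutCoeff T τ n * expi n t) (∫ x in (0 : ℝ)..t, expi τ x) := by
  have hpi := Real.pi_gt_three
  obtain ⟨C, hC, h⟩ := tsum_cutCoeff_le
  let F : C(AddCircle (2 * Real.pi), ℂ) :=
    ⟨AddCircle.liftIco (2 * Real.pi) 0 (cutPrimitive T τ), AddCircle.liftIco_continuous
      (by rw [zero_add, cutPrimitive_zero hT0, cutPrimitive_two_pi (by linarith)])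
      (continuous_cutPrimitive (by linarith) τ).continuousOn⟩
  have hF : fourierCoeff F = cutCoeff T τ := by
    funext n
    exact fourierCoeff_liftIco_eq _ _
  have hs : Summable (fourierCoeff F) := by
    rw [hF]
    refine Summable.of_enorm ?_
    exact ((h T hT0 hT τ).trans_lt ENNReal.ofReal_lt_top).ne
  have h2 := has_pointwise_sum_fourier_series_of_summable hs t
  rw [hF] at h2
  have h3 : F (t : AddCircle (2 * Real.pi)) = ∫ x in (0 : ℝ)..t, expi τ x := by
    have h4 : t ∈ Set.Ico (0 : ℝ) (0 + 2 * Real.pi) := ⟨ht, by linarith⟩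
    have h5 : F (t : AddCircle (2 * Real.pi)) = cutPrimitive T τ t :=
      AddCircle.liftIco_coe_apply (f := cutPrimitive T τ) h4
    rw [h5, cutPrimitive, if_pos htT]
  rw [h3] at h2
  simpa only [fourier_coe_eq_expi, smul_eq_mul] using h2

/-- `D` is a time kernel on `[t₀, t₁]`: its sections expand the primitives of `e^{iτt}`. -/
def IsTimeKernel (t₀ t₁ : ℝ) (D : ℤ → ℤ → ℂ) : Prop :=
  ∀ τ, ∀ t ∈ Set.Icc t₀ t₁, HasSum (fun l => D l τ * expi l t) (∫ x in t₀..t, expi τ x)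

/-- Majorant of the absolute column sums of time kernels. -/
def kernelBound (A : ℝ) (τ : ℤ) : ℝ≥0∞ := ENNReal.ofReal (min A (2 / max 1 |(τ : ℝ)|))

/-- Two expansions compete for each `τ`: the Fourier series of the continued primitive, of total
size `C √T`, and the explicit `(e^{iτt} - 1)/(iτ)`, of total size `2/|τ|`. The smaller bound is
taken. -/
lemma exists_isTimeKernel_zero : ∃ C : ℝ, 0 < C ∧ ∀ T : ℝ, 0 ≤ T → T ≤ 1 → C * Real.sqrt T ≤ 1 →
    ∃ D, IsTimeKernel 0 T D ∧ ∀ τ, ∑' l, ‖D l τ‖ₑ ≤ kernelBound (C * Real.sqrt T) τ := by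
  obtain ⟨C, hC, h⟩ := tsum_cutCoeff_le
  refine ⟨C, hC, fun T hT0 hT hCT => ?_⟩
  have key : ∀ τ : ℤ, ∃ d : ℤ → ℂ, (∀ t ∈ Set.Icc 0 T,
      HasSum (fun l => d l * expi l t) (∫ x in (0 : ℝ)..t, expi τ x)) ∧
      ∑' l, ‖d l‖ₑ ≤ kernelBound (C * Real.sqrt T) τ := by
    intro τ
    by_cases hτ : C * Real.sqrt T ≤ 2 / max 1 |(τ : ℝ)|
    · refine ⟨cutCoeff T τ, fun t ht => hasSum_cutCoeff hT0 hT τ ht.1 ht.2, ?_⟩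
      rw [kernelBound, min_eq_left hτ]
      exact h T hT0 hT τ
    · push Not at hτ
      -- `C √T ≤ 1 < 2` excludes `|τ| ≤ 1` in this case, so division by `τ` is legitimate.
      have hτ1 : 1 < |(τ : ℝ)| := by
        by_contra hcon
        rw [max_eq_left (not_lt.mp hcon)] at hτ
        linarith
      have hτ0 : τ ≠ 0 := by rintro rfl; simp at hτ1; linarith
      have hτc : (τ : ℂ) * Complex.I ≠ 0 := by simp [hτ0]
      refine ⟨fun l => (if l = τ then (τ * Complex.I : ℂ)⁻¹ else 0) +
        (if l = 0 then -(τ * Complex.I : ℂ)⁻¹ else 0), fun t ht => ?_, ?_⟩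
      · have e : ∫ x in (0 : ℝ)..t, expi τ x =
            (τ * Complex.I : ℂ)⁻¹ * expi τ t + -(τ * Complex.I : ℂ)⁻¹ * expi 0 t := by
          have hd : ∀ x ∈ Set.uIcc 0 t,
              HasDerivAt (fun x => (τ * Complex.I : ℂ)⁻¹ * expi τ x) (expi τ x) x := by
            intro x _
            have := (hasDerivAt_expi τ x).const_mul (τ * Complex.I : ℂ)⁻¹
            rwa [← mul_assoc, inv_mul_cancel₀ hτc, one_mul] at this
          rw [intervalIntegral.integral_eq_sub_of_hasDerivAt hd
            ((continuous_expi τ).intervalIntegrable _ _), expi_at_zero, expi_zero]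
          ring
        rw [e]
        simp only [add_mul]
        refine HasSum.add ?_ ?_
        · convert hasSum_ite_eq τ ((τ * Complex.I : ℂ)⁻¹ * expi τ t) using 2 with l
          split_ifs with hl
          · rw [hl]
          · exact zero_mul _
        · convert hasSum_ite_eq (0 : ℤ) (-(τ * Complex.I : ℂ)⁻¹ * expi 0 t) using 2 with l
          split_ifs with hl
          · rw [hl]
          · exact zero_mul _
      · rw [kernelBound, min_eq_right hτ.le, max_eq_right hτ1.le]
        calc _ ≤ ∑' l : ℤ, ((if l = τ then ENNReal.ofReal (1 / |(τ : ℝ)|) else 0) +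
              (if l = 0 then ENNReal.ofReal (1 / |(τ : ℝ)|) else 0)) := by
              have hn : ‖(τ * Complex.I : ℂ)⁻¹‖ₑ = ENNReal.ofReal (1 / |(τ : ℝ)|) := by
                rw [← ofReal_norm]; simp
              refine ENNReal.tsum_le_tsum fun l => (enorm_add_le _ _).trans (add_le_add ?_ ?_)
              · split_ifs
                · exact hn.le
                · simp
              · split_ifs
                · rw [enorm_neg]; exact hn.le
                · simp
          _ = _ := by
              rw [ENNReal.tsum_add, tsum_ite_eq, tsum_ite_eq,
                ← ENNReal.ofReal_add (by positivity) (by positivity)]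
              congr 1; ring
  choose d hd hd' using key
  exact ⟨fun l τ => d τ l, fun τ => hd τ, hd'⟩

/-- A translation in time multiplies the entries by unimodular factors and leaves the column sums
unchanged, so the admissible length does not depend on the starting time. -/
lemma IsTimeKernel.shift {T : ℝ} {D : ℤ → ℤ → ℂ} (h : IsTimeKernel 0 T D) (t₀ : ℝ) :
    IsTimeKernel t₀ (t₀ + T) (fun l τ => expi (τ - l) t₀ * D l τ) := by
  intro τ t ht
  have h1 := (h τ (t - t₀) ⟨by linarith [ht.1], by linarith [ht.2]⟩).mul_left (expi τ t₀)
  have e : expi τ t₀ * ∫ x in (0 : ℝ)..(t - t₀), expi τ x = ∫ x in t₀..t, expi τ x := by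
    rw [← intervalIntegral.integral_const_mul]
    simp_rw [← expi_add_right]
    rw [intervalIntegral.integral_comp_add_left (expi τ) t₀]
    simp
  rw [e] at h1
  refine h1.congr_fun fun l => ?_
  have : expi τ t₀ = expi (τ - l) t₀ * expi l t₀ := by rw [← expi_add, sub_add_cancel]
  rw [this]
  have : expi l t = expi l t₀ * expi l (t - t₀) := by rw [← expi_add_right]; congr 1; ring
  rw [this]; ring

lemma IsTimeKernel.mono {t₀ t₁ t₂ : ℝ} {D : ℤ → ℤ → ℂ} (h : IsTimeKernel t₀ t₂ D) (h' : t₁ ≤ t₂) :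
    IsTimeKernel t₀ t₁ D := fun τ t ht => h τ t ⟨ht.1, ht.2.trans h'⟩

/-- Interpolation `min(A, B) ≤ A^θ B^{1-θ}`: as `q > 1`, some `θ > 0` still has `(1 - θ) q > 1`, so
the sum over `τ` converges and a power of `A` is gained. -/
lemma exists_lnorm_kernelBound_le {q : ℝ} (hq : 1 < q) {ε : ℝ≥0∞} (hε : 0 < ε) :
    ∃ A₀ : ℝ, 0 < A₀ ∧ ∀ A : ℝ, 0 ≤ A → A ≤ A₀ → lnorm q (kernelBound A) ≤ ε := by
  have hq0 : 0 < q := by linarith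
  obtain ⟨θ, hθ, hθ1, hθq⟩ : ∃ θ : ℝ, 0 < θ ∧ 0 < 1 - θ ∧ 1 < (1 - θ) * q := by
    have : 1 / q < 1 := by rw [div_lt_one hq0]; exact hq
    have h0 : 0 < 1 / q := by positivity
    refine ⟨(1 - 1 / q) / 2, by linarith, by linarith, ?_⟩
    have : (1 - (1 - 1 / q) / 2) * q = (q + 1) / 2 := by field_simp; ring
    rw [this]; linarith
  set K := lnorm q (fun τ : ℤ => ENNReal.ofReal ((2 / max 1 |(τ : ℝ)|) ^ (1 - θ))) with hK
  have hKt : K ≠ ⊤ := by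
    refine ENNReal.rpow_ne_top_of_nonneg (by positivity) ?_
    have hs : Summable fun τ : ℤ => 2 ^ ((1 - θ) * q) * ((max 1 |(τ : ℝ)|) ^ (-((1 - θ) * q))) := by
      refine Summable.mul_left _ ?_
      refine (summable_congr_cofinite (g := fun τ : ℤ => |(τ : ℝ)| ^ (-((1 - θ) * q))) ?_).mpr
        (Real.summable_abs_int_rpow hθq)
      filter_upwards [(Set.finite_singleton (0 : ℤ)).compl_mem_cofinite] with τ hτ
      have : (1 : ℝ) ≤ |(τ : ℝ)| := by
        have : 1 ≤ |τ| := Int.one_le_abs hτ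
        exact_mod_cast this
      rw [max_eq_right this]
    have e : ∀ τ : ℤ, ENNReal.ofReal ((2 / max 1 |(τ : ℝ)|) ^ (1 - θ)) ^ q =
        ENNReal.ofReal (2 ^ ((1 - θ) * q) * ((max 1 |(τ : ℝ)|) ^ (-((1 - θ) * q)))) := by
      intro τ
      have hm : 0 < max 1 |(τ : ℝ)| := by positivity
      rw [ENNReal.ofReal_rpow_of_nonneg (by positivity) hq0.le, ← Real.rpow_mul (by positivity),
        Real.div_rpow (by norm_num) hm.le, Real.rpow_neg hm.le, div_eq_mul_inv]
    rw [tsum_congr e]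
    exact hs.tsum_ofReal_ne_top
  have hb : ∀ A : ℝ, 0 ≤ A → lnorm q (kernelBound A) ≤ ENNReal.ofReal (A ^ θ) * K := by
    intro A hA
    rw [hK, ← lnorm_const_mul hq0]
    refine lnorm_mono hq0 fun τ => ?_
    rw [← ENNReal.ofReal_mul (by positivity)]
    refine ENNReal.ofReal_le_ofReal ?_
    have hm : 0 < 2 / max 1 |(τ : ℝ)| := by positivity
    have h0 : 0 ≤ min A (2 / max 1 |(τ : ℝ)|) := le_min hA hm.le
    calc min A (2 / max 1 |(τ : ℝ)|) = min A (2 / max 1 |(τ : ℝ)|) ^ (θ + (1 - θ)) := by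
          rw [add_sub_cancel, Real.rpow_one]
      _ = min A (2 / max 1 |(τ : ℝ)|) ^ θ * min A (2 / max 1 |(τ : ℝ)|) ^ (1 - θ) :=
          Real.rpow_add_of_nonneg h0 hθ.le hθ1.le
      _ ≤ _ := by
          gcongr
          · exact min_le_left _ _
          · exact min_le_right _ _
  have ht : Filter.Tendsto (fun A : ℝ => ENNReal.ofReal (A ^ θ) * K) (nhds 0) (nhds 0) := by
    have h1 : Filter.Tendsto (fun A : ℝ => A ^ θ) (nhds 0) (nhds (0 ^ θ)) :=
      (Real.continuousAt_rpow_const 0 θ (Or.inr hθ.le))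
    rw [Real.zero_rpow hθ.ne'] at h1
    have h2 := ENNReal.Tendsto.mul_const (b := K) (ENNReal.tendsto_ofReal h1) (Or.inr hKt)
    simpa using h2
  obtain ⟨δ, hδ, hδ'⟩ := Metric.eventually_nhds_iff.mp (ht.eventually_lt_const hε)
  refine ⟨δ / 2, by positivity, fun A hA hA' => (hb A hA).trans (hδ' ?_).le⟩
  rw [Real.dist_eq, sub_zero, abs_of_nonneg hA]
  linarith

/-- Time kernels with small norm on short intervals. -/
lemma exists_isTimeKernel {q q' : ℝ} (hq : 1 < q) (hq' : 1 < q') {ε : ℝ≥0∞} (hε : 0 < ε) :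
    ∃ T₀ : ℝ, 0 < T₀ ∧ ∀ t₀ t₁ : ℝ, t₁ ≤ t₀ + T₀ → ∃ D, IsTimeKernel t₀ t₁ D ∧
      lnorm q (fun τ => ∑' l, ‖D l τ‖ₑ) ≤ ε ∧ lnorm q' (fun τ => ∑' l, ‖D l τ‖ₑ) ≤ ε := by
  obtain ⟨C, hC, h⟩ := exists_isTimeKernel_zero
  obtain ⟨A, hA, h₁⟩ := exists_lnorm_kernelBound_le hq hε
  obtain ⟨A', hA', h₂⟩ := exists_lnorm_kernelBound_le hq' hε
  set B := min 1 (min A A')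
  have hB : 0 < B := by positivity
  set T₀ := min 1 ((B / C) ^ 2)
  have hT₀ : 0 < T₀ := by positivity
  have hCT : C * Real.sqrt T₀ ≤ B := by
    have : Real.sqrt T₀ ≤ B / C := Real.sqrt_le_iff.mpr ⟨by positivity, min_le_right _ _⟩
    rwa [le_div_iff₀' hC] at this
  obtain ⟨D, hD, hDb⟩ := h T₀ hT₀.le (min_le_left _ _) (hCT.trans (min_le_left _ _))
  refine ⟨T₀, hT₀, fun t₀ t₁ ht => ⟨_, (hD.shift t₀).mono ht, ?_, ?_⟩⟩
  all_goals
    simp only [enorm_mul, enorm_expi, one_mul]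
  · exact (lnorm_mono (by linarith) hDb).trans (h₁ _ (by positivity)
      (hCT.trans ((min_le_right _ _).trans (min_le_left _ _))))
  · exact (lnorm_mono (by linarith) hDb).trans (h₂ _ (by positivity)
      (hCT.trans ((min_le_right _ _).trans (min_le_right _ _))))

/-! ### The Duhamel operator on arrays of time-space frequencies -/

/-- The `𝓕L^{s,p}` norm of a sequence of Fourier coefficients. -/
def cnorm (s p : ℝ) (f : ℤ × ℤ → ℂ) : ℝ≥0∞ := xnorm s p fun n => ‖f n‖ₑ

/-- The norm of `ℓ¹_τ 𝓕L^{s,p}`. -/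
def anorm (s p : ℝ) (x : ℤ → ℤ × ℤ → ℂ) : ℝ≥0∞ := znorm s p fun τ n => ‖x τ n‖ₑ

/-- The norm of time kernels used in the Duhamel estimates. -/
def kernelNorm (p r : ℝ) (D : ℤ → ℤ → ℂ) : ℝ≥0∞ :=
  max (lnorm p.conjExponent (fun τ => ∑' l, ‖D l τ‖ₑ))
    (lnorm r.conjExponent (fun τ => ∑' l, ‖D l τ‖ₑ))

/-- The trilinear Duhamel operator bounded on all of the arrays. -/
def absDuhamel (D : ℤ → ℤ → ℂ) (x y w : ℤ → ℤ × ℤ → ℂ) : ℤ → ℤ × ℤ → ℝ≥0∞ :=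
  duhamelAbs (fun l τ => ‖D l τ‖ₑ) (fun τ n => ‖x τ n‖ₑ) (fun τ n => ‖y τ n‖ₑ)
    (fun τ n => ‖w τ n‖ₑ)

/-- The collection of trilinear bounds on which the well-posedness theory rests. -/
structure TrilinearBounds (s p r : ℝ) (C : ℝ≥0∞) : Prop where
  one_lt : 1 < p
  nonneg : 0 ≤ s
  le : p ≤ r
  ne_top : C ≠ ⊤
  strong : ∀ D x y w, znorm s p (absDuhamel D x y w) ≤
    C * kernelNorm p r D * (anorm s p x * anorm s p y * anorm s p w)
  weak₁ : ∀ D w x y, znorm 0 r (absDuhamel D w x y) ≤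
    C * kernelNorm p r D * (anorm 0 r w * anorm s p x * anorm s p y)
  weak₂ : ∀ D w x y, znorm 0 r (absDuhamel D x w y) ≤
    C * kernelNorm p r D * (anorm 0 r w * anorm s p x * anorm s p y)
  weak₃ : ∀ D w x y, znorm 0 r (absDuhamel D x y w) ≤
    C * kernelNorm p r D * (anorm 0 r w * anorm s p x * anorm s p y)
  embed : ∀ f, lnorm (3 * r / (2 * r + 1)) f ≤ C * xnorm s p f
  young : ∀ f g h, lnorm r (tripleConv f g h) ≤ C * (xnorm s p f * xnorm s p g * xnorm s p h)

/-- The hypotheses on `s` and `p` are used here for the last time; all that follows rests on the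
structure `TrilinearBounds`. -/
lemma exists_trilinearBounds {p s : ℝ} (hp : 1 < p) (hs : 1 - 1 / p < s)
    (hs' : 4 / 3 - 2 / p < s) : ∃ r C, TrilinearBounds s p r C := by
  obtain ⟨C, hC, h₁, h₂⟩ := exists_znorm_duhamelAbs_le hp hs
  obtain ⟨r, hpr, C', hC', h₃⟩ := exists_lnorm_le_xnorm hp hs hs'
  have hp0 : 0 < p := by linarith
  have hs0 : 0 ≤ s := by
    have : 1 / p < 1 := by rw [div_lt_one hp0]; exact hp
    linarith
  have hqp : p.conjExponent.HolderConjugate p := (Real.HolderConjugate.conjExponent hp).symm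
  have hqr : r.conjExponent.HolderConjugate r :=
    (Real.HolderConjugate.conjExponent (hp.trans_le hpr)).symm
  have hCC : C ≤ C + C' + C' ^ 3 := (le_self_add).trans le_self_add
  refine ⟨r, C + C' + C' ^ 3, hp, hs0, hpr, by finiteness, fun D x y w => ?_, fun D w x y => ?_,
    fun D w x y => ?_, fun D w x y => ?_, fun f => ?_, fun f g h => ?_⟩
  · refine (h₁ _ hqp _ _ _ _).trans ?_
    exact mul_le_mul' (mul_le_mul' hCC (le_max_left _ _)) le_rfl
  · refine ((h₂ _ _ hpr hqr _ _ _ _).1).trans ?_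
    exact mul_le_mul' (mul_le_mul' hCC (le_max_right _ _)) le_rfl
  · refine ((h₂ _ _ hpr hqr _ _ _ _).2.1).trans ?_
    exact mul_le_mul' (mul_le_mul' hCC (le_max_right _ _)) le_rfl
  · refine ((h₂ _ _ hpr hqr _ _ _ _).2.2).trans ?_
    exact mul_le_mul' (mul_le_mul' hCC (le_max_right _ _)) le_rfl
  · refine (h₃ f).trans ?_
    gcongr
    exact le_add_self.trans le_self_add
  · refine (lnorm_tripleConv_le (hp.le.trans hpr) rfl f g h).trans ?_
    calc _ ≤ (C' * xnorm s p f) * (C' * xnorm s p g) * (C' * xnorm s p h) := by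
          gcongr <;> exact h₃ _
      _ = C' ^ 3 * (xnorm s p f * xnorm s p g * xnorm s p h) := by ring
      _ ≤ _ := by gcongr; exact le_add_self

/-- The coefficient with which the pair `(n₁, n₃)` enters the gauged nonlinearity. -/
def coef (n : ℤ × ℤ) (z : (ℤ × ℤ) × (ℤ × ℤ)) : ℂ :=
  if z.1 ≠ n ∧ z.2 ≠ n then Complex.I else if z.1 = n ∧ z.2 = n then -Complex.I else 0

lemma enorm_star' (z : ℂ) : ‖star z‖ₑ = ‖z‖ₑ := by
  rw [← ofReal_norm, norm_star, ofReal_norm]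

lemma enorm_coef_le (n : ℤ × ℤ) (z : (ℤ × ℤ) × (ℤ × ℤ)) :
    ‖coef n z‖ₑ ≤ if Interacts n z then 1 else 0 := by
  unfold coef Interacts
  split_ifs <;> simp_all [← ofReal_norm]

lemma enorm_coef_le_one (n : ℤ × ℤ) (z : (ℤ × ℤ) × (ℤ × ℤ)) : ‖coef n z‖ₑ ≤ 1 :=
  (enorm_coef_le n z).trans (by split_ifs <;> simp)

/-- Index set of the expanded trilinear form: time frequencies and space frequencies. -/
abbrev Idx : Type := (ℤ × ℤ × ℤ) × ((ℤ × ℤ) × (ℤ × ℤ))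

/-- The time frequency of an interaction. -/
def freq (n : ℤ × ℤ) (i : Idx) : ℤ := i.1.1 - i.1.2.1 + i.1.2.2 + 2 * halfPhase n i.2

/-- The amplitude of an interaction. -/
def ampl (x y w : ℤ → ℤ × ℤ → ℂ) (n : ℤ × ℤ) (i : Idx) : ℂ :=
  coef n i.2 * (x i.1.1 i.2.1 * star (y i.1.2.1 (mid n i.2)) * w i.1.2.2 i.2.2)

/-- The trilinear Duhamel operator with time kernel `D`. -/
def duhamel (D : ℤ → ℤ → ℂ) (x y w : ℤ → ℤ × ℤ → ℂ) (l : ℤ) (n : ℤ × ℤ) : ℂ :=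
  ∑' i, D l (freq n i) * ampl x y w n i

lemma tsum_enorm_duhamel_le (D : ℤ → ℤ → ℂ) (x y w : ℤ → ℤ × ℤ → ℂ) (l : ℤ) (n : ℤ × ℤ) :
    ∑' i, ‖D l (freq n i) * ampl x y w n i‖ₑ ≤ absDuhamel D x y w l n := by
  rw [ENNReal.tsum_prod', absDuhamel, duhamelAbs]
  simp only [duhamelAtom]
  refine ENNReal.tsum_le_tsum fun τ => ENNReal.tsum_le_tsum fun z => ?_
  simp only [ampl, enorm_mul, freq, enorm_star']
  have := enorm_coef_le n z
  split_ifs at this ⊢ with h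
  · exact mul_le_mul' le_rfl (mul_le_of_le_one_left zero_le this)
  · rw [le_antisymm this zero_le]; simp

lemma enorm_duhamel_le (D : ℤ → ℤ → ℂ) (x y w : ℤ → ℤ × ℤ → ℂ) (l : ℤ) (n : ℤ × ℤ) :
    ‖duhamel D x y w l n‖ₑ ≤ absDuhamel D x y w l n :=
  (enorm_tsum_le_tsum_enorm).trans (tsum_enorm_duhamel_le D x y w l n)

lemma tsum_enorm_ampl_le (x y w : ℤ → ℤ × ℤ → ℂ) (n : ℤ × ℤ) :
    ∑' i, ‖ampl x y w n i‖ₑ ≤ tripleConv (fun m => ∑' τ, ‖x τ m‖ₑ) (fun m => ∑' τ, ‖y τ m‖ₑ)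
      (fun m => ∑' τ, ‖w τ m‖ₑ) n := by
  rw [ENNReal.tsum_prod', ENNReal.tsum_comm, tripleConv]
  refine ENNReal.tsum_le_tsum fun z => ?_
  calc _ ≤ ∑' τ : ℤ × ℤ × ℤ, ‖x τ.1 z.1‖ₑ * (‖y τ.2.1 (mid n z)‖ₑ * ‖w τ.2.2 z.2‖ₑ) := by
        refine ENNReal.tsum_le_tsum fun τ => ?_
        simp only [ampl, enorm_mul, enorm_star']
        rw [mul_assoc ‖x τ.1 z.1‖ₑ]
        exact mul_le_of_le_one_left zero_le (enorm_coef_le_one n z)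
    _ = _ := by
        rw [tsum_mul_prod (fun τ => ‖x τ z.1‖ₑ)
          (fun τ : ℤ × ℤ => ‖y τ.1 (mid n z)‖ₑ * ‖w τ.2 z.2‖ₑ),
          tsum_mul_prod (fun τ => ‖y τ (mid n z)‖ₑ) (fun τ => ‖w τ z.2‖ₑ), mul_assoc]

namespace TrilinearBounds

variable {s p r : ℝ} {C : ℝ≥0∞}

lemma pos (H : TrilinearBounds s p r C) : 0 < p := one_pos.trans H.one_lt

lemma one_le_r (H : TrilinearBounds s p r C) : 1 ≤ r := H.one_lt.le.trans H.le

lemma r_pos (H : TrilinearBounds s p r C) : 0 < r := H.pos.trans_le H.le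

lemma xnorm_tsum_ne_top (H : TrilinearBounds s p r C) {x : ℤ → ℤ × ℤ → ℂ} (hx : anorm s p x ≠ ⊤) :
    xnorm s p (fun m => ∑' τ, ‖x τ m‖ₑ) ≠ ⊤ :=
  ne_top_of_le_ne_top hx (xnorm_tsum_le H.one_lt.le _)

lemma tsum_enorm_ne_top (H : TrilinearBounds s p r C) {x : ℤ → ℤ × ℤ → ℂ} (hx : anorm s p x ≠ ⊤)
    (n : ℤ × ℤ) : ∑' τ, ‖x τ n‖ₑ ≠ ⊤ :=
  ne_top_of_le_ne_top (H.xnorm_tsum_ne_top hx)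
    (le_xnorm H.nonneg H.pos (fun m => ∑' τ, ‖x τ m‖ₑ) n)

lemma tripleConv_ne_top (H : TrilinearBounds s p r C) {f g h : ℤ × ℤ → ℝ≥0∞}
    (hf : xnorm s p f ≠ ⊤) (hg : xnorm s p g ≠ ⊤) (hh : xnorm s p h ≠ ⊤) (n : ℤ × ℤ) :
    tripleConv f g h n ≠ ⊤ := by
  have hC := H.ne_top
  exact ne_top_of_le_ne_top (by finiteness) ((le_lnorm H.r_pos _ n).trans (H.young f g h))

lemma tsum_enorm_ampl_ne_top (H : TrilinearBounds s p r C) {x y w : ℤ → ℤ × ℤ → ℂ}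
    (hx : anorm s p x ≠ ⊤) (hy : anorm s p y ≠ ⊤) (hw : anorm s p w ≠ ⊤) (n : ℤ × ℤ) :
    ∑' i, ‖ampl x y w n i‖ₑ ≠ ⊤ :=
  ne_top_of_le_ne_top (H.tripleConv_ne_top (H.xnorm_tsum_ne_top hx) (H.xnorm_tsum_ne_top hy)
    (H.xnorm_tsum_ne_top hw) n) (tsum_enorm_ampl_le x y w n)

lemma tsum_absDuhamel_ne_top (H : TrilinearBounds s p r C) {D : ℤ → ℤ → ℂ}
    (hD : kernelNorm p r D ≠ ⊤) {x y w : ℤ → ℤ × ℤ → ℂ}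
    (hx : anorm s p x ≠ ⊤) (hy : anorm s p y ≠ ⊤) (hw : anorm s p w ≠ ⊤) (n : ℤ × ℤ) :
    ∑' l, absDuhamel D x y w l n ≠ ⊤ := by
  have hC := H.ne_top
  have h := H.strong D x y w
  refine ne_top_of_le_ne_top (b := znorm s p (absDuhamel D x y w))
    (ne_top_of_le_ne_top (by finiteness) h) (ENNReal.tsum_le_tsum fun l => ?_)
  exact le_xnorm H.nonneg H.pos _ n

lemma anorm_duhamel_le (H : TrilinearBounds s p r C) (D : ℤ → ℤ → ℂ) (x y w : ℤ → ℤ × ℤ → ℂ) :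
    anorm s p (duhamel D x y w) ≤
      C * kernelNorm p r D * (anorm s p x * anorm s p y * anorm s p w) :=
  (ENNReal.tsum_le_tsum fun l => xnorm_mono H.pos fun n => enorm_duhamel_le D x y w l n).trans
    (H.strong D x y w)

end TrilinearBounds

/-- The function of time represented by an array. -/
def synth (x : ℤ → ℤ × ℤ → ℂ) (t : ℝ) (n : ℤ × ℤ) : ℂ := ∑' τ, expi τ t * x τ n

/-- The gauged nonlinearity in interaction representation. -/
def nonlin (t : ℝ) (f g h : ℤ × ℤ → ℂ) (n : ℤ × ℤ) : ℂ :=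
  ∑' z, coef n z * expi (2 * halfPhase n z) t * (f z.1 * star (g (mid n z)) * h z.2)

lemma enorm_synth_le (x : ℤ → ℤ × ℤ → ℂ) (t : ℝ) (n : ℤ × ℤ) :
    ‖synth x t n‖ₑ ≤ ∑' τ, ‖x τ n‖ₑ := by
  refine enorm_tsum_le_tsum_enorm.trans (le_of_eq (tsum_congr fun τ => ?_))
  rw [enorm_mul, enorm_expi, one_mul]

lemma cnorm_synth_le {s p : ℝ} (hp : 1 ≤ p) (x : ℤ → ℤ × ℤ → ℂ) (t : ℝ) :
    cnorm s p (synth x t) ≤ anorm s p x :=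
  (xnorm_mono (one_pos.trans_le hp) fun n => enorm_synth_le x t n).trans (xnorm_tsum_le hp _)

lemma tsum_enorm_nonlin_le (t : ℝ) (f g h : ℤ × ℤ → ℂ) (n : ℤ × ℤ) :
    ∑' z, ‖coef n z * expi (2 * halfPhase n z) t * (f z.1 * star (g (mid n z)) * h z.2)‖ₑ ≤
      tripleConv (fun m => ‖f m‖ₑ) (fun m => ‖g m‖ₑ) (fun m => ‖h m‖ₑ) n := by
  refine ENNReal.tsum_le_tsum fun z => ?_
  simp only [enorm_mul, enorm_expi, enorm_star', mul_one]
  exact mul_le_of_le_one_left zero_le (enorm_coef_le_one n z)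

namespace TrilinearBounds

variable {s p r : ℝ} {C : ℝ≥0∞}

lemma cnorm_nonlin_le (H : TrilinearBounds s p r C) (t : ℝ) (f g h : ℤ × ℤ → ℂ) :
    cnorm 0 r (nonlin t f g h) ≤ C * (cnorm s p f * cnorm s p g * cnorm s p h) := by
  refine (xnorm_mono H.r_pos fun n => enorm_tsum_le_tsum_enorm.trans
    (tsum_enorm_nonlin_le t f g h n)).trans ?_
  rw [xnorm_zero_left]
  exact H.young _ _ _

lemma summable_nonlin (H : TrilinearBounds s p r C) (t : ℝ) {f g h : ℤ × ℤ → ℂ}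
    (hf : cnorm s p f ≠ ⊤) (hg : cnorm s p g ≠ ⊤) (hh : cnorm s p h ≠ ⊤) (n : ℤ × ℤ) :
    Summable fun z => coef n z * expi (2 * halfPhase n z) t *
      (f z.1 * star (g (mid n z)) * h z.2) :=
  Summable.of_enorm (ne_top_of_le_ne_top (H.tripleConv_ne_top hf hg hh n)
    (tsum_enorm_nonlin_le t f g h n))

lemma nonlin_sub (H : TrilinearBounds s p r C) (t : ℝ) {f g : ℤ × ℤ → ℂ}
    (hf : cnorm s p f ≠ ⊤) (hg : cnorm s p g ≠ ⊤) (n : ℤ × ℤ) :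
    nonlin t f f f n - nonlin t g g g n = nonlin t (f - g) f f n + nonlin t g (f - g) f n +
      nonlin t g g (f - g) n := by
  have hfg : cnorm s p (f - g) ≠ ⊤ := by
    refine ne_top_of_le_ne_top (ENNReal.add_ne_top.mpr ⟨hf, hg⟩)
      ((xnorm_mono H.pos fun n => ?_).trans (xnorm_add_le H.one_lt.le _ _))
    exact enorm_sub_le
  simp only [nonlin]
  rw [← (H.summable_nonlin t hf hf hf n).tsum_sub (H.summable_nonlin t hg hg hg n),
    ← (H.summable_nonlin t hfg hf hf n).tsum_add (H.summable_nonlin t hg hfg hf n),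
    ← ((H.summable_nonlin t hfg hf hf n).add (H.summable_nonlin t hg hfg hf n)).tsum_add
      (H.summable_nonlin t hg hg hfg n)]
  refine tsum_congr fun z => ?_
  simp only [Pi.sub_apply, star_sub]
  ring

lemma summable_synth (H : TrilinearBounds s p r C) {x : ℤ → ℤ × ℤ → ℂ} (hx : anorm s p x ≠ ⊤)
    (t : ℝ) (n : ℤ × ℤ) : Summable fun τ => expi τ t * x τ n := by
  refine Summable.of_enorm ?_
  simp only [enorm_mul, enorm_expi, one_mul]
  exact H.tsum_enorm_ne_top hx n

lemma summable_norm_synth (H : TrilinearBounds s p r C) {x : ℤ → ℤ × ℤ → ℂ} (hx : anorm s p x ≠ ⊤)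
    (t : ℝ) (n : ℤ × ℤ) : Summable fun τ => ‖expi τ t * x τ n‖ :=
  (H.summable_synth hx t n).norm

/-- Three absolutely convergent time series are multiplied out; the conjugated one enters with the
opposite frequency, and the resonance phase is added. -/
lemma nonlin_synth (H : TrilinearBounds s p r C) {x y w : ℤ → ℤ × ℤ → ℂ}
    (hx : anorm s p x ≠ ⊤) (hy : anorm s p y ≠ ⊤) (hw : anorm s p w ≠ ⊤) (t : ℝ) (n : ℤ × ℤ) :
    nonlin t (synth x t) (synth y t) (synth w t) n = ∑' i, expi (freq n i) t * ampl x y w n i := by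
  have hs : Summable fun i => expi (freq n i) t * ampl x y w n i := by
    refine Summable.of_enorm ?_
    simp only [enorm_mul, enorm_expi, one_mul]
    exact H.tsum_enorm_ampl_ne_top hx hy hw n
  have e : ∑' i, expi (freq n i) t * ampl x y w n i =
      ∑' z, ∑' τ, expi (freq n (τ, z)) t * ampl x y w n (τ, z) :=
    hs.tsum_prod.trans (Summable.tsum_comm
      (f := fun τ z => expi (freq n (τ, z)) t * ampl x y w n (τ, z)) hs).symm
  rw [e, nonlin]
  refine tsum_congr fun z => ?_
  have hsy : Summable fun τ => ‖star (expi τ t * y τ (mid n z))‖ := by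
    simpa only [norm_star] using H.summable_norm_synth hy t (mid n z)
  have h2 := tsum_mul_tsum_of_summable_norm hsy (H.summable_norm_synth hw t z.2)
  have h1 := tsum_mul_tsum_of_summable_norm (H.summable_norm_synth hx t z.1)
    (hsy.mul_norm (H.summable_norm_synth hw t z.2))
  have hst : star (synth y t (mid n z)) = ∑' τ, star (expi τ t * y τ (mid n z)) := by
    rw [synth, Complex.star_def, Complex.conj_tsum]
  rw [mul_assoc (synth x t z.1), hst]
  simp only [synth]
  rw [h2, h1, ← tsum_mul_left]
  refine tsum_congr fun τ => ?_
  simp only [ampl, freq, star_mul', star_expi, expi_add, sub_eq_add_neg]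
  ring

lemma continuous_nonlin_synth (H : TrilinearBounds s p r C) {x y w : ℤ → ℤ × ℤ → ℂ}
    (hx : anorm s p x ≠ ⊤) (hy : anorm s p y ≠ ⊤) (hw : anorm s p w ≠ ⊤) (n : ℤ × ℤ) :
    Continuous fun t => nonlin t (synth x t) (synth y t) (synth w t) n := by
  simp_rw [H.nonlin_synth hx hy hw]
  refine continuous_tsum (fun i => by fun_prop)
    (tsum_enorm_ne_top_iff_summable_norm.mp (H.tsum_enorm_ampl_ne_top hx hy hw n)) fun i t => ?_
  rw [norm_mul, norm_expi, one_mul]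

/-- The Duhamel operator on arrays represents the Duhamel integral. -/
lemma synth_duhamel (H : TrilinearBounds s p r C) {D : ℤ → ℤ → ℂ} (hDn : kernelNorm p r D ≠ ⊤)
    {t₀ t₁ : ℝ} (hD : IsTimeKernel t₀ t₁ D) {x y w : ℤ → ℤ × ℤ → ℂ}
    (hx : anorm s p x ≠ ⊤) (hy : anorm s p y ≠ ⊤) (hw : anorm s p w ≠ ⊤)
    {t : ℝ} (ht : t ∈ Set.Icc t₀ t₁) (n : ℤ × ℤ) :
    synth (duhamel D x y w) t n =
      ∫ t' in t₀..t, nonlin t' (synth x t') (synth y t') (synth w t') n := by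
  have hs : Summable fun j : ℤ × Idx => expi j.1 t * (D j.1 (freq n j.2) * ampl x y w n j.2) := by
    refine Summable.of_enorm (ne_top_of_le_ne_top (H.tsum_absDuhamel_ne_top hDn hx hy hw n) ?_)
    rw [ENNReal.tsum_prod']
    refine ENNReal.tsum_le_tsum fun l => ?_
    refine le_trans (le_of_eq (tsum_congr fun i => ?_)) (tsum_enorm_duhamel_le D x y w l n)
    rw [enorm_mul, enorm_expi, one_mul]
  have hA := tsum_enorm_ne_top_iff_summable_norm.mp (H.tsum_enorm_ampl_ne_top hx hy hw n)
  calc synth (duhamel D x y w) t n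
      = ∑' l, ∑' i, expi l t * (D l (freq n i) * ampl x y w n i) := by
        simp only [synth, duhamel, tsum_mul_left]
    _ = ∑' i, ∑' l, expi l t * (D l (freq n i) * ampl x y w n i) :=
        (Summable.tsum_comm (f := fun l i => expi l t * (D l (freq n i) * ampl x y w n i)) hs).symm
    -- For each interaction the sum over `l` is the kernel expansion of the primitive of its
    -- exponential, valid only on `[t₀, t₁]`.
    _ = ∑' i, ∫ t' in t₀..t, expi (freq n i) t' * ampl x y w n i := by
        refine tsum_congr fun i => ?_
        rw [intervalIntegral.integral_mul_const, ← (hD (freq n i) t ht).tsum_eq, ← tsum_mul_right]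
        exact tsum_congr fun l => by ring
    _ = ∫ t' in t₀..t, ∑' i, expi (freq n i) t' * ampl x y w n i := by
        refine (intervalIntegral.hasSum_intervalIntegral_of_summable_norm
          (f := fun i => (⟨fun t' => expi (freq n i) t' * ampl x y w n i, by fun_prop⟩ :
            C(ℝ, ℂ))) ?_).tsum_eq
        refine Summable.of_nonneg_of_le (fun i => norm_nonneg _) (fun i => ?_) hA
        rw [ContinuousMap.norm_le _ (norm_nonneg _)]
        intro t'
        simp [norm_expi]
    _ = _ := by simp_rw [H.nonlin_synth hx hy hw]

end TrilinearBounds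

/-! ### Solutions in the space of absolutely convergent time frequencies -/

lemma cnorm_add_le {s p : ℝ} (hp : 1 ≤ p) (f g : ℤ × ℤ → ℂ) :
    cnorm s p (f + g) ≤ cnorm s p f + cnorm s p g :=
  (xnorm_mono (one_pos.trans_le hp) fun _ => enorm_add_le _ _).trans (xnorm_add_le hp _ _)

lemma cnorm_neg (s p : ℝ) (f : ℤ × ℤ → ℂ) : cnorm s p (-f) = cnorm s p f := by
  simp [cnorm]

lemma cnorm_sub_le {s p : ℝ} (hp : 1 ≤ p) (f g : ℤ × ℤ → ℂ) :
    cnorm s p (f - g) ≤ cnorm s p f + cnorm s p g := by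
  rw [sub_eq_add_neg]
  exact (cnorm_add_le hp _ _).trans_eq (by rw [cnorm_neg])

lemma cnorm_sub_comm (s p : ℝ) (f g : ℤ × ℤ → ℂ) : cnorm s p (f - g) = cnorm s p (g - f) := by
  rw [← cnorm_neg, neg_sub]

lemma cnorm_zero {s p : ℝ} (hp : 0 < p) : cnorm s p 0 = 0 := by
  simp [cnorm, xnorm, lnorm_zero hp]

lemma anorm_add_le {s p : ℝ} (hp : 1 ≤ p) (x y : ℤ → ℤ × ℤ → ℂ) :
    anorm s p (x + y) ≤ anorm s p x + anorm s p y :=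
  (ENNReal.tsum_le_tsum fun τ => cnorm_add_le hp (x τ) (y τ)).trans_eq ENNReal.tsum_add

lemma anorm_neg (s p : ℝ) (x : ℤ → ℤ × ℤ → ℂ) : anorm s p (-x) = anorm s p x := by
  simp [anorm]

lemma anorm_sub_le {s p : ℝ} (hp : 1 ≤ p) (x y : ℤ → ℤ × ℤ → ℂ) :
    anorm s p (x - y) ≤ anorm s p x + anorm s p y := by
  rw [sub_eq_add_neg]
  exact (anorm_add_le hp _ _).trans_eq (by rw [anorm_neg])

lemma enorm_le_anorm {s p : ℝ} (hs : 0 ≤ s) (hp : 0 < p) (x : ℤ → ℤ × ℤ → ℂ) (τ : ℤ)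
    (n : ℤ × ℤ) : ‖x τ n‖ₑ ≤ anorm s p x :=
  (le_xnorm hs hp (fun n => ‖x τ n‖ₑ) n).trans (ENNReal.le_tsum τ)

/-- The array of a function which does not depend on time. -/
def constArr (f : ℤ × ℤ → ℂ) (τ : ℤ) (n : ℤ × ℤ) : ℂ := if τ = 0 then f n else 0

lemma anorm_constArr {s p : ℝ} (hp : 0 < p) (f : ℤ × ℤ → ℂ) :
    anorm s p (constArr f) = cnorm s p f := by
  rw [anorm, znorm, tsum_eq_single 0]
  · simp [constArr, cnorm]
  · intro τ hτ
    simp [constArr, hτ, xnorm, lnorm_zero hp]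

lemma synth_constArr (f : ℤ × ℤ → ℂ) (t : ℝ) (n : ℤ × ℤ) : synth (constArr f) t n = f n := by
  rw [synth, tsum_eq_single 0]
  · simp [constArr, expi_zero]
  · intro τ hτ
    simp [constArr, hτ]

/-- Explains the constant `24`: on the ball of radius `2R` the three difference terms have Lipschitz
constant `12 a R²`, at most `1/2` when `24 a R² ≤ 1`. -/
lemma three_mul_sq_eq (a R : ℝ≥0∞) : 3 * (a * (2 * R) ^ 2) = 2⁻¹ * (24 * (a * R ^ 2)) := by
  calc _ = 1 * (12 * (a * R ^ 2)) := by ring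
    _ = 2⁻¹ * 2 * (12 * (a * R ^ 2)) := by
        rw [ENNReal.inv_mul_cancel (by norm_num) (by norm_num)]
    _ = _ := by ring

/-- The trilinear operator applied to the same argument three times. -/
def cubic (D : ℤ → ℤ → ℂ) (x : ℤ → ℤ × ℤ → ℂ) : ℤ → ℤ × ℤ → ℂ := duhamel D x x x

/-- The three terms of the linearization of a difference of cubic terms. -/
def cubicDiff (D : ℤ → ℤ → ℂ) (x y v : ℤ → ℤ × ℤ → ℂ) : ℤ → ℤ × ℤ → ℂ :=
  duhamel D v x x + duhamel D y v x + duhamel D y y v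

/-- The array `x` represents a solution of the integral equation on `[t₀, t₁]`. -/
def IsGood (t₀ t₁ : ℝ) (x : ℤ → ℤ × ℤ → ℂ) : Prop :=
  ∀ t ∈ Set.Icc t₀ t₁, ∀ n, synth x t n = synth x t₀ n +
    ∫ t' in t₀..t, nonlin t' (synth x t') (synth x t') (synth x t') n

namespace TrilinearBounds

variable {s p r : ℝ} {C : ℝ≥0∞}

lemma summable_duhamel (H : TrilinearBounds s p r C) {D : ℤ → ℤ → ℂ}
    (hD : kernelNorm p r D ≠ ⊤) {x y w : ℤ → ℤ × ℤ → ℂ}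
    (hx : anorm s p x ≠ ⊤) (hy : anorm s p y ≠ ⊤) (hw : anorm s p w ≠ ⊤) (l : ℤ) (n : ℤ × ℤ) :
    Summable fun i => D l (freq n i) * ampl x y w n i :=
  Summable.of_enorm (ne_top_of_le_ne_top (ne_top_of_le_ne_top
    (H.tsum_absDuhamel_ne_top hD hx hy hw n) (ENNReal.le_tsum l)) (tsum_enorm_duhamel_le D x y w l n))

lemma cubic_sub (H : TrilinearBounds s p r C) {D : ℤ → ℤ → ℂ} (hD : kernelNorm p r D ≠ ⊤)
    {x y : ℤ → ℤ × ℤ → ℂ} (hx : anorm s p x ≠ ⊤) (hy : anorm s p y ≠ ⊤) :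
    cubic D x - cubic D y = cubicDiff D x y (x - y) := by
  have hxy : anorm s p (x - y) ≠ ⊤ := ne_top_of_le_ne_top (ENNReal.add_ne_top.mpr ⟨hx, hy⟩)
    (anorm_sub_le H.one_lt.le x y)
  funext l n
  simp only [Pi.sub_apply, Pi.add_apply, cubic, cubicDiff, duhamel]
  rw [← (H.summable_duhamel hD hx hx hx l n).tsum_sub (H.summable_duhamel hD hy hy hy l n),
    ← (H.summable_duhamel hD hxy hx hx l n).tsum_add (H.summable_duhamel hD hy hxy hx l n),
    ← ((H.summable_duhamel hD hxy hx hx l n).add (H.summable_duhamel hD hy hxy hx l n)).tsum_add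
      (H.summable_duhamel hD hy hy hxy l n)]
  refine tsum_congr fun i => ?_
  simp only [ampl, Pi.sub_apply, star_sub]
  ring

lemma anorm_cubicDiff_le (H : TrilinearBounds s p r C) (D : ℤ → ℤ → ℂ) {K : ℝ≥0∞}
    {x y : ℤ → ℤ × ℤ → ℂ} (hx : anorm s p x ≤ K) (hy : anorm s p y ≤ K) (v : ℤ → ℤ × ℤ → ℂ) :
    anorm s p (cubicDiff D x y v) ≤ 3 * (C * kernelNorm p r D * K ^ 2) * anorm s p v := by
  calc _ ≤ anorm s p (duhamel D v x x) + anorm s p (duhamel D y v x) +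
        anorm s p (duhamel D y y v) :=
        (anorm_add_le H.one_lt.le _ _).trans (add_le_add (anorm_add_le H.one_lt.le _ _) le_rfl)
    _ ≤ C * kernelNorm p r D * (anorm s p v * K * K) + C * kernelNorm p r D * (K * anorm s p v * K)
        + C * kernelNorm p r D * (K * K * anorm s p v) := by
        gcongr
        · refine (H.anorm_duhamel_le D _ _ _).trans ?_; gcongr
        · refine (H.anorm_duhamel_le D _ _ _).trans ?_; gcongr
        · refine (H.anorm_duhamel_le D _ _ _).trans ?_; gcongr
    _ = _ := by ring

lemma weak_cubicDiff_le (H : TrilinearBounds s p r C) (D : ℤ → ℤ → ℂ) {K : ℝ≥0∞}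
    {x y : ℤ → ℤ × ℤ → ℂ} (hx : anorm s p x ≤ K) (hy : anorm s p y ≤ K) (v : ℤ → ℤ × ℤ → ℂ) :
    anorm 0 r (cubicDiff D x y v) ≤ 3 * (C * kernelNorm p r D * K ^ 2) * anorm 0 r v := by
  have hm : ∀ a b c, anorm 0 r (duhamel D a b c) ≤ znorm 0 r (absDuhamel D a b c) := fun a b c =>
    ENNReal.tsum_le_tsum fun l => xnorm_mono H.r_pos fun n => enorm_duhamel_le D a b c l n
  calc _ ≤ anorm 0 r (duhamel D v x x) + anorm 0 r (duhamel D y v x) +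
        anorm 0 r (duhamel D y y v) :=
        (anorm_add_le H.one_le_r _ _).trans (add_le_add (anorm_add_le H.one_le_r _ _) le_rfl)
    _ ≤ C * kernelNorm p r D * (anorm 0 r v * K * K) + C * kernelNorm p r D * (anorm 0 r v * K * K)
        + C * kernelNorm p r D * (anorm 0 r v * K * K) := by
        gcongr
        · refine ((hm _ _ _).trans (H.weak₁ D _ _ _)).trans ?_; gcongr
        · refine ((hm _ _ _).trans (H.weak₂ D _ _ _)).trans ?_; gcongr
        · refine ((hm _ _ _).trans (H.weak₃ D _ _ _)).trans ?_; gcongr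
    _ = _ := by ring

lemma exists_kernel (H : TrilinearBounds s p r C) {ε : ℝ≥0∞} (hε : 0 < ε) :
    ∃ T₀ : ℝ, 0 < T₀ ∧ ∀ t₀ t₁ : ℝ, t₁ ≤ t₀ + T₀ → ∃ D, IsTimeKernel t₀ t₁ D ∧
      kernelNorm p r D ≤ ε := by
  obtain ⟨T₀, hT₀, h⟩ := exists_isTimeKernel (Real.HolderConjugate.conjExponent H.one_lt).symm.lt
    (Real.HolderConjugate.conjExponent (H.one_lt.trans_le H.le)).symm.lt hε
  refine ⟨T₀, hT₀, fun t₀ t₁ ht => ?_⟩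
  obtain ⟨D, hD, h1, h2⟩ := h t₀ t₁ ht
  exact ⟨D, hD, max_le h1 h2⟩

/-- The Picard iterates. -/
def picard (D : ℤ → ℤ → ℂ) (f : ℤ × ℤ → ℂ) : ℕ → ℤ → ℤ × ℤ → ℂ
  | 0 => constArr f
  | k + 1 => constArr f + cubic D (picard D f k)

/-- The fixed point of the Duhamel equation in the space of arrays. -/
lemma exists_fixedPoint (H : TrilinearBounds s p r C) {D : ℤ → ℤ → ℂ} {R : ℝ≥0∞} (hR : R ≠ ⊤)
    (hD : kernelNorm p r D ≠ ⊤) (hDR : 24 * (C * kernelNorm p r D * R ^ 2) ≤ 1)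
    {f : ℤ × ℤ → ℂ} (hf : cnorm s p f ≤ R) :
    ∃ x, anorm s p x ≤ 2 * R ∧ x = constArr f + cubic D x := by
  have hp := H.one_lt.le
  have hp0 := H.pos
  have hR2 : 2 * R ≠ ⊤ := by finiteness
  set X := picard D f with hX
  have hbound : ∀ k, anorm s p (X k) ≤ 2 * R := by
    intro k
    induction k with
    | zero =>
      calc _ = cnorm s p f := anorm_constArr hp0 f
        _ ≤ 1 * R := by rwa [one_mul]
        _ ≤ _ := by gcongr; norm_num
    | succ k ih =>
      calc _ ≤ anorm s p (constArr f) + anorm s p (cubic D (X k)) := anorm_add_le hp _ _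
        _ ≤ R + C * kernelNorm p r D * (2 * R * (2 * R) * (2 * R)) := by
            gcongr
            · rwa [anorm_constArr hp0]
            · refine (H.anorm_duhamel_le D _ _ _).trans ?_; gcongr
        _ = R + 8 * (C * kernelNorm p r D * R ^ 2) * R := by ring
        _ ≤ R + 24 * (C * kernelNorm p r D * R ^ 2) * R := by gcongr; norm_num
        _ ≤ R + 1 * R := by gcongr
        _ = 2 * R := by ring
  have hfin : ∀ k, anorm s p (X k) ≠ ⊤ := fun k => ne_top_of_le_ne_top hR2 (hbound k)
  have hlip : ∀ x y, anorm s p x ≤ 2 * R → anorm s p y ≤ 2 * R →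
      anorm s p (cubic D x - cubic D y) ≤ 2⁻¹ * anorm s p (x - y) := by
    intro x y hx hy
    rw [H.cubic_sub hD (ne_top_of_le_ne_top hR2 hx) (ne_top_of_le_ne_top hR2 hy)]
    refine (H.anorm_cubicDiff_le D hx hy _).trans ?_
    gcongr
    calc 3 * (C * kernelNorm p r D * (2 * R) ^ 2) = 2⁻¹ * (24 * (C * kernelNorm p r D * R ^ 2)) := by
          exact three_mul_sq_eq _ _
      _ ≤ 2⁻¹ * 1 := by gcongr
      _ = 2⁻¹ := mul_one _
  set d : ℕ → ℤ → ℤ × ℤ → ℂ := fun k => X (k + 1) - X k with hd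
  have hdb : ∀ k, anorm s p (d k) ≤ 2⁻¹ ^ k * (4 * R) := by
    intro k
    induction k with
    | zero =>
      rw [pow_zero, one_mul]
      calc _ ≤ 2 * R + 2 * R := (anorm_sub_le hp _ _).trans (add_le_add (hbound _) (hbound _))
        _ = 4 * R := by ring
    | succ k ih =>
      have e : d (k + 1) = cubic D (X (k + 1)) - cubic D (X k) := by
        simp only [hd, hX, picard]; abel
      rw [e]
      refine (hlip _ _ (hbound _) (hbound _)).trans ?_
      rw [pow_succ', mul_assoc]
      gcongr
  have hsum : ∑' k, anorm s p (d k) ≠ ⊤ := by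
    refine ne_top_of_le_ne_top ?_ (ENNReal.tsum_le_tsum hdb)
    rw [ENNReal.tsum_mul_right, ENNReal.tsum_geometric]
    exact ENNReal.mul_ne_top (by simp) (by finiteness)
  have hsm : ∀ τ n, Summable fun k => d k τ n := fun τ n =>
    Summable.of_enorm (ne_top_of_le_ne_top hsum
      (ENNReal.tsum_le_tsum fun k => enorm_le_anorm H.nonneg hp0 (d k) τ n))
  -- The limit is built entry by entry from the telescoping series of increments, which converge
  -- geometrically in norm.
  set x : ℤ → ℤ × ℤ → ℂ := fun τ n => X 0 τ n + ∑' k, d k τ n with hx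
  have hxk : ∀ k, anorm s p (x - X k) ≤ ∑' j, anorm s p (d (j + k)) := by
    intro k
    have e : ∀ τ n, (x - X k) τ n = ∑' j, d (j + k) τ n := by
      intro τ n
      have h1 := (hsm τ n).sum_add_tsum_nat_add k
      have h2 : ∑ i ∈ Finset.range k, d i τ n = X k τ n - X 0 τ n :=
        Finset.sum_range_sub (fun i => X i τ n) k
      simp only [Pi.sub_apply, hx]
      rw [← h1, h2]; ring
    calc _ ≤ ∑' τ, ∑' j, cnorm s p (d (j + k) τ) := by
          refine ENNReal.tsum_le_tsum fun τ => ?_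
          refine (xnorm_mono hp0 fun n => ?_).trans (xnorm_tsum_le hp fun j n => ‖d (j + k) τ n‖ₑ)
          simp only [e]
          exact enorm_tsum_le_tsum_enorm
      _ = _ := ENNReal.tsum_comm
  have htend : Filter.Tendsto (fun k => ∑' j, anorm s p (d (j + k))) Filter.atTop (nhds 0) :=
    ENNReal.tendsto_sum_nat_add _ hsum
  have hxb : anorm s p x ≤ 2 * R := by
    have ht : Filter.Tendsto (fun k => ∑' j, anorm s p (d (j + k)) + 2 * R) Filter.atTop
        (nhds (2 * R)) := by simpa using htend.add_const (2 * R)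
    refine ge_of_tendsto' ht fun k => ?_
    calc anorm s p x = anorm s p ((x - X k) + X k) := by rw [sub_add_cancel]
      _ ≤ _ := (anorm_add_le hp _ _).trans (add_le_add (hxk k) (hbound k))
  refine ⟨x, hxb, ?_⟩
  have hz : anorm s p (x - (constArr f + cubic D x)) ≤ 0 := by
    have ht2 : Filter.Tendsto (fun k => ∑' j, anorm s p (d (j + (k + 1))) +
        2⁻¹ * ∑' j, anorm s p (d (j + k))) Filter.atTop (nhds 0) := by
      simpa using (htend.comp (Filter.tendsto_add_atTop_nat 1)).add
        (ENNReal.Tendsto.const_mul htend (Or.inr (by simp)))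
    refine ge_of_tendsto' ht2 fun k => ?_
    have e : x - (constArr f + cubic D x) = (x - X (k + 1)) + (cubic D (X k) - cubic D x) := by
      have : X (k + 1) = constArr f + cubic D (X k) := rfl
      rw [this]; abel
    rw [e]
    refine (anorm_add_le hp _ _).trans (add_le_add (hxk _) ((hlip _ _ (hbound k) hxb).trans ?_))
    rw [← neg_sub, anorm_neg]
    gcongr
    exact hxk k
  funext τ n
  have h0 := le_antisymm ((enorm_le_anorm H.nonneg hp0 _ τ n).trans hz) zero_le
  rw [enorm_eq_zero] at h0
  exact sub_eq_zero.mp h0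

lemma synth_add (H : TrilinearBounds s p r C) {x y : ℤ → ℤ × ℤ → ℂ} (hx : anorm s p x ≠ ⊤)
    (hy : anorm s p y ≠ ⊤) (t : ℝ) (n : ℤ × ℤ) :
    synth (x + y) t n = synth x t n + synth y t n := by
  simp only [synth]
  rw [← (H.summable_synth hx t n).tsum_add (H.summable_synth hy t n)]
  simp only [Pi.add_apply, mul_add]

lemma synth_sub (H : TrilinearBounds s p r C) {x y : ℤ → ℤ × ℤ → ℂ} (hx : anorm s p x ≠ ⊤)
    (hy : anorm s p y ≠ ⊤) (t : ℝ) (n : ℤ × ℤ) :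
    synth (x - y) t n = synth x t n - synth y t n := by
  simp only [synth]
  rw [← (H.summable_synth hx t n).tsum_sub (H.summable_synth hy t n)]
  simp only [Pi.sub_apply, mul_sub]

lemma anorm_duhamel_ne_top (H : TrilinearBounds s p r C) {D : ℤ → ℤ → ℂ}
    (hD : kernelNorm p r D ≠ ⊤) {x y w : ℤ → ℤ × ℤ → ℂ}
    (hx : anorm s p x ≠ ⊤) (hy : anorm s p y ≠ ⊤) (hw : anorm s p w ≠ ⊤) :
    anorm s p (duhamel D x y w) ≠ ⊤ := by
  have hC := H.ne_top
  exact ne_top_of_le_ne_top (by finiteness) (H.anorm_duhamel_le D x y w)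

/-- Solutions exist as arrays on intervals with a small time kernel. -/
lemma exists_good (H : TrilinearBounds s p r C) {D : ℤ → ℤ → ℂ} {R : ℝ≥0∞} (hR : R ≠ ⊤)
    (hD : kernelNorm p r D ≠ ⊤) (hDR : 24 * (C * kernelNorm p r D * R ^ 2) ≤ 1)
    {t₀ t₁ : ℝ} (ht : t₀ ≤ t₁) (hDk : IsTimeKernel t₀ t₁ D) {f : ℤ × ℤ → ℂ} (hf : cnorm s p f ≤ R) :
    ∃ x, anorm s p x ≤ 2 * R ∧ synth x t₀ = f ∧ IsGood t₀ t₁ x := by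
  obtain ⟨x, hx, hfix⟩ := H.exists_fixedPoint hR hD hDR hf
  have hxt : anorm s p x ≠ ⊤ := ne_top_of_le_ne_top (by finiteness) hx
  have hft : anorm s p (constArr f) ≠ ⊤ := by
    rw [anorm_constArr H.pos]; exact ne_top_of_le_ne_top hR hf
  have key : ∀ t ∈ Set.Icc t₀ t₁, ∀ n, synth x t n = f n +
      ∫ t' in t₀..t, nonlin t' (synth x t') (synth x t') (synth x t') n := by
    intro t ht' n
    rw [← H.synth_duhamel hD hDk hxt hxt hxt ht' n, ← synth_constArr f t n,
      ← H.synth_add hft (H.anorm_duhamel_ne_top hD hxt hxt hxt)]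
    exact congrArg (fun y => synth y t n) hfix
  have h0 : synth x t₀ = f := by
    funext n
    simpa using key t₀ ⟨le_rfl, ht⟩ n
  refine ⟨x, hx, h0, ?_⟩
  intro t ht' n
  rw [key t ht' n, h0]

lemma IsGood_restrict (H : TrilinearBounds s p r C) {x : ℤ → ℤ × ℤ → ℂ} (hx : anorm s p x ≠ ⊤)
    {t₀ t₁ t₂ : ℝ} (h : IsGood t₀ t₂ x) (h1 : t₀ ≤ t₁) : IsGood t₁ t₂ x := by
  intro t ht n
  have hc := H.continuous_nonlin_synth hx hx hx n
  rw [h t ⟨h1.trans ht.1, ht.2⟩ n, h t₁ ⟨h1, ht.1.trans ht.2⟩ n, add_assoc,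
    intervalIntegral.integral_add_adjacent_intervals (hc.intervalIntegrable _ _)
      (hc.intervalIntegrable _ _)]

/-- The increment is itself a Duhamel term, so a small kernel makes it small in the strong norm. -/
lemma cnorm_synth_sub_le (H : TrilinearBounds s p r C) {D : ℤ → ℤ → ℂ}
    (hD : kernelNorm p r D ≠ ⊤) {t₀ t₁ : ℝ} (hDk : IsTimeKernel t₀ t₁ D)
    {x : ℤ → ℤ × ℤ → ℂ} (hx : anorm s p x ≠ ⊤) (hg : IsGood t₀ t₁ x) {t : ℝ}
    (ht : t ∈ Set.Icc t₀ t₁) :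
    cnorm s p (synth x t - synth x t₀) ≤ C * kernelNorm p r D * anorm s p x ^ 3 := by
  have e : synth x t - synth x t₀ = synth (duhamel D x x x) t := by
    funext n
    rw [Pi.sub_apply, hg t ht n, H.synth_duhamel hD hDk hx hx hx ht n, add_sub_cancel_left]
  rw [e]
  refine (cnorm_synth_le H.one_lt.le _ _).trans ((H.anorm_duhamel_le D x x x).trans_eq ?_)
  ring

/-- Two array solutions depend on the data in a Lipschitz way in the weak norm. -/
lemma weak_lipschitz (H : TrilinearBounds s p r C) {D : ℤ → ℤ → ℂ} {R : ℝ≥0∞} (hR : R ≠ ⊤)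
    (hD : kernelNorm p r D ≠ ⊤) (hDR : 24 * (C * kernelNorm p r D * R ^ 2) ≤ 1)
    {t₀ t₁ : ℝ} (hDk : IsTimeKernel t₀ t₁ D) {x y : ℤ → ℤ × ℤ → ℂ}
    (hx : anorm s p x ≤ 2 * R) (hy : anorm s p y ≤ 2 * R) (hgx : IsGood t₀ t₁ x)
    (hgy : IsGood t₀ t₁ y) {t : ℝ} (ht : t ∈ Set.Icc t₀ t₁) :
    cnorm 0 r (synth x t - synth y t) ≤ 2 * cnorm 0 r (synth x t₀ - synth y t₀) := by
  have hp := H.one_lt.le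
  have hR2 : 2 * R ≠ ⊤ := by finiteness
  have hxt := ne_top_of_le_ne_top hR2 hx
  have hyt := ne_top_of_le_ne_top hR2 hy
  set δ := cnorm 0 r (synth x t₀ - synth y t₀) with hδ
  have hst : ∀ t, cnorm s p (synth x t - synth y t) ≠ ⊤ := fun t =>
    ne_top_of_le_ne_top (ENNReal.add_ne_top.mpr ⟨hxt, hyt⟩)
      ((cnorm_sub_le hp _ _).trans (add_le_add (cnorm_synth_le hp _ _) (cnorm_synth_le hp _ _)))
  set A := cnorm s p (synth x t₀ - synth y t₀) + anorm s p (x - y) with hA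
  have hweak : ∀ z : ℤ → ℤ × ℤ → ℂ, anorm 0 r z ≤ anorm s p z := fun z =>
    ENNReal.tsum_le_tsum fun τ => xnorm_zero_left_le H.nonneg H.pos H.le _
  have hxy : anorm s p (x - y) ≠ ⊤ :=
    ne_top_of_le_ne_top (ENNReal.add_ne_top.mpr ⟨hxt, hyt⟩) (anorm_sub_le hp x y)
  -- The weak array norm of `x - y` is not controlled by the data, because `x` and `y` are only
  -- known through their values on `[t₀, t₁]`. The difference is therefore represented by new
  -- arrays: each pass through the integral equation keeps the represented function and halves the
  -- part of the bound not due to the data.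
  have key : ∀ k : ℕ, ∃ v, anorm s p v ≠ ⊤ ∧
      (∀ t ∈ Set.Icc t₀ t₁, ∀ n, synth v t n = synth x t n - synth y t n) ∧
      anorm 0 r v ≤ 2 * δ + 2⁻¹ ^ k * anorm s p (x - y) := by
    intro k
    induction k with
    | zero =>
      refine ⟨x - y, hxy, fun t _ n => H.synth_sub hxt hyt t n, ?_⟩
      rw [pow_zero, one_mul]
      exact (hweak _).trans le_add_self
    | succ k ih =>
      obtain ⟨v, hv, hrep, hvb⟩ := ih
      have hc : anorm s p (constArr (synth x t₀ - synth y t₀)) ≠ ⊤ := by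
        rw [anorm_constArr H.pos]; exact hst t₀
      have h1 := H.anorm_duhamel_ne_top hD hv hxt hxt
      have h2 := H.anorm_duhamel_ne_top hD hyt hv hxt
      have h3 := H.anorm_duhamel_ne_top hD hyt hyt hv
      have h12 : anorm s p (duhamel D v x x + duhamel D y v x) ≠ ⊤ :=
        ne_top_of_le_ne_top (ENNReal.add_ne_top.mpr ⟨h1, h2⟩) (anorm_add_le hp _ _)
      have h123 : anorm s p (cubicDiff D x y v) ≠ ⊤ :=
        ne_top_of_le_ne_top (ENNReal.add_ne_top.mpr ⟨h12, h3⟩) (anorm_add_le hp _ _)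
      refine ⟨constArr (synth x t₀ - synth y t₀) + cubicDiff D x y v,
        ne_top_of_le_ne_top (ENNReal.add_ne_top.mpr ⟨hc, h123⟩) (anorm_add_le hp _ _), ?_, ?_⟩
      · intro t ht n
        have hcv := H.continuous_nonlin_synth hv hxt hxt n
        have hcv2 := H.continuous_nonlin_synth hyt hv hxt n
        have hcv12 : Continuous fun t => nonlin t (synth v t) (synth x t) (synth x t) n +
            nonlin t (synth y t) (synth v t) (synth x t) n := hcv.add hcv2
        have hcv3 := H.continuous_nonlin_synth hyt hyt hv n
        have hcx := H.continuous_nonlin_synth hxt hxt hxt n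
        have hcy := H.continuous_nonlin_synth hyt hyt hyt n
        rw [H.synth_add hc h123, synth_constArr, cubicDiff, H.synth_add h12 h3, H.synth_add h1 h2,
          H.synth_duhamel hD hDk hv hxt hxt ht, H.synth_duhamel hD hDk hyt hv hxt ht,
          H.synth_duhamel hD hDk hyt hyt hv ht,
          ← intervalIntegral.integral_add (hcv.intervalIntegrable _ _)
            (hcv2.intervalIntegrable _ _),
          ← intervalIntegral.integral_add (hcv12.intervalIntegrable _ _)
            (hcv3.intervalIntegrable _ _), hgx t ht n, hgy t ht n, Pi.sub_apply,
          add_sub_add_comm, ← intervalIntegral.integral_sub (hcx.intervalIntegrable _ _)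
            (hcy.intervalIntegrable _ _)]
        congr 1
        refine intervalIntegral.integral_congr fun t' ht' => ?_
        rw [Set.uIcc_of_le ht.1] at ht'
        have hvt : synth v t' = synth x t' - synth y t' :=
          funext fun m => hrep t' ⟨ht'.1, ht'.2.trans ht.2⟩ m
        rw [H.nonlin_sub t' (ne_top_of_le_ne_top hxt (cnorm_synth_le hp x t'))
          (ne_top_of_le_ne_top hyt (cnorm_synth_le hp y t')) n, hvt]
      · calc _ ≤ anorm 0 r (constArr (synth x t₀ - synth y t₀)) + anorm 0 r (cubicDiff D x y v) :=
              anorm_add_le H.one_le_r _ _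
          _ ≤ δ + 3 * (C * kernelNorm p r D * (2 * R) ^ 2) * anorm 0 r v :=
              add_le_add (anorm_constArr H.r_pos _).le (H.weak_cubicDiff_le D hx hy v)
          _ ≤ δ + 2⁻¹ * (2 * δ + 2⁻¹ ^ k * anorm s p (x - y)) := by
              gcongr
              calc 3 * (C * kernelNorm p r D * (2 * R) ^ 2) =
                    2⁻¹ * (24 * (C * kernelNorm p r D * R ^ 2)) := by
                    exact three_mul_sq_eq _ _
                _ ≤ 2⁻¹ * 1 := by gcongr
                _ = 2⁻¹ := mul_one _
          _ = 2 * δ + 2⁻¹ ^ (k + 1) * anorm s p (x - y) := by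
              rw [mul_add, ← mul_assoc, ENNReal.inv_mul_cancel (by norm_num) (by norm_num), one_mul,
                ← mul_assoc, ← pow_succ', ← add_assoc, two_mul]
  have hlim : Filter.Tendsto (fun k : ℕ => 2 * δ + 2⁻¹ ^ k * anorm s p (x - y)) Filter.atTop
      (nhds (2 * δ)) := by
    have h := ENNReal.tendsto_pow_atTop_nhds_zero_of_lt_one (r := (2⁻¹ : ℝ≥0∞)) (by simp)
    have h2 := (ENNReal.Tendsto.mul_const h (Or.inr hxy)).const_add (2 * δ)
    simpa using h2
  refine ge_of_tendsto' hlim fun k => ?_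
  obtain ⟨v, hv, hrep, hvb⟩ := key k
  have e : synth x t - synth y t = synth v t := funext fun n => (hrep t ht n).symm
  rw [e]
  exact (cnorm_synth_le H.one_le_r v t).trans hvb

end TrilinearBounds

/-! ### Continuous solutions and their uniqueness -/

/-- Heine–Cantor for the pseudo-distance `d`, which may take the value `⊤`. -/
lemma exists_modulus {X : Type*} (d : X → X → ℝ≥0∞) (hd : ∀ x, d x x = 0)
    (hs : ∀ x y, d x y = d y x) (ht : ∀ x y z, d x z ≤ d x y + d y z) {f : ℝ → X} {a b : ℝ}
    (h : ∀ t ∈ Set.Icc a b, Filter.Tendsto (fun t' => d (f t') (f t))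
      (nhdsWithin t (Set.Icc a b)) (nhds 0))
    {ε : ℝ≥0∞} (hε : 0 < ε) : ∃ δ : ℝ, 0 < δ ∧ ∀ t ∈ Set.Icc a b,
    ∀ t' ∈ Set.Icc a b, |t - t'| < δ → d (f t) (f t') ≤ ε := by
  let _ : PseudoEMetricSpace X := { edist := d, edist_self := hd, edist_comm := hs, edist_triangle := ht }
  have hc : ContinuousOn f (Set.Icc a b) := fun t htt => tendsto_iff_edist_tendsto_0.mpr (h t htt)
  have hu := isCompact_Icc.uniformContinuousOn_of_continuous hc
  rw [EMetric.uniformContinuousOn_iff] at hu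
  obtain ⟨δ, hδ, hu⟩ := hu ε hε
  obtain ⟨δ', hδ', hδ''⟩ := ENNReal.lt_iff_exists_nnreal_btwn.mp hδ
  refine ⟨δ', by exact_mod_cast hδ', fun t htt t' htt' hlt => (hu htt htt' ?_).le⟩
  refine lt_trans ?_ hδ''
  rw [edist_dist, Real.dist_eq]
  exact (ENNReal.ofReal_lt_ofReal_iff (by exact_mod_cast hδ')).mpr hlt |>.trans_eq (by simp)

lemma exists_bound {X : Type*} (d : X → X → ℝ≥0∞) (hd : ∀ x, d x x = 0)
    (hs : ∀ x y, d x y = d y x) (ht : ∀ x y z, d x z ≤ d x y + d y z) {f : ℝ → X} {a b : ℝ}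
    (h : ∀ t ∈ Set.Icc a b, Filter.Tendsto (fun t' => d (f t') (f t))
      (nhdsWithin t (Set.Icc a b)) (nhds 0))
    (x₀ : X) (hfin : ∀ t ∈ Set.Icc a b, d (f t) x₀ ≠ ⊤) :
    ∃ R : ℝ≥0∞, R ≠ ⊤ ∧ ∀ t ∈ Set.Icc a b, d (f t) x₀ ≤ R := by
  let _ : PseudoEMetricSpace X := { edist := d, edist_self := hd, edist_comm := hs, edist_triangle := ht }
  have hc : ContinuousOn f (Set.Icc a b) := fun t htt => tendsto_iff_edist_tendsto_0.mpr (h t htt)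
  have hc2 : ContinuousOn (fun t => d (f t) x₀) (Set.Icc a b) :=
    (continuous_id.edist continuous_const).comp_continuousOn hc
  rcases (Set.Icc a b).eq_empty_or_nonempty with he | hne
  · exact ⟨0, by simp, fun t htt => by simp [he] at htt⟩
  · obtain ⟨t, htt, hmax⟩ := isCompact_Icc.exists_isMaxOn hne hc2
    exact ⟨_, hfin t htt, fun t' ht' => hmax ht'⟩

/-- Continuity on `[t₀, t₁]` with values in the space of Fourier coefficients of `𝓕L^{s,p}`. -/
def ContX (s p t₀ t₁ : ℝ) (b : ℝ → ℤ × ℤ → ℂ) : Prop :=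
  (∀ t ∈ Set.Icc t₀ t₁, cnorm s p (b t) ≠ ⊤) ∧
  ∀ t ∈ Set.Icc t₀ t₁, Filter.Tendsto (fun t' => cnorm s p (b t' - b t))
    (nhdsWithin t (Set.Icc t₀ t₁)) (nhds 0)

/-- Continuous solutions of the gauged integral equation. -/
structure IsRough (s p t₀ t₁ : ℝ) (b : ℝ → ℤ × ℤ → ℂ) : Prop where
  cont : ContX s p t₀ t₁ b
  eq : ∀ t ∈ Set.Icc t₀ t₁, ∀ n, b t n = b t₀ n + ∫ t' in t₀..t, nonlin t' (b t') (b t') (b t') n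

lemma ContX.restrict {s p t₀ t₁ t₂ t₃ : ℝ} {b : ℝ → ℤ × ℤ → ℂ} (h : ContX s p t₀ t₃ b)
    (h1 : t₀ ≤ t₁) (h2 : t₂ ≤ t₃) : ContX s p t₁ t₂ b :=
  ⟨fun t ht => h.1 t ⟨h1.trans ht.1, ht.2.trans h2⟩, fun t ht =>
    (h.2 t ⟨h1.trans ht.1, ht.2.trans h2⟩).mono_left (nhdsWithin_mono _ (Set.Icc_subset_Icc h1 h2))⟩

lemma ContX.exists_modulus {s p t₀ t₁ : ℝ} (hp : 1 ≤ p) {b : ℝ → ℤ × ℤ → ℂ}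
    (h : ContX s p t₀ t₁ b) {ε : ℝ≥0∞} (hε : 0 < ε) : ∃ δ : ℝ, 0 < δ ∧ ∀ t ∈ Set.Icc t₀ t₁,
    ∀ t' ∈ Set.Icc t₀ t₁, |t - t'| < δ → cnorm s p (b t - b t') ≤ ε :=
  HNLS.exists_modulus (fun f g => cnorm s p (f - g))
    (fun f => by rw [sub_self, cnorm_zero (one_pos.trans_le hp)]) (cnorm_sub_comm s p)
    (fun f g k => by rw [← sub_add_sub_cancel f g k]; exact cnorm_add_le hp _ _) h.2 hε

lemma ContX.exists_bound {s p t₀ t₁ : ℝ} (hp : 1 ≤ p) {b : ℝ → ℤ × ℤ → ℂ}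
    (h : ContX s p t₀ t₁ b) : ∃ R : ℝ≥0∞, R ≠ ⊤ ∧ ∀ t ∈ Set.Icc t₀ t₁, cnorm s p (b t) ≤ R := by
  have := HNLS.exists_bound (fun f g => cnorm s p (f - g))
    (fun f => by rw [sub_self, cnorm_zero (one_pos.trans_le hp)]) (cnorm_sub_comm s p)
    (fun f g k => by rw [← sub_add_sub_cancel f g k]; exact cnorm_add_le hp _ _) h.2 0
    (by simpa using h.1)
  simpa using this

lemma exists_pos_mul_le {A ε : ℝ≥0∞} (hA : A ≠ ⊤) (hε : 0 < ε) :
    ∃ κ : ℝ≥0∞, 0 < κ ∧ κ ≠ ⊤ ∧ A * κ ≤ ε := by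
  have hA1 : A + 1 ≠ ⊤ := by finiteness
  refine ⟨min 1 (ε / (A + 1)), lt_min one_pos (ENNReal.div_pos hε.ne' hA1),
    ne_top_of_le_ne_top (by simp) (min_le_left _ _), ?_⟩
  calc _ ≤ (A + 1) * (ε / (A + 1)) := mul_le_mul' le_self_add (min_le_right _ _)
    _ ≤ ε := ENNReal.mul_div_le

/-- Minkowski's inequality for time integrals. -/
lemma cnorm_integral_le {r : ℝ} (hr : 1 ≤ r) {F : ℝ → ℤ × ℤ → ℂ} {a b : ℝ} (hab : a ≤ b)
    (hF : ∀ n, ContinuousOn (fun t => F t n) (Set.Icc a b)) {S : ℝ≥0∞}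
    (hS : ∀ t ∈ Set.Icc a b, cnorm 0 r (F t) ≤ S) :
    cnorm 0 r (fun n => ∫ t in a..b, F t n) ≤ ENNReal.ofReal (b - a) * S := by
  have hr0 : 0 < r := by linarith
  have hm : ∀ n, AEMeasurable (fun t => ‖F t n‖ₑ) (volume.restrict (Set.Ioc a b)) := fun n =>
    (((hF n).mono Set.Ioc_subset_Icc_self).aestronglyMeasurable measurableSet_Ioc).enorm
  -- Jensen's inequality on an interval of length `b - a`; the sum over `n` can then be moved under
  -- the time integral.
  have hjensen : ∀ n, (∫⁻ t in Set.Ioc a b, ‖F t n‖ₑ) ^ r ≤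
      ENNReal.ofReal (b - a) ^ (r - 1) * ∫⁻ t in Set.Ioc a b, ‖F t n‖ₑ ^ r := by
    intro n
    have h := eLpNorm'_le_eLpNorm'_mul_rpow_measure_univ (μ := volume.restrict (Set.Ioc a b))
      one_pos hr (((hF n).mono Set.Ioc_subset_Icc_self).aestronglyMeasurable measurableSet_Ioc)
    simp only [eLpNorm', ENNReal.rpow_one, div_one, Measure.restrict_apply_univ,
      Real.volume_Ioc] at h
    refine (ENNReal.rpow_le_rpow h hr0.le).trans_eq ?_
    rw [ENNReal.mul_rpow_of_nonneg _ _ hr0.le, ← ENNReal.rpow_mul, ← ENNReal.rpow_mul,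
      one_div_mul_cancel hr0.ne', ENNReal.rpow_one, mul_comm]
    congr 2
    field_simp
  rw [cnorm, xnorm_zero_left, lnorm_le_iff hr0]
  calc _ ≤ ∑' n, ENNReal.ofReal (b - a) ^ (r - 1) * ∫⁻ t in Set.Ioc a b, ‖F t n‖ₑ ^ r := by
        refine ENNReal.tsum_le_tsum fun n => le_trans ?_ (hjensen n)
        gcongr
        rw [intervalIntegral.integral_of_le hab]
        exact enorm_integral_le_lintegral_enorm _
    _ = ENNReal.ofReal (b - a) ^ (r - 1) * ∫⁻ t in Set.Ioc a b, ∑' n, ‖F t n‖ₑ ^ r := by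
        rw [ENNReal.tsum_mul_left, lintegral_tsum fun n => (hm n).pow_const r]
    _ ≤ ENNReal.ofReal (b - a) ^ (r - 1) * ∫⁻ t in Set.Ioc a b, S ^ r := by
        gcongr 1
        refine setLIntegral_mono' measurableSet_Ioc fun t ht => ?_
        have := hS t (Set.Ioc_subset_Icc_self ht)
        rwa [cnorm, xnorm_zero_left, lnorm_le_iff hr0] at this
    _ = (ENNReal.ofReal (b - a) * S) ^ r := by
        rw [setLIntegral_const, Real.volume_Ioc, mul_left_comm, ENNReal.mul_rpow_of_nonneg _ _ hr0.le,
          mul_comm (S ^ r)]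
        congr 1
        nth_rw 2 [← ENNReal.rpow_one (ENNReal.ofReal (b - a))]
        rw [← ENNReal.rpow_add_of_nonneg _ _ (by linarith) (by norm_num), sub_add_cancel]

namespace TrilinearBounds

variable {s p r : ℝ} {C : ℝ≥0∞}

/-- Only Young's inequality is used, with no gain from oscillation; the price is that the output is
measured in the weak norm. -/
lemma cnorm_nonlin_sub_le (H : TrilinearBounds s p r C) (t : ℝ) {K : ℝ≥0∞} (hK : K ≠ ⊤)
    {f g : ℤ × ℤ → ℂ} (hf : cnorm s p f ≤ K) (hg : cnorm s p g ≤ K) :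
    cnorm 0 r (nonlin t f f f - nonlin t g g g) ≤ 3 * (C * K ^ 2) * cnorm s p (f - g) := by
  have e : nonlin t f f f - nonlin t g g g = nonlin t (f - g) f f + nonlin t g (f - g) f +
      nonlin t g g (f - g) :=
    funext fun n => H.nonlin_sub t (ne_top_of_le_ne_top hK hf) (ne_top_of_le_ne_top hK hg) n
  rw [e]
  calc _ ≤ cnorm 0 r (nonlin t (f - g) f f) + cnorm 0 r (nonlin t g (f - g) f) +
        cnorm 0 r (nonlin t g g (f - g)) :=
        (cnorm_add_le H.one_le_r _ _).trans (add_le_add (cnorm_add_le H.one_le_r _ _) le_rfl)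
    _ ≤ C * (cnorm s p (f - g) * K * K) + C * (K * cnorm s p (f - g) * K)
        + C * (K * K * cnorm s p (f - g)) := by
        gcongr
        · refine (H.cnorm_nonlin_le t _ _ _).trans ?_; gcongr
        · refine (H.cnorm_nonlin_le t _ _ _).trans ?_; gcongr
        · refine (H.cnorm_nonlin_le t _ _ _).trans ?_; gcongr
    _ = _ := by ring

lemma continuous_nonlin_const (H : TrilinearBounds s p r C) {f : ℤ × ℤ → ℂ}
    (hf : cnorm s p f ≠ ⊤) (n : ℤ × ℤ) : Continuous fun t => nonlin t f f f n := by
  unfold nonlin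
  refine continuous_tsum (fun z => by fun_prop) (H.summable_nonlin 0 hf hf hf n).norm
    fun z t => le_of_eq ?_
  simp only [norm_mul, norm_expi]

lemma continuousOn_nonlin (H : TrilinearBounds s p r C) {t₀ t₁ : ℝ} {b : ℝ → ℤ × ℤ → ℂ}
    (hb : ContX s p t₀ t₁ b) (n : ℤ × ℤ) :
    ContinuousOn (fun t => nonlin t (b t) (b t) (b t) n) (Set.Icc t₀ t₁) := by
  obtain ⟨R, hR, hbR⟩ := hb.exists_bound H.one_lt.le
  intro t ht
  have hC := H.ne_top
  -- Freezing the state at time `t` separates the change of `b`, controlled uniformly in the phases,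
  -- from the change of the phases alone.
  have h1 : Filter.Tendsto (fun t' => nonlin t' (b t') (b t') (b t') n -
      nonlin t' (b t) (b t) (b t) n) (nhdsWithin t (Set.Icc t₀ t₁)) (nhds 0) := by
    rw [tendsto_zero_iff_enorm_tendsto_zero]
    have hlim := ENNReal.Tendsto.const_mul (a := 3 * (C * R ^ 2)) (hb.2 t ht)
      (Or.inr (by finiteness))
    rw [mul_zero] at hlim
    refine tendsto_of_tendsto_of_tendsto_of_le_of_le' tendsto_const_nhds hlim
      (Filter.Eventually.of_forall fun _ => zero_le) ?_
    filter_upwards [self_mem_nhdsWithin] with t' ht'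
    refine le_trans ?_ (H.cnorm_nonlin_sub_le t' hR (hbR t' ht') (hbR t ht))
    exact le_xnorm le_rfl H.r_pos (fun n => ‖(nonlin t' (b t') (b t') (b t') -
      nonlin t' (b t) (b t) (b t)) n‖ₑ) n
  have h2 := ((H.continuous_nonlin_const (hb.1 t ht) n).tendsto t).mono_left
    (nhdsWithin_le_nhds (s := Set.Icc t₀ t₁))
  have h3 := h1.add h2
  simpa [ContinuousWithinAt] using h3

lemma intervalIntegrable_nonlin (H : TrilinearBounds s p r C) {t₀ t₁ : ℝ} {b : ℝ → ℤ × ℤ → ℂ}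
    (hb : ContX s p t₀ t₁ b) (n : ℤ × ℤ) {a c : ℝ} (ha : a ∈ Set.Icc t₀ t₁)
    (hc : c ∈ Set.Icc t₀ t₁) :
    IntervalIntegrable (fun t => nonlin t (b t) (b t) (b t) n) volume a c :=
  ((H.continuousOn_nonlin hb n).mono (Set.uIcc_subset_Icc ha hc)).intervalIntegrable

lemma restrict_isRough (H : TrilinearBounds s p r C) {t₀ t₁ t₂ t₃ : ℝ} {b : ℝ → ℤ × ℤ → ℂ}
    (h : IsRough s p t₀ t₃ b) (h1 : t₀ ≤ t₁) (h2 : t₂ ≤ t₃) : IsRough s p t₁ t₂ b := by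
  refine ⟨h.cont.restrict h1 h2, fun t ht n => ?_⟩
  have m1 : t₁ ∈ Set.Icc t₀ t₃ := ⟨h1, ht.1.trans (ht.2.trans h2)⟩
  have m2 : t ∈ Set.Icc t₀ t₃ := ⟨h1.trans ht.1, ht.2.trans h2⟩
  have m0 : t₀ ∈ Set.Icc t₀ t₃ := ⟨le_rfl, m1.1.trans m1.2⟩
  rw [h.eq t m2 n, h.eq t₁ m1 n, add_assoc, intervalIntegral.integral_add_adjacent_intervals
    (H.intervalIntegrable_nonlin h.cont n m0 m1) (H.intervalIntegrable_nonlin h.cont n m1 m2)]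

lemma contX_synth (H : TrilinearBounds s p r C) {t₀ t₁ : ℝ} {x : ℤ → ℤ × ℤ → ℂ}
    (hx : anorm s p x ≠ ⊤) (hg : IsGood t₀ t₁ x) : ContX s p t₀ t₁ (synth x) := by
  have hp := H.one_lt.le
  have hC := H.ne_top
  refine ⟨fun t _ => ne_top_of_le_ne_top hx (cnorm_synth_le hp x t), fun t ht => ?_⟩
  rw [ENNReal.tendsto_nhds_zero]
  intro ε hε
  obtain ⟨κ, hκ, hκε⟩ : ∃ κ : ℝ≥0∞, 0 < κ ∧ κ ≠ ⊤ ∧ C * κ * anorm s p x ^ 3 ≤ ε := by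
    obtain ⟨κ, h1, h2, h3⟩ := exists_pos_mul_le (A := C * anorm s p x ^ 3) (by finiteness) hε
    exact ⟨κ, h1, h2, by rwa [mul_right_comm]⟩
  obtain ⟨T₀, hT₀, hker⟩ := H.exists_kernel hκ
  have hstep : ∀ a c, a ∈ Set.Icc t₀ t₁ → c ∈ Set.Icc t₀ t₁ → a ≤ c → c ≤ a + T₀ →
      cnorm s p (synth x c - synth x a) ≤ ε := by
    intro a c ha hc hac hcT
    obtain ⟨D, hD, hDκ⟩ := hker a c hcT
    refine (H.cnorm_synth_sub_le (ne_top_of_le_ne_top hκε.1 hDκ) hD hx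
      (t₁ := c) (fun t ht => H.IsGood_restrict hx hg ha.1 t ⟨ht.1, ht.2.trans hc.2⟩)
      ⟨hac, le_rfl⟩).trans (le_trans ?_ hκε.2)
    gcongr
  have hnear : ∀ᶠ t' in nhdsWithin t (Set.Icc t₀ t₁), |t' - t| < T₀ :=
    nhdsWithin_le_nhds (Metric.ball_mem_nhds t hT₀)
  filter_upwards [self_mem_nhdsWithin, hnear] with t' ht' hlt
  rw [abs_lt] at hlt
  rcases le_total t t' with h | h
  · exact hstep t t' ht ht' h (by linarith)
  · rw [cnorm_sub_comm]
    exact hstep t' t ht' ht h (by linarith)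

lemma isRough_synth (H : TrilinearBounds s p r C) {t₀ t₁ : ℝ} {x : ℤ → ℤ × ℤ → ℂ}
    (hx : anorm s p x ≠ ⊤) (hg : IsGood t₀ t₁ x) : IsRough s p t₀ t₁ (synth x) :=
  ⟨H.contX_synth hx hg, hg⟩

/-- Comparison at time `t₁` of two array solutions that start on a rough solution at times `a`
and `c`. -/
lemma weak_step (H : TrilinearBounds s p r C) {R κ κ' η : ℝ≥0∞} (hR : R ≠ ⊤) (hκ : κ ≠ ⊤)
    (hκ' : κ' ≠ ⊤) (hκR : 24 * (C * κ * R ^ 2) ≤ 1) {a c t₁ : ℝ} (hac : a ≤ c) (hct : c ≤ t₁)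
    {b : ℝ → ℤ × ℤ → ℂ} (hb : IsRough s p a c b) (hbR : ∀ t ∈ Set.Icc a c, cnorm s p (b t) ≤ R)
    (hη : ∀ t ∈ Set.Icc a c, cnorm s p (b t - b a) ≤ η)
    {D D' : ℤ → ℤ → ℂ} (hD : IsTimeKernel c t₁ D) (hDκ : kernelNorm p r D ≤ κ)
    (hD' : IsTimeKernel a c D') (hDκ' : kernelNorm p r D' ≤ κ')
    {x y : ℤ → ℤ × ℤ → ℂ} (hx : anorm s p x ≤ 2 * R) (hy : anorm s p y ≤ 2 * R)
    (hgx : IsGood a t₁ x) (hgy : IsGood c t₁ y) (hxa : synth x a = b a) (hyc : synth y c = b c) :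
    cnorm 0 r (synth x t₁ - synth y t₁) ≤ ENNReal.ofReal (c - a) *
      (2 * (3 * (C * (2 * R) ^ 2) * (C * κ' * (2 * R) ^ 3 + η))) := by
  have hp := H.one_lt.le
  have hR2 : 2 * R ≠ ⊤ := by finiteness
  have hxt := ne_top_of_le_ne_top hR2 hx
  have hRR : R ≤ 2 * R := by
    calc R = 1 * R := (one_mul R).symm
      _ ≤ 2 * R := by gcongr; norm_num
  -- Lipschitz dependence on `[c, t₁]` reduces the comparison to time `c`.
  have hlip := H.weak_lipschitz hR (ne_top_of_le_ne_top hκ hDκ)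
    (le_trans (by gcongr) hκR) hD hx hy (H.IsGood_restrict hxt hgx hac) hgy ⟨hct, le_rfl⟩
  refine hlip.trans ?_
  rw [mul_left_comm]
  gcongr 2 * ?_
  have hgac : IsGood a c x := fun t ht => hgx t ⟨ht.1, ht.2.trans hct⟩
  -- At time `c` the array `y` takes the value of `b`, while `x` and `b` agree at `a`; the
  -- difference is the integral over `[a, c]` of the difference of the nonlinearities.
  have e : synth x c - synth y c = fun n => ∫ t in a..c,
      (nonlin t (synth x t) (synth x t) (synth x t) - nonlin t (b t) (b t) (b t)) n := by
    funext n
    simp only [Pi.sub_apply]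
    rw [intervalIntegral.integral_sub
      ((H.continuous_nonlin_synth hxt hxt hxt n).intervalIntegrable _ _)
      (H.intervalIntegrable_nonlin hb.cont n ⟨le_rfl, hac⟩ ⟨hac, le_rfl⟩), hyc,
      hgac c ⟨hac, le_rfl⟩ n, hb.eq c ⟨hac, le_rfl⟩ n, hxa]
    ring
  rw [e]
  refine cnorm_integral_le H.one_le_r hac (fun n => ?_) fun t ht => ?_
  · exact (H.continuous_nonlin_synth hxt hxt hxt n).continuousOn.sub
      (H.continuousOn_nonlin hb.cont n)
  · refine (H.cnorm_nonlin_sub_le t hR2 ((cnorm_synth_le hp x t).trans hx)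
      ((hbR t ht).trans hRR)).trans ?_
    gcongr
    -- Both curves stay close to their common value `b a`, so the integrand is small on top of the
    -- factor `c - a`.
    have e2 : synth x t - b t = (synth x t - synth x a) + (b a - b t) := by rw [hxa]; abel
    rw [e2]
    refine (cnorm_add_le hp _ _).trans (add_le_add ?_ ?_)
    · refine (H.cnorm_synth_sub_le (ne_top_of_le_ne_top hκ' hDκ') hD' hxt hgac ht).trans ?_
      gcongr
    · rw [cnorm_sub_comm]; exact hη t ht

/-- On short intervals, rough solutions agree at the end point with the array solution. -/
lemma rough_eq_good (H : TrilinearBounds s p r C) {R κ : ℝ≥0∞} (hR : R ≠ ⊤) (hκ : κ ≠ ⊤)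
    (hκR : 24 * (C * κ * R ^ 2) ≤ 1) {T₀ t₀ t₁ : ℝ}
    (hker : ∀ a c : ℝ, c ≤ a + T₀ → ∃ D, IsTimeKernel a c D ∧ kernelNorm p r D ≤ κ)
    (ht : t₀ ≤ t₁) (htT : t₁ ≤ t₀ + T₀) {b : ℝ → ℤ × ℤ → ℂ} (hb : IsRough s p t₀ t₁ b)
    (hbR : ∀ t ∈ Set.Icc t₀ t₁, cnorm s p (b t) ≤ R) {x : ℤ → ℤ × ℤ → ℂ}
    (hx : anorm s p x ≤ 2 * R) (hgx : IsGood t₀ t₁ x) (hx0 : synth x t₀ = b t₀) :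
    synth x t₁ = b t₁ := by
  have hp := H.one_lt.le
  have hC := H.ne_top
  have hgood : ∀ a, a ∈ Set.Icc t₀ t₁ → ∃ y, anorm s p y ≤ 2 * R ∧ synth y a = b a ∧
      IsGood a t₁ y := by
    intro a ha
    obtain ⟨D, hD, hDκ⟩ := hker a t₁ (by linarith [ha.1])
    exact H.exists_good hR (ne_top_of_le_ne_top hκ hDκ) (le_trans (by gcongr) hκR) ha.2 hD (hbR a ha)
  suffices hz : cnorm 0 r (synth x t₁ - b t₁) ≤ 0 by
    funext n
    have h0 := le_antisymm ((le_xnorm le_rfl H.r_pos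
      (fun n => ‖(synth x t₁ - b t₁) n‖ₑ) n).trans hz) zero_le
    rw [enorm_eq_zero] at h0
    exact sub_eq_zero.mp h0
  refine le_of_forall_pos_le_add fun ε hε => ?_
  rw [zero_add]
  set A := 2 * (3 * (C * (2 * R) ^ 2)) with hA
  -- `η` is fixed from the whole length `t₁ - t₀` before the number of steps; the grid is then made
  -- fine enough that `b` and the array solutions vary by at most `η` over one step.
  obtain ⟨η, hη, hηt, hηε⟩ := exists_pos_mul_le (A := ENNReal.ofReal (t₁ - t₀) * A * 2)
    (by finiteness) hε
  obtain ⟨κ', hκ', hκt', hκη⟩ := exists_pos_mul_le (A := C * (2 * R) ^ 3) (by finiteness) hη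
  obtain ⟨T₁, hT₁, hker'⟩ := H.exists_kernel hκ'
  obtain ⟨δ, hδ, hmod⟩ := hb.cont.exists_modulus hp hη
  obtain ⟨N, hN⟩ := exists_nat_gt ((t₁ - t₀) / min T₁ δ)
  have hmin : 0 < min T₁ δ := lt_min hT₁ hδ
  have hN0 : (0 : ℝ) < N := lt_of_le_of_lt (div_nonneg (by linarith) hmin.le) hN
  set h := (t₁ - t₀) / N with hh
  have hh0 : 0 ≤ h := div_nonneg (by linarith) hN0.le
  have hhm : h < min T₁ δ := by
    rw [hh, div_lt_iff₀ hN0]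
    rwa [div_lt_iff₀ hmin, mul_comm] at hN
  have hNh : N * h = t₁ - t₀ := by rw [hh]; field_simp
  set E := ENNReal.ofReal h * (A * (2 * η)) with hE
  -- The array solution is restarted from `b` at the `j`th grid point; the values at `t₁` of
  -- consecutive restarts differ by at most `E`. At `j = N` the restart point is `t₁` itself, where
  -- the array equals `b`.
  have key : ∀ j : ℕ, j ≤ N → ∃ y, anorm s p y ≤ 2 * R ∧ synth y (t₀ + j * h) = b (t₀ + j * h) ∧
      IsGood (t₀ + j * h) t₁ y ∧ cnorm 0 r (synth x t₁ - synth y t₁) ≤ j * E := by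
    intro j
    induction j with
    | zero =>
      intro _
      refine ⟨x, hx, by simpa using hx0, by simpa using hgx, ?_⟩
      rw [sub_self, cnorm_zero H.r_pos]
      exact zero_le
    | succ j ih =>
      intro hj
      obtain ⟨y, hy, hya, hyg, hyb⟩ := ih (by omega)
      have hjN : ((j : ℝ) + 1) ≤ N := by exact_mod_cast hj
      set a := t₀ + j * h with ha
      have hc : t₀ + ((j + 1 : ℕ) : ℝ) * h = a + h := by rw [ha]; push_cast; ring
      rw [hc]
      have ha0 : t₀ ≤ a := by rw [ha]; nlinarith [show (0 : ℝ) ≤ j by positivity]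
      have hct : a + h ≤ t₁ := by
        have := mul_le_mul_of_nonneg_right hjN hh0
        rw [ha]; linarith
      obtain ⟨w, hw, hwc, hwg⟩ := hgood (a + h) ⟨by linarith, hct⟩
      obtain ⟨D, hD, hDκ⟩ := hker (a + h) t₁ (by linarith)
      obtain ⟨D', hD', hDκ'⟩ := hker' a (a + h) (by linarith [min_le_left T₁ δ])
      refine ⟨w, hw, hwc, hwg, ?_⟩
      have hstep := H.weak_step hR hκ hκt' hκR (η := η) (a := a) (c := a + h) (by linarith) hct
        (H.restrict_isRough hb ha0 hct) (fun t ht => hbR t ⟨ha0.trans ht.1, ht.2.trans hct⟩)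
        (fun t ht => hmod t ⟨ha0.trans ht.1, ht.2.trans hct⟩ a ⟨ha0, by linarith⟩ (by
          rw [abs_of_nonneg (by linarith [ht.1])]
          linarith [ht.2, min_le_right T₁ δ]))
        hD hDκ hD' hDκ' hy hw hyg hwg hya hwc
      have e : synth x t₁ - synth w t₁ = (synth x t₁ - synth y t₁) + (synth y t₁ - synth w t₁) := by
        abel
      rw [e]
      refine (cnorm_add_le H.one_le_r _ _).trans ?_
      push_cast
      rw [add_mul, one_mul]
      refine add_le_add hyb (hstep.trans ?_)
      rw [hE, add_sub_cancel_left, hA]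
      calc _ ≤ ENNReal.ofReal h * (2 * (3 * (C * (2 * R) ^ 2) * (η + η))) := by
            gcongr
            calc C * κ' * (2 * R) ^ 3 = C * (2 * R) ^ 3 * κ' := by ring
              _ ≤ η := hκη
        _ = _ := by ring
  obtain ⟨y, hy, hya, hyg, hyb⟩ := key N le_rfl
  rw [hNh, add_sub_cancel] at hya
  rw [← hya]
  refine hyb.trans (le_trans (le_of_eq ?_) hηε)
  rw [hE, ← hNh, ENNReal.ofReal_mul hN0.le, ENNReal.ofReal_natCast]
  ring

lemma exists_small_kernels (H : TrilinearBounds s p r C) {R : ℝ≥0∞} (hR : R ≠ ⊤) :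
    ∃ κ : ℝ≥0∞, κ ≠ ⊤ ∧ 24 * (C * κ * R ^ 2) ≤ 1 ∧ ∃ T₀ : ℝ, 0 < T₀ ∧
      ∀ a c : ℝ, c ≤ a + T₀ → ∃ D, IsTimeKernel a c D ∧ kernelNorm p r D ≤ κ := by
  have hC := H.ne_top
  obtain ⟨κ, h0, ht, hle⟩ := exists_pos_mul_le (A := 24 * (C * R ^ 2)) (by finiteness) one_pos
  exact ⟨κ, ht, le_trans (le_of_eq (by ring)) hle, H.exists_kernel h0⟩

/-- Rough solutions on `[0, T]` are determined by their initial data. -/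
lemma rough_unique (H : TrilinearBounds s p r C) {T : ℝ} {b b' : ℝ → ℤ × ℤ → ℂ}
    (hb : IsRough s p 0 T b) (hb' : IsRough s p 0 T b') (h0 : b 0 = b' 0) :
    ∀ t ∈ Set.Icc 0 T, b t = b' t := by
  have hp := H.one_lt.le
  obtain ⟨R₁, hR₁, hbR⟩ := hb.cont.exists_bound hp
  obtain ⟨R₂, hR₂, hbR'⟩ := hb'.cont.exists_bound hp
  have hR : max R₁ R₂ ≠ ⊤ := by simp [hR₁, hR₂]
  obtain ⟨κ, hκ, hκR, T₀, hT₀, hker⟩ := H.exists_small_kernels hR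
  -- `T₀` depends only on a common bound for both solutions, so the local result can be iterated; on
  -- each piece both are compared with the same array solution.
  have key : ∀ k : ℕ, ∀ t ∈ Set.Icc 0 T, t ≤ k * T₀ → b t = b' t := by
    intro k
    induction k with
    | zero =>
      intro t ht htk
      have : t = 0 := le_antisymm (by simpa using htk) ht.1
      rw [this, h0]
    | succ k ih =>
      intro t ht htk
      by_cases hk : t ≤ k * T₀
      · exact ih t ht hk
      · push Not at hk
        push_cast at htk
        have ha : (0 : ℝ) ≤ k * T₀ := by positivity
        have heq := ih (k * T₀) ⟨ha, hk.le.trans ht.2⟩ le_rfl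
        have hlen : t ≤ k * T₀ + T₀ := by linarith
        obtain ⟨D, hD, hDκ⟩ := hker (k * T₀) t hlen
        have hm : ∀ u ∈ Set.Icc (k * T₀) t, u ∈ Set.Icc 0 T := fun u hu =>
          ⟨ha.trans hu.1, hu.2.trans ht.2⟩
        obtain ⟨x, hx, hx0, hxg⟩ := H.exists_good hR (ne_top_of_le_ne_top hκ hDκ)
          (le_trans (by gcongr) hκR) hk.le hD
          ((hbR _ (hm _ ⟨le_rfl, hk.le⟩)).trans (le_max_left R₁ R₂))
        rw [← H.rough_eq_good hR hκ hκR hker hk.le hlen (H.restrict_isRough hb ha ht.2)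
          (fun u hu => (hbR u (hm u hu)).trans (le_max_left _ _)) hx hxg hx0,
          ← H.rough_eq_good hR hκ hκR hker hk.le hlen (H.restrict_isRough hb' ha ht.2)
          (fun u hu => (hbR' u (hm u hu)).trans (le_max_right _ _)) hx hxg (hx0.trans heq)]
  intro t ht
  obtain ⟨k, hk⟩ := exists_nat_ge (t / T₀)
  exact key k t ht (by rwa [div_le_iff₀ hT₀] at hk)

/-- Local existence of rough solutions. -/
lemma exists_rough (H : TrilinearBounds s p r C) {f : ℤ × ℤ → ℂ} (hf : cnorm s p f ≠ ⊤) :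
    ∃ T : ℝ, 0 < T ∧ ∃ b, IsRough s p 0 T b ∧ b 0 = f := by
  obtain ⟨κ, hκ, hκR, T₀, hT₀, hker⟩ := H.exists_small_kernels hf
  obtain ⟨D, hD, hDκ⟩ := hker 0 T₀ (by linarith)
  obtain ⟨x, hx, hx0, hxg⟩ := H.exists_good hf (ne_top_of_le_ne_top hκ hDκ)
    (le_trans (by gcongr) hκR) hT₀.le hD le_rfl
  exact ⟨T₀, hT₀, synth x, H.isRough_synth (ne_top_of_le_ne_top (by finiteness) hx) hxg, hx0⟩

end TrilinearBounds

/-! ### Fourier analysis on the torus -/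

instance : IsProbabilityMeasure torusMeasure := by
  unfold torusMeasure; infer_instance

lemma character_add (m n : ℤ × ℤ) (x : Torus) :
    character (m + n) x = character m x * character n x := by
  simp only [character, Prod.fst_add, Prod.snd_add, fourier_add]; ring

lemma character_neg (n : ℤ × ℤ) (x : Torus) : character (-n) x = star (character n x) := by
  simp only [character, Prod.fst_neg, Prod.snd_neg, fourier_neg, star_mul', Complex.star_def]

lemma character_zero (x : Torus) : character 0 x = 1 := by
  simp [character]

@[fun_prop]
lemma continuous_character (n : ℤ × ℤ) : Continuous (character n) := by
  unfold character; fun_prop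

lemma norm_character (n : ℤ × ℤ) (x : Torus) : ‖character n x‖ = 1 := by
  have h1 : ‖fourier n.1 x.1‖ = 1 := by rw [fourier_apply]; exact Circle.norm_coe _
  have h2 : ‖fourier n.2 x.2‖ = 1 := by rw [fourier_apply]; exact Circle.norm_coe _
  rw [character, norm_mul, h1, h2, one_mul]

/-- The character as a continuous map. -/
def chi (n : ℤ × ℤ) : C(Torus, ℂ) := ⟨character n, continuous_character n⟩

lemma chi_apply (n : ℤ × ℤ) (x : Torus) : chi n x = character n x := rfl

lemma integrable_of_continuous {E : Type*} [NormedAddCommGroup E] {f : Torus → E}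
    (hf : Continuous f) : Integrable f torusMeasure :=
  hf.integrable_of_hasCompactSupport (HasCompactSupport.of_compactSpace _)

lemma integral_fourier (n : ℤ) :
    ∫ x : AddCircle (2 * Real.pi), fourier n x ∂AddCircle.haarAddCircle = if n = 0 then 1 else 0 := by
  have h := congrFun (fourierCoeff_fourier (T := 2 * Real.pi) n) 0
  simp only [fourierCoeff, neg_zero, fourier_zero, one_smul] at h
  rw [h, Pi.single_apply]
  simp only [eq_comm]

lemma integral_character (n : ℤ × ℤ) :
    ∫ x, character n x ∂torusMeasure = if n = 0 then 1 else 0 := by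
  simp only [character, torusMeasure]
  rw [integral_prod_mul (fun x => fourier n.1 x) (fun x => fourier n.2 x), integral_fourier,
    integral_fourier]
  by_cases h1 : n.1 = 0 <;> by_cases h2 : n.2 = 0 <;> simp [Prod.ext_iff, h1, h2]

/-- The star subalgebra spanned by the characters. -/
def charSubalgebra : StarSubalgebra ℂ C(Torus, ℂ) where
  toSubalgebra := Algebra.adjoin ℂ (Set.range chi)
  star_mem' := by
    change Algebra.adjoin ℂ (Set.range chi) ≤ star (Algebra.adjoin ℂ (Set.range chi))
    refine Algebra.adjoin_le ?_
    rintro - ⟨n, rfl⟩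
    exact Algebra.subset_adjoin ⟨-n, ContinuousMap.ext fun x => character_neg n x⟩

lemma charSubalgebra_coe : Subalgebra.toSubmodule charSubalgebra.toSubalgebra =
    Submodule.span ℂ (Set.range chi) := by
  apply Algebra.adjoin_eq_span_of_subset
  refine Set.Subset.trans ?_ Submodule.subset_span
  intro x hx
  refine Submonoid.closure_induction (fun _ => id)
    ⟨0, ContinuousMap.ext fun x => character_zero x⟩ ?_ hx
  rintro - - - - ⟨m, rfl⟩ ⟨n, rfl⟩
  exact ⟨m + n, ContinuousMap.ext fun x => character_add m n x⟩

lemma fourier_one_injective : Function.Injective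
    (fourier 1 : C(AddCircle (2 * Real.pi), ℂ)) := by
  intro x y hxy
  rw [fourier_one, fourier_one] at hxy
  exact AddCircle.injective_toCircle (Real.two_pi_pos.ne') (Subtype.coe_injective hxy)

lemma charSubalgebra_separatesPoints : charSubalgebra.SeparatesPoints := by
  intro x y hxy
  by_cases h : x.1 = y.1
  · refine ⟨_, ⟨chi (0, 1), Algebra.subset_adjoin ⟨_, rfl⟩, rfl⟩, fun heq => hxy ?_⟩
    have : fourier 1 x.2 = fourier 1 y.2 := by simpa [chi, character] using heq
    exact Prod.ext h (fourier_one_injective this)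
  · refine ⟨_, ⟨chi (1, 0), Algebra.subset_adjoin ⟨_, rfl⟩, rfl⟩, fun heq => h ?_⟩
    have : fourier 1 x.1 = fourier 1 y.1 := by simpa [chi, character] using heq
    exact fourier_one_injective this

lemma span_chi_closure_eq_top :
    (Submodule.span ℂ (Set.range chi)).topologicalClosure = ⊤ := by
  rw [← charSubalgebra_coe]
  exact congrArg (Subalgebra.toSubmodule <| StarSubalgebra.toSubalgebra ·)
    (ContinuousMap.starSubalgebra_topologicalClosure_eq_top_of_separatesPoints charSubalgebra
      charSubalgebra_separatesPoints)

lemma integrable_mul_continuous {f : Torus → ℂ} (hf : Integrable f torusMeasure) (g : C(Torus, ℂ)) :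
    Integrable (fun x => f x * g x) torusMeasure :=
  hf.mul_bdd (c := ‖g‖) g.continuous.aestronglyMeasurable
    (Filter.Eventually.of_forall fun x => g.norm_coe_le_norm x)

/-- The functional `g ↦ ∫ f g` on continuous functions. -/
def pairing (f : Torus → ℂ) (hf : Integrable f torusMeasure) : C(Torus, ℂ) →L[ℂ] ℂ :=
  LinearMap.mkContinuous
    { toFun := fun g => ∫ x, f x * g x ∂torusMeasure
      map_add' := fun g h => by
        rw [← integral_add (integrable_mul_continuous hf g) (integrable_mul_continuous hf h)]
        simp only [ContinuousMap.add_apply, mul_add]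
      map_smul' := fun c g => by
        simp only [ContinuousMap.smul_apply, smul_eq_mul, RingHom.id_apply]
        rw [← integral_const_mul]
        simp only [mul_left_comm] }
    (∫ x, ‖f x‖ ∂torusMeasure) fun g => by
      simp only [LinearMap.coe_mk, AddHom.coe_mk]
      refine (norm_integral_le_integral_norm _).trans ?_
      rw [← integral_mul_const]
      refine integral_mono (integrable_mul_continuous hf g).norm (hf.norm.mul_const _) fun x => ?_
      simp only [norm_mul]
      gcongr
      exact g.norm_coe_le_norm x

/-- By Stone–Weierstrass the pairing vanishes on all continuous functions; outer approximations of
indicators carry this to integrals over closed sets, which determine `f`. -/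
lemma ae_eq_zero_of_pairing {f : Torus → ℂ} (hf : Integrable f torusMeasure)
    (h : ∀ n, ∫ x, f x * character n x ∂torusMeasure = 0) : f =ᵐ[torusMeasure] 0 := by
  have h0 : pairing f hf = 0 := by
    refine ContinuousLinearMap.ext_on (s := Set.range chi) ?_ ?_
    · have := span_chi_closure_eq_top
      rwa [← Submodule.dense_iff_topologicalClosure_eq_top] at this
    · rintro - ⟨n, rfl⟩
      exact h n
  refine ae_eq_zero_of_forall_setIntegral_isClosed_eq_zero hf fun F hF => ?_
  have hlim : Filter.Tendsto (fun k => ∫ x, f x * ((hF.apprSeq k x : NNReal) : ℂ) ∂torusMeasure)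
      Filter.atTop (nhds (∫ x, F.indicator f x ∂torusMeasure)) := by
    refine tendsto_integral_of_dominated_convergence (fun x => ‖f x‖) (fun k => ?_) hf.norm
      (fun k => Filter.Eventually.of_forall fun x => ?_) (Filter.Eventually.of_forall fun x => ?_)
    · have : Continuous fun x => ((hF.apprSeq k x : NNReal) : ℂ) := by fun_prop
      exact hf.aestronglyMeasurable.mul this.aestronglyMeasurable
    · rw [norm_mul]
      refine mul_le_of_le_one_right (norm_nonneg _) ?_
      have := HasOuterApproxClosed.apprSeq_apply_le_one hF k x
      simpa using this
    · have h1 := (tendsto_pi_nhds.mp (HasOuterApproxClosed.tendsto_apprSeq hF)) x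
      have hcc : Continuous fun y : NNReal => ((y : ℝ) : ℂ) := by fun_prop
      have h2 := (hcc.tendsto _).comp h1
      have h3 := h2.const_mul (f x)
      by_cases hx : x ∈ F
      · simpa [hx] using h3
      · simpa [hx] using h3
  have hz : ∀ k, ∫ x, f x * ((hF.apprSeq k x : NNReal) : ℂ) ∂torusMeasure = 0 := fun k => by
    have : Continuous fun x => ((hF.apprSeq k x : NNReal) : ℂ) := by fun_prop
    exact congrArg (fun L : C(Torus, ℂ) →L[ℂ] ℂ => L ⟨_, this⟩) h0
  simp only [hz] at hlim
  rw [← integral_indicator hF.measurableSet]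
  exact tendsto_nhds_unique hlim tendsto_const_nhds

lemma integrable_mul_character {f : Torus → ℂ} (hf : Integrable f torusMeasure) (n : ℤ × ℤ) :
    Integrable (fun x => f x * character n x) torusMeasure :=
  integrable_mul_continuous hf (chi n)

lemma fourierCoefficient_sub (f g : L1) :
    fourierCoefficient (f - g) = fourierCoefficient f - fourierCoefficient g := by
  funext n
  simp only [fourierCoefficient, Pi.sub_apply]
  rw [← integral_sub (integrable_mul_character (L1.integrable_coeFn f) _)
    (integrable_mul_character (L1.integrable_coeFn g) _)]
  refine integral_congr_ae ?_
  filter_upwards [Lp.coeFn_sub f g] with x hx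
  rw [hx, Pi.sub_apply, sub_mul]

lemma fourierCoefficient_injective : Function.Injective fourierCoefficient := by
  intro f g hfg
  rw [← sub_eq_zero]
  have h := fourierCoefficient_sub f g
  rw [hfg, sub_self] at h
  rw [Lp.eq_zero_iff_ae_eq_zero]
  refine ae_eq_zero_of_pairing (L1.integrable_coeFn _) fun n => ?_
  simpa [fourierCoefficient] using congrFun h (-n)

lemma weightedNorm_eq_cnorm (s p : ℝ) (a : ℤ × ℤ → ℂ) : weightedNorm s p a = cnorm s p a := by
  simp only [weightedNorm, cnorm, xnorm, lnorm, wt, neg_neg]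
  congr 2
  funext n
  rw [← ofReal_norm, ← ENNReal.ofReal_mul (Real.rpow_nonneg (bracket_pos n).le _)]

/-! ### Fourier series in `L³` -/

instance fact_one_le_three : Fact ((1 : ℝ≥0∞) ≤ 3) := ⟨by norm_num⟩

/-- The characters as elements of `L³`. -/
def chi3 (n : ℤ × ℤ) : Lp ℂ 3 torusMeasure := ContinuousMap.toLp 3 torusMeasure ℂ (chi n)

lemma integral_norm_sq_sum_chi (t : Finset (ℤ × ℤ)) (a : ℤ × ℤ → ℂ) :
    ∫ x, ‖∑ n ∈ t, a n * character n x‖ ^ 2 ∂torusMeasure = ∑ n ∈ t, ‖a n‖ ^ 2 := by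
  have h : ∫ x, ((‖∑ n ∈ t, a n * character n x‖ ^ 2 : ℝ) : ℂ) ∂torusMeasure =
      ∑ n ∈ t, ((‖a n‖ ^ 2 : ℝ) : ℂ) := by
    have e : ∀ x, ((‖∑ n ∈ t, a n * character n x‖ ^ 2 : ℝ) : ℂ) =
        ∑ n ∈ t, ∑ m ∈ t, a n * star (a m) * character (n - m) x := by
      intro x
      rw [Complex.ofReal_pow, ← Complex.mul_conj', map_sum, Finset.sum_mul_sum]
      refine Finset.sum_congr rfl fun n _ => Finset.sum_congr rfl fun m _ => ?_
      rw [sub_eq_add_neg, character_add, character_neg, map_mul]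
      simp only [Complex.star_def]
      ring
    simp only [e]
    rw [integral_finsetSum _ fun n _ => integrable_of_continuous (by fun_prop)]
    refine Finset.sum_congr rfl fun n hn => ?_
    rw [integral_finsetSum _ fun m _ => integrable_of_continuous (by fun_prop)]
    simp only [integral_const_mul, integral_character, sub_eq_zero]
    rw [Finset.sum_eq_single n]
    · rw [if_pos rfl, mul_one, Complex.star_def, Complex.mul_conj', Complex.ofReal_pow]
    · intro m _ hm
      rw [if_neg (Ne.symm hm), mul_zero]
    · exact fun h => absurd hn h
  rw [integral_complex_ofReal] at h
  exact_mod_cast h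

/-- One factor is estimated by the supremum `M · card` and the other two by orthogonality. -/
lemma lintegral_sum_chi_cube_le (t : Finset (ℤ × ℤ)) (a : ℤ × ℤ → ℂ) {M : ℝ} (hM : 0 ≤ M)
    (ha : ∀ n ∈ t, ‖a n‖ ≤ M) :
    ∫⁻ x, ‖∑ n ∈ t, a n * character n x‖ₑ ^ (3 : ℝ) ∂torusMeasure ≤
      ENNReal.ofReal (M ^ 3 * (t.card : ℝ) ^ 2) := by
  have hsup : ∀ x, ‖∑ n ∈ t, a n * character n x‖ ≤ M * t.card := fun x => by
    refine (norm_sum_le _ _).trans ?_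
    calc _ ≤ ∑ n ∈ t, M := Finset.sum_le_sum fun n hn => by
          rw [norm_mul, norm_character, mul_one]; exact ha n hn
      _ = _ := by rw [Finset.sum_const, nsmul_eq_mul, mul_comm]
  have hc : Continuous fun x => ∑ n ∈ t, a n * character n x := by fun_prop
  have hi : Integrable (fun x => ‖∑ n ∈ t, a n * character n x‖ ^ 3) torusMeasure :=
    integrable_of_continuous (hc.norm.pow 3)
  have hi2 : Integrable (fun x => ‖∑ n ∈ t, a n * character n x‖ ^ 2) torusMeasure :=
    integrable_of_continuous (hc.norm.pow 2)
  calc _ = ∫⁻ x, ENNReal.ofReal (‖∑ n ∈ t, a n * character n x‖ ^ 3) ∂torusMeasure := by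
        refine lintegral_congr fun x => ?_
        rw [← ofReal_norm, ENNReal.ofReal_rpow_of_nonneg (norm_nonneg _) (by norm_num)]
        norm_num
    _ = ENNReal.ofReal (∫ x, ‖∑ n ∈ t, a n * character n x‖ ^ 3 ∂torusMeasure) :=
        (ofReal_integral_eq_lintegral_ofReal hi (Filter.Eventually.of_forall fun x => by positivity)).symm
    _ ≤ _ := by
        refine ENNReal.ofReal_le_ofReal ?_
        calc _ ≤ ∫ x, M * t.card * ‖∑ n ∈ t, a n * character n x‖ ^ 2 ∂torusMeasure :=
              integral_mono hi (hi2.const_mul _) fun x => by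
                simp only [pow_succ' _ 2]
                gcongr
                exact hsup x
          _ = M * t.card * ∑ n ∈ t, ‖a n‖ ^ 2 := by
              rw [integral_const_mul, integral_norm_sq_sum_chi]
          _ ≤ M * t.card * ∑ n ∈ t, M ^ 2 := by
              gcongr with n hn
              exact ha n hn
          _ = _ := by rw [Finset.sum_const, nsmul_eq_mul]; ring

lemma sum_chi3_coeFn (t : Finset (ℤ × ℤ)) (a : ℤ × ℤ → ℂ) :
    (∑ n ∈ t, a n • chi3 n : Lp ℂ 3 torusMeasure) =ᵐ[torusMeasure]
      fun x => ∑ n ∈ t, a n * character n x := by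
  have e : (∑ n ∈ t, a n • chi3 n : Lp ℂ 3 torusMeasure) =
      ContinuousMap.toLp 3 torusMeasure ℂ (∑ n ∈ t, a n • chi n) := by
    simp only [chi3, map_sum, map_smul]
  rw [e]
  refine (ContinuousMap.coeFn_toLp (𝕜 := ℂ) torusMeasure _).trans
    (Filter.Eventually.of_forall fun x => ?_)
  simp [chi_apply]

lemma norm_sum_chi3_le_of_bound (t : Finset (ℤ × ℤ)) (a : ℤ × ℤ → ℂ) {M : ℝ} (hM : 0 ≤ M)
    (ha : ∀ n ∈ t, ‖a n‖ ≤ M) :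
    ‖∑ n ∈ t, a n • chi3 n‖ ≤ M * (t.card : ℝ) ^ (2 / 3 : ℝ) := by
  rw [Lp.norm_def, eLpNorm_congr_ae (sum_chi3_coeFn t a),
    eLpNorm_eq_lintegral_rpow_enorm_toReal (by norm_num) (by norm_num)]
  refine ENNReal.toReal_le_of_le_ofReal (by positivity) ?_
  have h3 : (3 : ℝ≥0∞).toReal = 3 := by norm_num
  rw [h3]
  refine (ENNReal.rpow_le_rpow (lintegral_sum_chi_cube_le t a hM ha) (by norm_num)).trans_eq ?_
  rw [ENNReal.ofReal_rpow_of_nonneg (by positivity) (by norm_num)]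
  congr 1
  rw [Real.mul_rpow (by positivity) (by positivity), ← Real.rpow_natCast, ← Real.rpow_natCast,
    ← Real.rpow_mul hM, ← Real.rpow_mul (by positivity)]
  norm_num

/-- A Hausdorff–Young inequality short of the endpoint `3/2`. The coefficients are sorted into
layers of size about `N 2^{-j}`; such a layer has at most `2^{(j+1)q}` elements, so its `L³` norm is
`O(N ρ^j)`, and `ρ < 1` because `q < 3/2`. -/
lemma exists_norm_sum_chi3_le {q : ℝ} (hq : 0 < q) (hq2 : q < 3 / 2) : ∃ C : ℝ, 0 ≤ C ∧
    ∀ (t : Finset (ℤ × ℤ)) (a : ℤ × ℤ → ℂ),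
      ‖∑ n ∈ t, a n • chi3 n‖ ≤ C * (∑ n ∈ t, ‖a n‖ ^ q) ^ (1 / q) := by
  set ρ : ℝ := 2 ^ (2 * q / 3 - 1) with hρ
  have hρ0 : 0 < ρ := by positivity
  have hρ1 : ρ < 1 := Real.rpow_lt_one_of_one_lt_of_neg (by norm_num) (by linarith)
  refine ⟨2 ^ (2 * q / 3) * (1 - ρ)⁻¹, mul_nonneg (by positivity) (by
    rw [inv_nonneg]; linarith), fun t a => ?_⟩
  have hsum0 : 0 ≤ ∑ n ∈ t, ‖a n‖ ^ q := Finset.sum_nonneg fun n _ => by positivity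
  set N := (∑ n ∈ t, ‖a n‖ ^ q) ^ (1 / q) with hN
  have hNq : N ^ q = ∑ n ∈ t, ‖a n‖ ^ q := by
    rw [hN, ← Real.rpow_mul hsum0, one_div_mul_cancel hq.ne', Real.rpow_one]
  have hN0 : 0 ≤ N := Real.rpow_nonneg hsum0 _
  have haN : ∀ n ∈ t, ‖a n‖ ≤ N := fun n hn => by
    rw [← Real.rpow_le_rpow_iff (norm_nonneg _) hN0 hq, hNq]
    exact Finset.single_le_sum (f := fun n => ‖a n‖ ^ q) (fun n _ => by positivity) hn
  have hlev : ∀ n, ∃ j : ℕ, n ∈ t → a n ≠ 0 →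
      N * (1 / 2) ^ (j + 1) < ‖a n‖ ∧ ‖a n‖ ≤ N * (1 / 2) ^ j := by
    intro n
    by_cases h : n ∈ t ∧ a n ≠ 0
    · have hpos : 0 < ‖a n‖ := norm_pos_iff.mpr h.2
      have hNp : 0 < N := hpos.trans_le (haN n h.1)
      obtain ⟨j, h1, h2⟩ := exists_nat_pow_near_of_lt_one (x := ‖a n‖ / N) (y := (1 / 2 : ℝ))
        (by positivity) ((div_le_one hNp).mpr (haN n h.1)) (by norm_num) (by norm_num)
      rw [lt_div_iff₀' hNp] at h1
      rw [div_le_iff₀' hNp] at h2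
      exact ⟨j, fun _ _ => ⟨h1, h2⟩⟩
    · exact ⟨0, fun h1 h2 => absurd ⟨h1, h2⟩ h⟩
  choose lev hlev using hlev
  set t' := t.filter fun n => a n ≠ 0 with ht'
  have hfil : ∑ n ∈ t, a n • chi3 n = ∑ n ∈ t', a n • chi3 n := by
    refine (Finset.sum_filter_of_ne fun n _ hn => ?_).symm
    rintro h0
    exact hn (by rw [h0, zero_smul])
  have hcard : ∀ j, ((t'.filter fun n => lev n = j).card : ℝ) ≤ (2 ^ (j + 1)) ^ q := by
    intro j
    by_cases hN00 : N = 0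
    · have : t'.filter (fun n => lev n = j) = ∅ := by
        rw [Finset.filter_eq_empty_iff]
        intro n hn
        rw [ht', Finset.mem_filter] at hn
        have := haN n hn.1
        rw [hN00] at this
        exact absurd (norm_le_zero_iff.mp this) hn.2
      rw [this]; simp; positivity
    · have hNp : 0 < N := lt_of_le_of_ne hN0 (Ne.symm hN00)
      have h1 : ((t'.filter fun n => lev n = j).card : ℝ) * (N * (1 / 2) ^ (j + 1)) ^ q ≤ N ^ q := by
        rw [hNq, ← nsmul_eq_mul, ← Finset.sum_const]
        calc _ ≤ ∑ n ∈ t'.filter fun n => lev n = j, ‖a n‖ ^ q := by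
              refine Finset.sum_le_sum fun n hn => ?_
              rw [Finset.mem_filter, ht', Finset.mem_filter] at hn
              have := (hlev n hn.1.1 hn.1.2).1
              rw [hn.2] at this
              gcongr
          _ ≤ _ := Finset.sum_le_sum_of_subset_of_nonneg
              ((Finset.filter_subset _ _).trans (Finset.filter_subset _ _))
              fun n _ _ => by positivity
      have h2 : N ^ q = (2 ^ (j + 1)) ^ q * (N * (1 / 2) ^ (j + 1)) ^ q := by
        rw [← Real.mul_rpow (by positivity) (by positivity)]
        congr 1
        rw [mul_left_comm, ← mul_pow]; norm_num
      rw [h2] at h1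
      exact le_of_mul_le_mul_right h1 (by positivity)
  have hterm : ∀ j, ‖∑ n ∈ t'.filter (fun n => lev n = j), a n • chi3 n‖ ≤
      N * 2 ^ (2 * q / 3) * ρ ^ j := by
    intro j
    refine (norm_sum_chi3_le_of_bound _ a (M := N * (1 / 2) ^ j) (by positivity) fun n hn => ?_).trans ?_
    · rw [Finset.mem_filter, ht', Finset.mem_filter] at hn
      have := (hlev n hn.1.1 hn.1.2).2
      rwa [hn.2] at this
    · calc _ ≤ N * (1 / 2) ^ j * (((2 : ℝ) ^ (j + 1)) ^ q) ^ (2 / 3 : ℝ) := by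
            gcongr
            exact hcard j
        _ = N * ((1 / 2) ^ j * (((2 : ℝ) ^ (j + 1)) ^ q) ^ (2 / 3 : ℝ)) := by ring
        _ = N * (2 ^ (2 * q / 3) * ρ ^ j) := by
            congr 1
            rw [hρ, ← Real.rpow_natCast (2 ^ (2 * q / 3 - 1) : ℝ), ← Real.rpow_mul (by norm_num),
              ← Real.rpow_natCast (2 : ℝ) (j + 1), ← Real.rpow_mul (by norm_num),
              ← Real.rpow_mul (by norm_num), one_div, inv_pow, ← Real.rpow_natCast (2 : ℝ) j,
              ← Real.rpow_neg (by norm_num), ← Real.rpow_add (by norm_num),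
              ← Real.rpow_add (by norm_num)]
            congr 1
            push_cast
            ring
        _ = _ := by ring
  rw [hfil, ← Finset.sum_fiberwise_of_maps_to (t := t'.image lev)
    (fun n hn => Finset.mem_image_of_mem lev hn)]
  calc _ ≤ ∑ j ∈ t'.image lev, N * 2 ^ (2 * q / 3) * ρ ^ j :=
        (norm_sum_le _ _).trans (Finset.sum_le_sum fun j _ => hterm j)
    _ ≤ N * 2 ^ (2 * q / 3) * (1 - ρ)⁻¹ := by
        rw [← Finset.mul_sum, ← tsum_geometric_of_lt_one hρ0.le hρ1]
        gcongr
        exact (summable_geometric_of_lt_one hρ0.le hρ1).sum_le_tsum _ fun j _ => by positivity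
    _ = _ := by ring

lemma summable_chi3 {q : ℝ} (hq : 0 < q) (hq2 : q < 3 / 2) {a : ℤ × ℤ → ℂ}
    (ha : lnorm q (fun n => ‖a n‖ₑ) ≠ ⊤) : Summable fun n => a n • chi3 n := by
  obtain ⟨C, hC, h⟩ := exists_norm_sum_chi3_le hq hq2
  have hs : Summable fun n => ‖a n‖ ^ q := by
    have h1 : ∑' n, ‖a n‖ₑ ^ q ≠ ⊤ := by
      rw [← lnorm_rpow hq]
      exact ENNReal.rpow_ne_top_of_nonneg hq.le ha
    have h2 : ∀ n, ‖a n‖ₑ ^ q = ENNReal.ofReal (‖a n‖ ^ q) := fun n => by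
      rw [← ofReal_norm, ENNReal.ofReal_rpow_of_nonneg (norm_nonneg _) hq.le]
    simp only [h2] at h1
    have h3 := ENNReal.summable_toReal h1
    refine h3.congr fun n => ENNReal.toReal_ofReal (by positivity)
  rw [summable_iff_vanishing_norm] at hs ⊢
  intro ε hε
  have hδ : 0 < (ε / (C + 1)) ^ q := by positivity
  obtain ⟨u, hu⟩ := hs _ hδ
  refine ⟨u, fun t ht => ?_⟩
  have h0 : 0 ≤ ∑ n ∈ t, ‖a n‖ ^ q := Finset.sum_nonneg fun n _ => by positivity
  have h1 := hu t ht
  rw [Real.norm_of_nonneg h0] at h1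
  have h2 : (∑ n ∈ t, ‖a n‖ ^ q) ^ (1 / q) < ε / (C + 1) := by
    have := Real.rpow_lt_rpow h0 h1 (by positivity : 0 < 1 / q)
    rwa [← Real.rpow_mul (by positivity), mul_one_div_cancel hq.ne', Real.rpow_one] at this
  calc _ ≤ C * (∑ n ∈ t, ‖a n‖ ^ q) ^ (1 / q) := h t a
    _ ≤ C * (ε / (C + 1)) := by gcongr
    _ < ε := by
      rw [mul_div_assoc', div_lt_iff₀ (by positivity)]
      nlinarith

/-! ### The cubic nonlinearity on the Fourier side -/

instance holderConjugate_three : ENNReal.HolderConjugate 3 (3 / 2) :=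
  ENNReal.holderConjugate_iff.mpr <| by
    rw [ENNReal.inv_div (by simp) (by simp), ENNReal.div_eq_inv_mul,
      show (3 : ℝ≥0∞)⁻¹ + 3⁻¹ * 2 = 3⁻¹ * 3 by ring]
    exact ENNReal.inv_mul_cancel (by norm_num) (by norm_num)

instance fact_one_le_three_halves : Fact ((1 : ℝ≥0∞) ≤ 3 / 2) :=
  ⟨by rw [ENNReal.le_div_iff_mul_le (by simp) (by simp)]; norm_num⟩

instance holderTriple_three : ENNReal.HolderTriple 3 3 (3 / 2) where
  inv_add_inv_eq_inv := by
    rw [ENNReal.inv_div (by simp) (by simp), ENNReal.div_eq_inv_mul]; ring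

lemma chi3_coeFn (n : ℤ × ℤ) : chi3 n =ᵐ[torusMeasure] character n :=
  ContinuousMap.coeFn_toLp (𝕜 := ℂ) torusMeasure (chi n)

/-- Integration against `g` is a continuous functional on `L³`, so it passes through the
unconditionally convergent series. -/
lemma hasSum_integral_mul {a : ℤ × ℤ → ℂ} {F : Lp ℂ 3 torusMeasure}
    (hF : HasSum (fun n => a n • chi3 n) F) {g : Torus → ℂ} (hg : MemLp g (3 / 2) torusMeasure) :
    HasSum (fun n => a n * ∫ x, character n x * g x ∂torusMeasure)
      (∫ x, F x * g x ∂torusMeasure) := by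
  set L := ((ContinuousLinearMap.mul ℂ ℂ).lpPairing torusMeasure 3 (3 / 2)).flip hg.toLp with hL
  have hLe : ∀ h : Lp ℂ 3 torusMeasure, L h = ∫ x, h x * g x ∂torusMeasure := fun h => by
    rw [hL, ContinuousLinearMap.flip_apply, ContinuousLinearMap.lpPairing_eq_integral]
    refine integral_congr_ae ?_
    filter_upwards [hg.coeFn_toLp] with x hx
    simp [hx]
  have h := L.hasSum hF
  rw [hLe] at h
  refine h.congr_fun fun n => ?_
  rw [map_smul, smul_eq_mul, hLe]
  congr 1
  refine integral_congr_ae ?_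
  filter_upwards [chi3_coeFn n] with x hx
  rw [hx]

lemma memLp_character (n : ℤ × ℤ) (p : ℝ≥0∞) : MemLp (character n) p torusMeasure :=
  MemLp.of_bound (continuous_character n).aestronglyMeasurable 1
    (Filter.Eventually.of_forall fun x => (norm_character n x).le)

lemma MemLp.mul_character {f : Torus → ℂ} {p : ℝ≥0∞} (hf : MemLp f p torusMeasure) (n : ℤ × ℤ) :
    MemLp (fun x => f x * character n x) p torusMeasure := by
  refine hf.of_le (hf.1.mul (continuous_character n).aestronglyMeasurable)
    (Filter.Eventually.of_forall fun x => ?_)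
  rw [norm_mul, norm_character, mul_one]

lemma MemLp.star' {f : Torus → ℂ} {p : ℝ≥0∞} (hf : MemLp f p torusMeasure) :
    MemLp (fun x => star (f x)) p torusMeasure :=
  hf.of_le (Complex.continuous_conj.comp_aestronglyMeasurable hf.1)
    (Filter.Eventually.of_forall fun _ => (norm_star _).le)

lemma integral_mul_character_of_hasSum {a : ℤ × ℤ → ℂ} {F : Lp ℂ 3 torusMeasure}
    (hF : HasSum (fun n => a n • chi3 n) F) (n : ℤ × ℤ) :
    ∫ x, F x * character (-n) x ∂torusMeasure = a n := by
  have h := hasSum_integral_mul hF (memLp_character (-n) (3 / 2))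
  refine h.unique ?_
  have e : ∀ m, a m * ∫ x, character m x * character (-n) x ∂torusMeasure =
      if m = n then a n else 0 := by
    intro m
    simp only [← character_add, integral_character, ← sub_eq_add_neg, sub_eq_zero]
    split_ifs with hm
    · rw [hm, mul_one]
    · rw [mul_zero]
  simp only [e]
  exact hasSum_ite_eq n (a n)

/-- The Fourier coefficients of `|f|² f` in terms of those of `f`. -/
def cubicSum (a : ℤ × ℤ → ℂ) (n : ℤ × ℤ) : ℂ := ∑' z, a z.1 * star (a (mid n z)) * a z.2

lemma summable_cubicSum {a : ℤ × ℤ → ℂ} {n : ℤ × ℤ}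
    (ha : tripleConv (fun n => ‖a n‖ₑ) (fun n => ‖a n‖ₑ) (fun n => ‖a n‖ₑ) n ≠ ⊤) :
    Summable fun z => a z.1 * star (a (mid n z)) * a z.2 := by
  refine Summable.of_enorm (ne_top_of_le_ne_top ha (le_of_eq (tsum_congr fun z => ?_)))
  rw [enorm_mul, enorm_mul, enorm_star']

/-- The factors are expanded one at a time, each against the `L^{3/2}` function formed by the
others. Absolute convergence of the triple sum is needed to read the iterated sums as one sum over
pairs. -/
lemma integral_cubic_of_hasSum {a : ℤ × ℤ → ℂ} {F : Lp ℂ 3 torusMeasure}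
    (hF : HasSum (fun n => a n • chi3 n) F) {n : ℤ × ℤ}
    (ha : tripleConv (fun n => ‖a n‖ₑ) (fun n => ‖a n‖ₑ) (fun n => ‖a n‖ₑ) n ≠ ⊤) :
    ∫ x, (‖F x‖ : ℂ) ^ 2 * F x * character (-n) x ∂torusMeasure = cubicSum a n := by
  have hF3 : MemLp F 3 torusMeasure := Lp.memLp F
  have hFs : MemLp (fun x => star (F x)) 3 torusMeasure := MemLp.star' hF3
  have hg : MemLp (fun x => star (F x) * (F x * character (-n) x)) (3 / 2) torusMeasure :=
    MemLp.mul (MemLp.mul_character hF3 (-n)) hFs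
  have h1 := hasSum_integral_mul hF hg
  have e1 : ∫ x, (‖F x‖ : ℂ) ^ 2 * F x * character (-n) x ∂torusMeasure =
      ∫ x, F x * (star (F x) * (F x * character (-n) x)) ∂torusMeasure := by
    refine integral_congr_ae (Filter.Eventually.of_forall fun x => ?_)
    simp only [Complex.star_def]
    rw [← Complex.mul_conj']; ring
  rw [e1, ← h1.tsum_eq, cubicSum, (summable_cubicSum ha).tsum_prod]
  refine tsum_congr fun m => ?_
  have hg2 : MemLp (fun x => star (F x) * character (m - n) x) (3 / 2) torusMeasure :=
    (MemLp.mul_character hFs (m - n)).mono_exponent (by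
      rw [ENNReal.div_le_iff (by simp) (by simp)]; norm_num)
  have h2 := hasSum_integral_mul hF hg2
  have e2 : ∫ x, character m x * (star (F x) * (F x * character (-n) x)) ∂torusMeasure =
      ∫ x, F x * (star (F x) * character (m - n) x) ∂torusMeasure := by
    refine integral_congr_ae (Filter.Eventually.of_forall fun x => ?_)
    simp only [sub_eq_add_neg, character_add]; ring
  rw [e2, ← h2.tsum_eq, ← tsum_mul_left]
  refine tsum_congr fun k => ?_
  have e3 : ∫ x, character k x * (star (F x) * character (m - n) x) ∂torusMeasure =
      star (a (mid n (m, k))) := by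
    rw [← integral_mul_character_of_hasSum hF, Complex.star_def, ← integral_conj]
    refine integral_congr_ae (Filter.Eventually.of_forall fun x => ?_)
    simp only [mid, map_mul, character_neg, Complex.star_def, Complex.conj_conj]
    rw [show m + k - n = k + (m - n) by abel, character_add]; ring
  rw [e3]; ring

lemma exists_L1_of_hasSum {a : ℤ × ℤ → ℂ} {F : Lp ℂ 3 torusMeasure}
    (hF : HasSum (fun n => a n • chi3 n) F) :
    ∃ f : L1, fourierCoefficient f = a ∧ f =ᵐ[torusMeasure] F := by
  have hi : MemLp F 1 torusMeasure := (Lp.memLp F).mono_exponent (by norm_num)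
  refine ⟨hi.toLp, funext fun n => ?_, hi.coeFn_toLp⟩
  rw [← integral_mul_character_of_hasSum hF n, fourierCoefficient]
  refine integral_congr_ae ?_
  filter_upwards [hi.coeFn_toLp] with x hx
  rw [hx]

lemma exists_hasSum_of_fourierCoefficient {q : ℝ} (hq : 0 < q) (hq2 : q < 3 / 2) {f : L1}
    (hf : lnorm q (fun n => ‖fourierCoefficient f n‖ₑ) ≠ ⊤) : ∃ F : Lp ℂ 3 torusMeasure,
      HasSum (fun n => fourierCoefficient f n • chi3 n) F ∧ f =ᵐ[torusMeasure] F := by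
  obtain ⟨F, hF⟩ := summable_chi3 hq hq2 hf
  obtain ⟨g, hg, hgF⟩ := exists_L1_of_hasSum hF
  rw [fourierCoefficient_injective hg] at hgF
  exact ⟨F, hF, hgF⟩

namespace TrilinearBounds

variable {s p r : ℝ} {C : ℝ≥0∞}

lemma exponent_pos (H : TrilinearBounds s p r C) : 0 < 3 * r / (2 * r + 1) := by
  have := H.r_pos; positivity

lemma exponent_lt (H : TrilinearBounds s p r C) : 3 * r / (2 * r + 1) < 3 / 2 := by
  have := H.r_pos
  rw [div_lt_div_iff₀ (by positivity) (by norm_num)]; linarith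

lemma lnorm_ne_top (H : TrilinearBounds s p r C) {a : ℤ × ℤ → ℂ} (ha : cnorm s p a ≠ ⊤) :
    lnorm (3 * r / (2 * r + 1)) (fun n => ‖a n‖ₑ) ≠ ⊤ :=
  ne_top_of_le_ne_top (ENNReal.mul_ne_top H.ne_top ha) (H.embed _)

lemma flEmbedsInL3 (H : TrilinearBounds s p r C) : FLEmbedsInL3 s p := by
  intro a ha
  rw [weightedNorm_eq_cnorm] at ha
  obtain ⟨F, hF⟩ := summable_chi3 H.exponent_pos H.exponent_lt (H.lnorm_ne_top ha.ne)
  obtain ⟨f, hf, hfF⟩ := exists_L1_of_hasSum hF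
  exact ⟨f, hf, (memLp_congr_ae hfF).mpr (Lp.memLp F)⟩

lemma integrable_cubic (H : TrilinearBounds s p r C) {f : L1}
    (hf : cnorm s p (fourierCoefficient f) ≠ ⊤) :
    Integrable (fun x => (‖f x‖ : ℂ) ^ 2 * f x) torusMeasure := by
  obtain ⟨F, hF, hfF⟩ := exists_hasSum_of_fourierCoefficient H.exponent_pos H.exponent_lt
    (H.lnorm_ne_top hf)
  have h3 : MemLp f 3 torusMeasure := (memLp_congr_ae hfF).mpr (Lp.memLp F)
  have h := h3.integrable_norm_pow (by norm_num)
  refine h.mono ?_ (Filter.Eventually.of_forall fun x => ?_)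
  · exact ((Complex.continuous_ofReal.comp_aestronglyMeasurable h3.1.norm).pow 2).mul h3.1
  · simp [pow_succ]

lemma integral_cubic (H : TrilinearBounds s p r C) {f : L1}
    (hf : cnorm s p (fourierCoefficient f) ≠ ⊤) (n : ℤ × ℤ) :
    ∫ x, (‖f x‖ : ℂ) ^ 2 * f x * character (-n) x ∂torusMeasure =
      cubicSum (fourierCoefficient f) n := by
  obtain ⟨F, hF, hfF⟩ := exists_hasSum_of_fourierCoefficient H.exponent_pos H.exponent_lt
    (H.lnorm_ne_top hf)
  rw [← integral_cubic_of_hasSum hF (H.tripleConv_ne_top hf hf hf n)]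
  refine integral_congr_ae ?_
  filter_upwards [hfF] with x hx
  rw [hx]

lemma enorm_cubicSum_le (H : TrilinearBounds s p r C) (a : ℤ × ℤ → ℂ) (n : ℤ × ℤ) :
    ‖cubicSum a n‖ₑ ≤ C * cnorm s p a ^ 3 := by
  refine enorm_tsum_le_tsum_enorm.trans ?_
  have e : ∑' z, ‖a z.1 * star (a (mid n z)) * a z.2‖ₑ =
      tripleConv (fun n => ‖a n‖ₑ) (fun n => ‖a n‖ₑ) (fun n => ‖a n‖ₑ) n :=
    tsum_congr fun z => by rw [enorm_mul, enorm_mul, enorm_star']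
  rw [e]
  refine (le_lnorm H.r_pos _ n).trans ((H.young _ _ _).trans_eq ?_)
  rw [cnorm]; ring

end TrilinearBounds

/-! ### The gauge transform -/

/-- The mass of a sequence of Fourier coefficients. -/
def mass (a : ℤ × ℤ → ℂ) : ℝ := ∑' n, ‖a n‖ ^ 2

/-- The gauge factor `e^{i(q(n)t - 2θ)}`, with `q(n) = n₁² - n₂²`. -/
def gauge (n : ℤ × ℤ) (t θ : ℝ) : ℂ :=
  Complex.exp (((hform n n : ℤ) * t - 2 * θ : ℝ) * Complex.I)

lemma norm_gauge (n : ℤ × ℤ) (t θ : ℝ) : ‖gauge n t θ‖ = 1 := Complex.norm_exp_ofReal_mul_I _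

lemma enorm_gauge (n : ℤ × ℤ) (t θ : ℝ) : ‖gauge n t θ‖ₑ = 1 := by
  rw [← ofReal_norm, norm_gauge, ENNReal.ofReal_one]

lemma star_gauge_mul (n : ℤ × ℤ) (t θ : ℝ) : star (gauge n t θ) * gauge n t θ = 1 := by
  rw [Complex.star_def, Complex.conj_mul', norm_gauge]; simp

lemma gauge_mul_star (n : ℤ × ℤ) (t θ : ℝ) : gauge n t θ * star (gauge n t θ) = 1 := by
  rw [mul_comm, star_gauge_mul]

lemma gauge_zero (n : ℤ × ℤ) : gauge n 0 0 = 1 := by simp [gauge]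

lemma hform_sub_eq_halfPhase (n : ℤ × ℤ) (z : (ℤ × ℤ) × (ℤ × ℤ)) :
    2 * halfPhase n z = hform n n - hform z.1 z.1 + hform (mid n z) (mid n z) - hform z.2 z.2 := by
  simp only [halfPhase, hform, mid, Prod.fst_sub, Prod.snd_sub, Prod.fst_add, Prod.snd_add]
  ring

/-- The resonance phase converts the linear phases of the inputs into that of the output; of the
three phases `-2θ, +2θ, -2θ` one survives. -/
lemma expi_mul_gauge (n : ℤ × ℤ) (z : (ℤ × ℤ) × (ℤ × ℤ)) (t θ : ℝ) :
    expi (2 * halfPhase n z) t * (gauge z.1 t θ * star (gauge (mid n z) t θ) * gauge z.2 t θ) =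
      gauge n t θ := by
  rw [hform_sub_eq_halfPhase]
  simp only [expi, gauge, Complex.star_def, ← Complex.exp_conj, ← Complex.exp_add]
  congr 1
  simp only [map_mul, Complex.conj_ofReal, Complex.conj_I]
  push_cast
  ring

/-- The nonlinear terms that are left after the gauge transform. -/
def gaugedSum (a : ℤ × ℤ → ℂ) (n : ℤ × ℤ) : ℂ :=
  ∑' z, coef n z * (a z.1 * star (a (mid n z)) * a z.2)

lemma nonlin_gauge (a : ℤ × ℤ → ℂ) (t θ : ℝ) (n : ℤ × ℤ) :
    nonlin t (fun m => gauge m t θ * a m) (fun m => gauge m t θ * a m)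
      (fun m => gauge m t θ * a m) n = gauge n t θ * gaugedSum a n := by
  rw [nonlin, gaugedSum, ← tsum_mul_left]
  refine tsum_congr fun z => ?_
  rw [← expi_mul_gauge n z t θ, star_mul']
  ring

lemma mass_gauge (a : ℤ × ℤ → ℂ) (t θ : ℝ) : mass (fun m => gauge m t θ * a m) = mass a := by
  simp only [mass, norm_mul, norm_gauge, one_mul]

lemma hasDerivWithinAt_gauge {Θ : ℝ → ℝ} {M t : ℝ} {S : Set ℝ} (h : HasDerivWithinAt Θ M S t)
    (n : ℤ × ℤ) : HasDerivWithinAt (fun t => gauge n t (Θ t))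
      (Complex.I * ((hform n n : ℤ) - 2 * M) * gauge n t (Θ t)) S t := by
  have h1 : HasDerivWithinAt (fun t : ℝ => ((hform n n : ℤ) * t - 2 * Θ t : ℝ))
      ((hform n n : ℤ) - 2 * M) S t := by
    exact (((hasDerivWithinAt_id t S).const_mul ((hform n n : ℤ) : ℝ)).sub
      (h.const_mul 2)).congr_deriv (by rw [mul_one])
  have h2 := (h1.ofReal_comp.mul_const Complex.I).cexp
  refine h2.congr_deriv ?_
  rw [gauge]; push_cast; ring

lemma hasDerivWithinAt_star_gauge {Θ : ℝ → ℝ} {M t : ℝ} {S : Set ℝ}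
    (h : HasDerivWithinAt Θ M S t) (n : ℤ × ℤ) :
    HasDerivWithinAt (fun t => star (gauge n t (Θ t)))
      (-(Complex.I * ((hform n n : ℤ) - 2 * M)) * star (gauge n t (Θ t))) S t := by
  have h1 := (hasDerivWithinAt_gauge h n).star
  refine h1.congr_deriv ?_
  simp only [star_mul', Complex.star_def, Complex.conj_I, map_sub, map_mul, Complex.conj_ofReal,
    map_ofNat]
  simp

/-- The fundamental theorem of calculus on a closed interval. -/
lemma integral_eq_iff_hasDerivWithinAt {T : ℝ} {f g : ℝ → ℂ} (hg : ContinuousOn g (Set.Icc 0 T)) :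
    (∀ t ∈ Set.Icc 0 T, f t = f 0 + ∫ x in (0 : ℝ)..t, g x) ↔
      ∀ t ∈ Set.Icc 0 T, HasDerivWithinAt f (g t) (Set.Icc 0 T) t := by
  constructor
  · intro h t ht
    have hT : (0 : ℝ) ≤ T := ht.1.trans ht.2
    set G := Set.IccExtend hT (Set.domRestrict (Set.Icc 0 T) g) with hG
    have hGc : Continuous G := (continuousOn_iff_continuous_domRestrict.mp hg).Icc_extend'
    have hGg : ∀ x ∈ Set.Icc 0 T, G x = g x := fun x hx => Set.IccExtend_of_mem hT _ hx
    have h1 : HasDerivAt (fun t => f 0 + ∫ x in (0 : ℝ)..t, G x) (G t) t :=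
      (intervalIntegral.integral_hasDerivAt_right (hGc.intervalIntegrable _ _)
        hGc.stronglyMeasurable.stronglyMeasurableAtFilter hGc.continuousAt).const_add _
    rw [hGg t ht] at h1
    have hfeq : ∀ u ∈ Set.Icc 0 T, f u = f 0 + ∫ x in (0 : ℝ)..u, G x := fun u hu => by
      rw [h u hu]
      congr 1
      refine intervalIntegral.integral_congr fun x hx => ?_
      rw [Set.uIcc_of_le hu.1] at hx
      exact (hGg x ⟨hx.1, hx.2.trans hu.2⟩).symm
    exact h1.hasDerivWithinAt.congr hfeq (hfeq t ht)
  · intro h t ht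
    have h1 := intervalIntegral.integral_eq_sub_of_hasDeriv_right_of_le (f := f) (f' := g) ht.1
      (fun x hx => ((h x ⟨hx.1, hx.2.trans ht.2⟩).continuousWithinAt).mono
        (Set.Icc_subset_Icc_right ht.2))
      (fun x hx => ((h x ⟨hx.1.le, hx.2.le.trans ht.2⟩).hasDerivAt
        (Icc_mem_nhds hx.1 (hx.2.trans_le ht.2))).hasDerivWithinAt)
      ((hg.mono (Set.uIcc_subset_Icc ⟨le_rfl, ht.1.trans ht.2⟩ ht)).intervalIntegrable)
    rw [h1]; ring

/-- Multiplication by continuous unimodular factors preserves continuity in time. -/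
lemma ContX.mul_unimodular {s p t₀ t₁ : ℝ} (hp : 1 ≤ p) {b : ℝ → ℤ × ℤ → ℂ}
    (hb : ContX s p t₀ t₁ b) {e : ℝ → ℤ × ℤ → ℂ} (he : ∀ t n, ‖e t n‖ₑ = 1)
    (hc : ∀ n, ContinuousOn (fun t => e t n) (Set.Icc t₀ t₁)) :
    ContX s p t₀ t₁ (fun t n => e t n * b t n) := by
  have hp0 : 0 < p := by linarith
  have hnorm : ∀ t (f : ℤ × ℤ → ℂ), cnorm s p (fun n => e t n * f n) = cnorm s p f := fun t f => by
    simp only [cnorm, enorm_mul, he, one_mul]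
  refine ⟨fun t ht => by rw [hnorm]; exact hb.1 t ht, fun t ht => ?_⟩
  have hsplit : ∀ t', cnorm s p ((fun n => e t' n * b t' n) - fun n => e t n * b t n) ≤
      cnorm s p (b t' - b t) + cnorm s p (fun n => (e t' n - e t n) * b t n) := by
    intro t'
    rw [← hnorm t' (b t' - b t)]
    refine le_trans (le_of_eq ?_) (cnorm_add_le hp _ _)
    congr 1
    funext n
    simp only [Pi.sub_apply, Pi.add_apply]; ring
  have hlim : Filter.Tendsto (fun t' => cnorm s p (fun n => (e t' n - e t n) * b t n))
      (nhdsWithin t (Set.Icc t₀ t₁)) (nhds 0) := by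
    -- The factors are continuous for each `n` but not uniformly in `n`, so dominated convergence on
    -- `ℤ²` with counting measure replaces a uniform estimate.
    let _ : MeasurableSpace (ℤ × ℤ) := ⊤
    have h1 : Filter.Tendsto
        (fun t' => ∫⁻ n, (wt (-s) n * ‖(e t' n - e t n) * b t n‖ₑ) ^ p ∂Measure.count)
        (nhdsWithin t (Set.Icc t₀ t₁)) (nhds (∫⁻ n : ℤ × ℤ, 0 ∂Measure.count)) := by
      refine tendsto_lintegral_filter_of_dominated_convergence
        (fun n => (2 * (wt (-s) n * ‖b t n‖ₑ)) ^ p) (Filter.Eventually.of_forall fun _ =>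
          measurable_from_top) (Filter.Eventually.of_forall fun t' =>
          Filter.Eventually.of_forall fun n => ?_) ?_ (Filter.Eventually.of_forall fun n => ?_)
      · refine ENNReal.rpow_le_rpow ?_ hp0.le
        rw [enorm_mul, mul_left_comm]
        gcongr
        refine enorm_sub_le.trans ?_
        rw [he, he]; norm_num
      · rw [lintegral_count' measurable_from_top, ← lnorm_rpow hp0, lnorm_const_mul hp0]
        have : lnorm p (fun n => wt (-s) n * ‖b t n‖ₑ) ≠ ⊤ := hb.1 t ht
        exact ENNReal.rpow_ne_top_of_nonneg hp0.le (by finiteness)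
      · have h2 : Filter.Tendsto (fun t' => (e t' n - e t n) * b t n)
            (nhdsWithin t (Set.Icc t₀ t₁)) (nhds ((e t n - e t n) * b t n)) :=
          (((hc n) t ht).sub_const _).mul_const _
        rw [sub_self, zero_mul] at h2
        have h3 := ENNReal.Tendsto.const_mul (a := wt (-s) n)
          (tendsto_zero_iff_enorm_tendsto_zero.mp h2) (Or.inr (wt_ne_top _ _))
        rw [mul_zero] at h3
        have h4 := (ENNReal.continuous_rpow_const (y := p)).tendsto 0 |>.comp h3
        rwa [ENNReal.zero_rpow_of_pos hp0] at h4
    have h5 := (ENNReal.continuous_rpow_const (y := 1 / p)).tendsto _ |>.comp h1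
    simp only [lintegral_zero] at h5
    rw [ENNReal.zero_rpow_of_pos (by positivity)] at h5
    refine h5.congr fun t' => ?_
    simp only [Function.comp_apply, lintegral_count' measurable_from_top]
    rfl
  have hz := (hb.2 t ht).add hlim
  rw [add_zero] at hz
  exact tendsto_of_tendsto_of_tendsto_of_le_of_le tendsto_const_nhds hz (fun _ => zero_le) hsplit

namespace TrilinearBounds

variable {s p r : ℝ} {C : ℝ≥0∞}

/-- The strong space lies in `ℓ^q` with `q < 3/2 < 2`, so the mass is finite. -/
lemma lnorm_two_le (H : TrilinearBounds s p r C) (f : ℤ × ℤ → ℝ≥0∞) :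
    lnorm 2 f ≤ C * xnorm s p f :=
  (lnorm_le_lnorm H.exponent_pos (by linarith [H.exponent_lt]) f).trans (H.embed f)

lemma summable_mass (H : TrilinearBounds s p r C) {a : ℤ × ℤ → ℂ} (ha : cnorm s p a ≠ ⊤) :
    Summable fun n => ‖a n‖ ^ 2 := by
  have h := ENNReal.rpow_ne_top_of_nonneg (y := 2) (by norm_num)
    (ne_top_of_le_ne_top (ENNReal.mul_ne_top H.ne_top ha) (H.lnorm_two_le fun n => ‖a n‖ₑ))
  rw [lnorm_rpow (by norm_num)] at h
  refine (ENNReal.summable_toReal h).congr fun n => ?_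
  rw [← ENNReal.toReal_rpow, toReal_enorm]
  norm_num

lemma mass_eq_toReal_sq {a : ℤ × ℤ → ℂ} :
    mass a = (lnorm 2 (fun n => ‖a n‖ₑ)).toReal ^ 2 := by
  have h : (lnorm 2 (fun n => ‖a n‖ₑ)) ^ (2 : ℝ) = ∑' n, ‖a n‖ₑ ^ (2 : ℝ) :=
    lnorm_rpow (by norm_num) _
  rw [← Real.rpow_natCast, Nat.cast_ofNat, ENNReal.toReal_rpow, h, ENNReal.tsum_toReal_eq]
  · refine tsum_congr fun n => ?_
    rw [← ENNReal.toReal_rpow, toReal_enorm]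
    norm_num
  · intro n
    finiteness

lemma continuousOn_mass (H : TrilinearBounds s p r C) {t₀ t₁ : ℝ} {b : ℝ → ℤ × ℤ → ℂ}
    (hb : ContX s p t₀ t₁ b) : ContinuousOn (fun t => mass (b t)) (Set.Icc t₀ t₁) := by
  simp only [mass_eq_toReal_sq]
  refine ContinuousOn.pow ?_ 2
  intro t ht
  have hfin : ∀ t ∈ Set.Icc t₀ t₁, lnorm 2 (fun n => ‖b t n‖ₑ) ≠ ⊤ := fun t ht =>
    ne_top_of_le_ne_top (ENNReal.mul_ne_top H.ne_top (hb.1 t ht)) (H.lnorm_two_le _)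
  refine (ENNReal.tendsto_toReal (hfin t ht)).comp ?_
  have hd := ENNReal.Tendsto.const_mul (a := C) (hb.2 t ht) (Or.inr H.ne_top)
  rw [mul_zero] at hd
  have hdiff : ∀ f g : ℤ × ℤ → ℂ, lnorm 2 (fun n => ‖f n‖ₑ) ≤
      lnorm 2 (fun n => ‖g n‖ₑ) + C * cnorm s p (f - g) := by
    intro f g
    refine le_trans ?_ (add_le_add le_rfl (H.lnorm_two_le fun n => ‖(f - g) n‖ₑ))
    refine (lnorm_mono (by norm_num) fun n => ?_).trans (lnorm_add_le (by norm_num) _ _)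
    calc ‖f n‖ₑ = ‖g n + (f - g) n‖ₑ := by rw [Pi.sub_apply, add_sub_cancel]
      _ ≤ _ := enorm_add_le _ _
  have hlow : Filter.Tendsto (fun t' => lnorm 2 (fun n => ‖b t n‖ₑ) - C * cnorm s p (b t' - b t))
      (nhdsWithin t (Set.Icc t₀ t₁)) (nhds (lnorm 2 (fun n => ‖b t n‖ₑ))) := by
    simpa using ENNReal.Tendsto.sub (tendsto_const_nhds (x := lnorm 2 (fun n => ‖b t n‖ₑ))) hd
      (Or.inl (hfin t ht))
  have hup : Filter.Tendsto (fun t' => lnorm 2 (fun n => ‖b t n‖ₑ) + C * cnorm s p (b t' - b t))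
      (nhdsWithin t (Set.Icc t₀ t₁)) (nhds (lnorm 2 (fun n => ‖b t n‖ₑ))) := by
    simpa using (tendsto_const_nhds (x := lnorm 2 (fun n => ‖b t n‖ₑ))).add hd
  refine tendsto_of_tendsto_of_tendsto_of_le_of_le hlow hup (fun t' => ?_) fun t' => ?_
  · rw [tsub_le_iff_right, cnorm_sub_comm]
    exact hdiff _ _
  · exact hdiff _ _

/-- Separation of the resonant part of the nonlinearity. -/
lemma cubicSum_eq (H : TrilinearBounds s p r C) {a : ℤ × ℤ → ℂ} (ha : cnorm s p a ≠ ⊤)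
    (n : ℤ × ℤ) :
    Complex.I * cubicSum a n = 2 * Complex.I * mass a * a n + gaugedSum a n := by
  set F : (ℤ × ℤ) × (ℤ × ℤ) → ℂ := fun z => a z.1 * star (a (mid n z)) * a z.2 with hF
  have hs : Summable F := summable_cubicSum (H.tripleConv_ne_top ha ha ha n)
  have hg : Summable fun z => coef n z * F z := by
    refine Summable.of_norm_bounded hs.norm fun z => ?_
    rw [norm_mul]
    refine mul_le_of_le_one_left (norm_nonneg _) ?_
    have := enorm_coef_le_one n z
    rw [← ofReal_norm] at this
    exact ENNReal.ofReal_le_one.mp this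
  have hmass : HasSum (fun m => a n * ((‖a m‖ ^ 2 : ℝ) : ℂ)) (a n * mass a) :=
    (Complex.hasSum_ofReal.mpr (H.summable_mass ha).hasSum).mul_left _
  have h1 : HasSum (fun z : (ℤ × ℤ) × (ℤ × ℤ) => if z.1 = n then F z else 0) (a n * mass a) := by
    have hinj : Function.Injective fun m : ℤ × ℤ => ((n, m) : (ℤ × ℤ) × (ℤ × ℤ)) :=
      fun m m' h => (Prod.ext_iff.mp h).2
    rw [← hinj.hasSum_iff]
    · refine hmass.congr_fun fun m => ?_
      simp only [Function.comp_apply, hF, mid, add_sub_cancel_left, if_true]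
      rw [Complex.star_def, mul_assoc, Complex.conj_mul']; push_cast; rfl
    · intro z hz
      refine if_neg fun h => hz ⟨z.2, ?_⟩
      rw [← h]
  have h2 : HasSum (fun z : (ℤ × ℤ) × (ℤ × ℤ) => if z.2 = n then F z else 0) (a n * mass a) := by
    have hinj : Function.Injective fun m : ℤ × ℤ => ((m, n) : (ℤ × ℤ) × (ℤ × ℤ)) :=
      fun m m' h => (Prod.ext_iff.mp h).1
    rw [← hinj.hasSum_iff]
    · refine hmass.congr_fun fun m => ?_
      simp only [Function.comp_apply, hF, mid, add_sub_cancel_right, if_true]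
      rw [Complex.star_def, Complex.mul_conj']; push_cast; ring
    · intro z hz
      refine if_neg fun h => hz ⟨z.1, ?_⟩
      rw [← h]
  have h3 := (hg.hasSum.add (h1.mul_left Complex.I)).add (h2.mul_left Complex.I)
  have h4 : HasSum (fun z => Complex.I * F z) (Complex.I * cubicSum a n) := hs.hasSum.mul_left _
  -- Inclusion–exclusion: the pair `(n, n)` belongs to both resonant families, which is why `coef`
  -- is `-i` there.
  have e : ∀ z, Complex.I * F z = coef n z * F z + Complex.I * (if z.1 = n then F z else 0) +
      Complex.I * (if z.2 = n then F z else 0) := by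
    intro z
    unfold coef
    by_cases hz1 : z.1 = n <;> by_cases hz2 : z.2 = n <;> simp [hz1, hz2]
  simp only [e] at h4
  rw [h4.unique h3]
  change gaugedSum a n + _ + _ = _
  ring

end TrilinearBounds

/-- Solutions of the equation on the Fourier side. -/
structure IsFourierSolution (s p T : ℝ) (a : ℝ → ℤ × ℤ → ℂ) : Prop where
  cont : ContX s p 0 T a
  deriv : ∀ t ∈ Set.Icc 0 T, ∀ n, HasDerivWithinAt (fun t => a t n)
    (-Complex.I * (hform n n : ℤ) * a t n + Complex.I * cubicSum (a t) n) (Set.Icc 0 T) t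

/-- The time integral of the mass. -/
def massIntegral (a : ℝ → ℤ × ℤ → ℂ) (t : ℝ) : ℝ := ∫ x in (0 : ℝ)..t, mass (a x)

namespace TrilinearBounds

variable {s p r : ℝ} {C : ℝ≥0∞}

lemma hasDerivWithinAt_massIntegral (H : TrilinearBounds s p r C) {T : ℝ} {a : ℝ → ℤ × ℤ → ℂ}
    (ha : ContX s p 0 T a) {t : ℝ} (ht : t ∈ Set.Icc 0 T) :
    HasDerivWithinAt (massIntegral a) (mass (a t)) (Set.Icc 0 T) t := by
  have h1 : ContinuousOn (fun t => ((mass (a t) : ℝ) : ℂ)) (Set.Icc 0 T) :=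
    Complex.continuous_ofReal.comp_continuousOn (H.continuousOn_mass ha)
  have h2 := (integral_eq_iff_hasDerivWithinAt (f := fun t => ((massIntegral a t : ℝ) : ℂ)) h1).mp
    (fun t _ => by simp [massIntegral, intervalIntegral.integral_ofReal]) t ht
  have h3 := (Complex.reCLM.hasFDerivAt (x := ((massIntegral a t : ℝ) : ℂ))).comp_hasDerivWithinAt t h2
  exact h3

lemma continuousOn_gauge (H : TrilinearBounds s p r C) {T : ℝ} {a : ℝ → ℤ × ℤ → ℂ}
    (ha : ContX s p 0 T a) (n : ℤ × ℤ) :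
    ContinuousOn (fun t => gauge n t (massIntegral a t)) (Set.Icc 0 T) := fun _ ht =>
  (hasDerivWithinAt_gauge (H.hasDerivWithinAt_massIntegral ha ht) n).continuousWithinAt

/-- The derivative of the gauge phase cancels the resonant term `2i · mass · a(n)`. The phase is the
integral of the mass along the solution, so conservation of mass is not needed. -/
lemma isRough_gauge (H : TrilinearBounds s p r C) {T : ℝ} {a : ℝ → ℤ × ℤ → ℂ}
    (ha : IsFourierSolution s p T a) :
    IsRough s p 0 T (fun t n => gauge n t (massIntegral a t) * a t n) := by
  have hcont := ha.cont.mul_unimodular H.one_lt.le (e := fun t n => gauge n t (massIntegral a t))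
    (fun t n => enorm_gauge _ _ _) (H.continuousOn_gauge ha.cont)
  refine ⟨hcont, fun t ht n => ?_⟩
  refine (integral_eq_iff_hasDerivWithinAt
    (f := fun t => gauge n t (massIntegral a t) * a t n) (H.continuousOn_nonlin hcont n)).mpr (fun t ht => ?_) t ht
  have h := (hasDerivWithinAt_gauge (H.hasDerivWithinAt_massIntegral ha.cont ht) n).mul
    (ha.deriv t ht n)
  refine h.congr_deriv ?_
  rw [nonlin_gauge, H.cubicSum_eq (ha.cont.1 t ht)]
  ring

/-- The mass is unchanged by the gauge, so the inverse transform can use the mass of `b` itself. -/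
lemma isFourierSolution_of_isRough (H : TrilinearBounds s p r C) {T : ℝ} {b : ℝ → ℤ × ℤ → ℂ}
    (hb : IsRough s p 0 T b) :
    IsFourierSolution s p T (fun t n => star (gauge n t (massIntegral b t)) * b t n) := by
  have hcont := hb.cont.mul_unimodular H.one_lt.le
    (e := fun t n => star (gauge n t (massIntegral b t)))
    (fun t n => by rw [enorm_star', enorm_gauge])
    (fun n => Complex.continuous_conj.comp_continuousOn (H.continuousOn_gauge hb.cont n))
  refine ⟨hcont, fun t ht n => ?_⟩
  have hbd := (integral_eq_iff_hasDerivWithinAt (H.continuousOn_nonlin hb.cont n)).mp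
    (fun t ht => hb.eq t ht n) t ht
  have h := (hasDerivWithinAt_star_gauge (H.hasDerivWithinAt_massIntegral hb.cont ht) n).mul hbd
  refine h.congr_deriv ?_
  set θ := massIntegral b t
  set a : ℤ × ℤ → ℂ := fun m => star (gauge m t θ) * b t m with ha
  have hab : b t = fun m => gauge m t θ * a m := funext fun m => by
    simp only [ha]; rw [← mul_assoc, gauge_mul_star, one_mul]
  have hm : mass (b t) = mass a := by rw [hab, mass_gauge]
  have hfin : cnorm s p a ≠ ⊤ := hcont.1 t ht
  have hn : nonlin t (b t) (b t) (b t) n = gauge n t θ * gaugedSum a n := by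
    rw [hab, nonlin_gauge]
  rw [H.cubicSum_eq hfin, hm, hn, ← mul_assoc (star (gauge n t θ)), star_gauge_mul]
  simp only [ha]
  ring

/-- The gauged solutions agree by `rough_unique`. Hence the masses agree, hence the phases, and the
phases can be cancelled. -/
lemma fourierSolution_unique (H : TrilinearBounds s p r C) {T : ℝ} {a a' : ℝ → ℤ × ℤ → ℂ}
    (ha : IsFourierSolution s p T a) (ha' : IsFourierSolution s p T a') (h0 : a 0 = a' 0) :
    ∀ t ∈ Set.Icc 0 T, a t = a' t := by
  have h := H.rough_unique (H.isRough_gauge ha) (H.isRough_gauge ha') (by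
    funext n; simp [massIntegral, h0])
  have hm : ∀ t ∈ Set.Icc 0 T, mass (a t) = mass (a' t) := fun t ht => by
    rw [← mass_gauge (a t) t (massIntegral a t), ← mass_gauge (a' t) t (massIntegral a' t)]
    exact congrArg mass (h t ht)
  intro t ht
  have hΘ : massIntegral a t = massIntegral a' t := by
    refine intervalIntegral.integral_congr fun x hx => ?_
    rw [Set.uIcc_of_le ht.1] at hx
    exact hm x ⟨hx.1, hx.2.trans ht.2⟩
  funext n
  have hn := congrFun (h t ht) n
  simp only [hΘ] at hn
  have hne : gauge n t (massIntegral a' t) ≠ 0 := by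
    rw [← norm_pos_iff, norm_gauge]; exact one_pos
  exact mul_left_cancel₀ hne hn

lemma exists_fourierSolution (H : TrilinearBounds s p r C) {f : ℤ × ℤ → ℂ}
    (hf : cnorm s p f ≠ ⊤) : ∃ T : ℝ, 0 < T ∧ ∃ a, IsFourierSolution s p T a ∧ a 0 = f := by
  obtain ⟨T, hT, b, hb, hb0⟩ := H.exists_rough hf
  refine ⟨T, hT, _, H.isFourierSolution_of_isRough hb, ?_⟩
  funext n
  simp [massIntegral, gauge_zero, hb0]

end TrilinearBounds

/-! ### Smooth families of functions on the torus -/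

/-- The lift to `ℝ × ℝ²` of a family of functions on the torus. -/
def lift (φ : ℝ → Torus → ℂ) (z : ℝ × ℝ × ℝ) : ℂ :=
  φ z.1 ((z.2.1 : AddCircle (2 * Real.pi)), (z.2.2 : AddCircle (2 * Real.pi)))

/-- Families of functions on the torus that depend smoothly on all variables. -/
def SmoothFamily (φ : ℝ → Torus → ℂ) : Prop := ContDiff ℝ ((⊤ : ℕ∞) : WithTop ℕ∞) (lift φ)

/-- The projection of the plane to the torus. -/
def toTorus (v : ℝ × ℝ) : Torus := ((v.1 : AddCircle (2 * Real.pi)), (v.2 : AddCircle (2 * Real.pi)))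

lemma toTorus_zero : toTorus 0 = 0 := rfl

lemma isOpenQuotientMap_toTorus : IsOpenQuotientMap toTorus :=
  (QuotientAddGroup.isOpenQuotientMap_mk (N := AddSubgroup.zmultiples (2 * Real.pi))).prodMap
    (QuotientAddGroup.isOpenQuotientMap_mk (N := AddSubgroup.zmultiples (2 * Real.pi)))

/-- The derivative of a family of functions on the torus in a direction of `ℝ × ℝ²`. -/
def dirDeriv (v : ℝ × ℝ × ℝ) (φ : ℝ → Torus → ℂ) (t : ℝ) (x : Torus) : ℂ :=
  deriv (fun h : ℝ => φ (t + h * v.1) (x + toTorus (h • v.2))) 0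

lemma SmoothFamily.hasDerivAt_lift {φ : ℝ → Torus → ℂ} (hφ : SmoothFamily φ)
    (z v : ℝ × ℝ × ℝ) (h : ℝ) :
    HasDerivAt (fun h : ℝ => lift φ (z + h • v)) (fderiv ℝ (lift φ) (z + h • v) v) h := by
  have h1 : HasDerivAt (fun h : ℝ => z + h • v) v h := by
    simpa using ((hasDerivAt_id h).smul_const v).const_add z
  exact ((hφ.differentiable (by simp)) (z + h • v)).hasFDerivAt.comp_hasDerivAt h h1

lemma SmoothFamily.lift_dirDeriv {φ : ℝ → Torus → ℂ} (hφ : SmoothFamily φ) (v : ℝ × ℝ × ℝ) :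
    lift (dirDeriv v φ) = fun z => fderiv ℝ (lift φ) z v := by
  funext z
  have h := (hφ.hasDerivAt_lift z v 0).deriv
  rw [zero_smul, add_zero] at h
  exact h

lemma SmoothFamily.dirDeriv {φ : ℝ → Torus → ℂ} (hφ : SmoothFamily φ) (v : ℝ × ℝ × ℝ) :
    SmoothFamily (dirDeriv v φ) := by
  rw [SmoothFamily, hφ.lift_dirDeriv v]
  exact (hφ.fderiv_right (m := ((⊤ : ℕ∞) : WithTop ℕ∞)) (by simp)).clm_apply contDiff_const

lemma SmoothFamily.hasDerivAt {φ : ℝ → Torus → ℂ} (hφ : SmoothFamily φ) (v : ℝ × ℝ × ℝ)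
    (t : ℝ) (x : Torus) (h : ℝ) :
    HasDerivAt (fun h : ℝ => φ (t + h * v.1) (x + toTorus (h • v.2)))
      (HNLS.dirDeriv v φ (t + h * v.1) (x + toTorus (h • v.2))) h := by
  obtain ⟨y, rfl⟩ := isOpenQuotientMap_toTorus.surjective x
  have h1 := hφ.hasDerivAt_lift (t, y) v h
  have h2 := congrFun (hφ.lift_dirDeriv v) ((t, y) + h • v)
  rw [← h2] at h1
  exact h1

lemma SmoothFamily.continuous {φ : ℝ → Torus → ℂ} (hφ : SmoothFamily φ) :
    Continuous fun z : ℝ × Torus => φ z.1 z.2 := by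
  have hq : IsOpenQuotientMap (Prod.map (id : ℝ → ℝ) toTorus) :=
    IsOpenQuotientMap.id.prodMap isOpenQuotientMap_toTorus
  rw [hq.isQuotientMap.continuous_iff]
  exact ContDiff.continuous hφ

lemma SmoothFamily.continuous_apply {φ : ℝ → Torus → ℂ} (hφ : SmoothFamily φ) (t : ℝ) :
    Continuous (φ t) :=
  hφ.continuous.comp (Continuous.prodMk_right t)

lemma SmoothFamily.exists_bound {φ : ℝ → Torus → ℂ} (hφ : SmoothFamily φ) (a b : ℝ) :
    ∃ K : ℝ, ∀ t ∈ Set.Icc a b, ∀ x, ‖φ t x‖ ≤ K := by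
  obtain ⟨K, hK⟩ := (isCompact_Icc.prod (isCompact_univ (X := Torus))).exists_bound_of_continuousOn
    (s := Set.Icc a b ×ˢ Set.univ) hφ.continuous.continuousOn
  exact ⟨K, fun t ht x => hK (t, x) ⟨ht, Set.mem_univ _⟩⟩

/-- The pairings of a family of functions with the characters. -/
def coeffOf (φ : ℝ → Torus → ℂ) (t : ℝ) (m : ℤ × ℤ) : ℂ := ∫ x, φ t x * character m x ∂torusMeasure

instance : torusMeasure.IsAddLeftInvariant := by
  unfold torusMeasure; infer_instance

lemma integral_translate (f : Torus → ℂ) (m : ℤ × ℤ) (y : Torus) :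
    ∫ x, f (x + y) * character m x ∂torusMeasure =
      character m (-y) * ∫ x, f x * character m x ∂torusMeasure := by
  rw [← integral_const_mul, ← integral_add_right_eq_self (μ := torusMeasure)
    (fun x => character m (-y) * (f x * character m x)) y]
  refine integral_congr_ae (Filter.Eventually.of_forall fun x => ?_)
  have : character m x = character m (-y) * character m (x + y) := by
    have hx : x = -y + (x + y) := by abel
    conv_lhs => rw [hx]
    simp only [character, Prod.fst_add, Prod.snd_add, fourier_apply, smul_add,
      AddCircle.toCircle_add, Circle.coe_mul]
    ring
  simp only [this]; ring

/-- By translation invariance a shift of `φ` in `x` becomes a phase on its coefficient, so a single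
differentiation under the integral serves both time and space derivatives. -/
lemma SmoothFamily.hasDerivAt_integral {φ : ℝ → Torus → ℂ} (hφ : SmoothFamily φ)
    (v : ℝ × ℝ × ℝ) (t : ℝ) (m : ℤ × ℤ) :
    HasDerivAt (fun h : ℝ => character m (-toTorus (h • v.2)) * coeffOf φ (t + h * v.1) m)
      (coeffOf (HNLS.dirDeriv v φ) t m) 0 := by
  obtain ⟨K, hK⟩ := (hφ.dirDeriv v).exists_bound (t - |v.1|) (t + |v.1|)
  have hc : ∀ h : ℝ, Continuous fun x : Torus =>
      φ (t + h * v.1) (x + toTorus (h • v.2)) * character m x := fun h =>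
    ((hφ.continuous_apply _).comp (continuous_add_const _)).mul (continuous_character m)
  have h := hasDerivAt_integral_of_dominated_loc_of_deriv_le (μ := torusMeasure) (𝕜 := ℝ)
    (F := fun h x => φ (t + h * v.1) (x + toTorus (h • v.2)) * character m x)
    (F' := fun h x => HNLS.dirDeriv v φ (t + h * v.1) (x + toTorus (h • v.2)) * character m x)
    (x₀ := 0) (bound := fun _ => K) (Metric.ball_mem_nhds 0 one_pos)
    (Filter.Eventually.of_forall fun h => (hc h).aestronglyMeasurable)
    (integrable_of_continuous (hc 0))
    ((((hφ.dirDeriv v).continuous_apply _).comp (continuous_add_const _)).mul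
      (continuous_character m)).aestronglyMeasurable
    (Filter.Eventually.of_forall fun x h hh => by
      rw [norm_mul, norm_character, mul_one]
      refine hK _ ?_ _
      rw [Metric.mem_ball, dist_zero_right, Real.norm_eq_abs] at hh
      have h1 : |h * v.1| ≤ |v.1| := by
        rw [abs_mul]; exact mul_le_of_le_one_left (abs_nonneg _) hh.le
      rw [abs_le] at h1
      constructor <;> linarith)
    (integrable_const K)
    (Filter.Eventually.of_forall fun x h _ => (hφ.hasDerivAt v t x h).mul_const _)
  have h2 := h.2
  simp only [zero_mul, zero_smul, add_zero, toTorus_zero] at h2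
  refine h2.congr_of_eventuallyEq (Filter.Eventually.of_forall fun h => ?_)
  exact (integral_translate (φ (t + h * v.1)) m (toTorus (h • v.2))).symm

lemma character_toTorus (m : ℤ × ℤ) (v : ℝ × ℝ) :
    character m (toTorus v) = Complex.exp (((m.1 * v.1 + m.2 * v.2 : ℝ) : ℂ) * Complex.I) := by
  simp only [character, toTorus, fourier_coe_apply, ← Complex.exp_add]
  congr 1
  have : (Real.pi : ℂ) ≠ 0 := by exact_mod_cast Real.pi_ne_zero
  push_cast
  field_simp

lemma SmoothFamily.coeffOf_dirDeriv {φ : ℝ → Torus → ℂ} (hφ : SmoothFamily φ)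
    (w : ℝ × ℝ) (t : ℝ) (m : ℤ × ℤ) :
    coeffOf (HNLS.dirDeriv (0, w) φ) t m =
      -Complex.I * ((m.1 * w.1 + m.2 * w.2 : ℝ) : ℂ) * coeffOf φ t m := by
  have h1 := hφ.hasDerivAt_integral (0, w) t m
  simp only [mul_zero, add_zero] at h1
  have h2 : HasDerivAt (fun h : ℝ => character m (-toTorus (h • w)))
      (-Complex.I * ((m.1 * w.1 + m.2 * w.2 : ℝ) : ℂ)) 0 := by
    have e : ∀ h : ℝ, character m (-toTorus (h • w)) =
        Complex.exp ((h : ℂ) * (-Complex.I * ((m.1 * w.1 + m.2 * w.2 : ℝ) : ℂ))) := fun h => by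
      change character m (toTorus (-(h • w))) = _
      rw [character_toTorus]
      congr 1
      simp only [Prod.fst_neg, Prod.snd_neg, Prod.smul_fst, Prod.smul_snd, smul_eq_mul]
      push_cast; ring
    simp only [e]
    have h3 := ((Complex.ofRealCLM.hasDerivAt (x := (0 : ℝ))).mul_const
      (-Complex.I * ((m.1 * w.1 + m.2 * w.2 : ℝ) : ℂ))).cexp
    simpa using h3
  exact h1.unique (h2.mul_const _)

lemma SmoothFamily.hasDerivAt_coeffOf {φ : ℝ → Torus → ℂ} (hφ : SmoothFamily φ)
    (t : ℝ) (m : ℤ × ℤ) :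
    HasDerivAt (fun t => coeffOf φ t m) (coeffOf (HNLS.dirDeriv (1, 0) φ) t m) t := by
  have h1 := hφ.hasDerivAt_integral (1, 0) t m
  simp only [mul_one, smul_zero, toTorus_zero, neg_zero] at h1
  have h0 : character m 0 = 1 := by simp [character]
  simp only [h0, one_mul] at h1
  rw [← sub_self t] at h1
  refine (h1.comp_sub_const t t).congr_of_eventuallyEq (Filter.Eventually.of_forall fun t' => ?_)
  simp only [add_sub_cancel]

/-- The sup bounds of `φ`, `∂₁²φ`, `∂₂²φ` and `∂₂²∂₁²φ` together control the coefficient times `(1 +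
m₁²)(1 + m₂²)`, whose inverse is summable. -/
lemma SmoothFamily.exists_summable_bound {φ : ℝ → Torus → ℂ} (hφ : SmoothFamily φ) (a b : ℝ) :
    ∃ K : ℤ × ℤ → ℝ, Summable K ∧ ∀ t ∈ Set.Icc a b, ∀ m, ‖coeffOf φ t m‖ ≤ K m := by
  have hb : ∀ {ψ : ℝ → Torus → ℂ}, SmoothFamily ψ → ∃ K : ℝ, ∀ t ∈ Set.Icc a b, ∀ m,
      ‖coeffOf ψ t m‖ ≤ K := by
    intro ψ hψ
    obtain ⟨K, hK⟩ := hψ.exists_bound a b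
    refine ⟨K, fun t ht m => ?_⟩
    have := norm_integral_le_of_norm_le_const (μ := torusMeasure) (C := K)
      (f := fun x => ψ t x * character m x) (Filter.Eventually.of_forall fun x => by
        rw [norm_mul, norm_character, mul_one]; exact hK t ht x)
    simpa [coeffOf] using this
  have h1 := (hφ.dirDeriv (0, 1, 0)).dirDeriv (0, 1, 0)
  have h2 := (hφ.dirDeriv (0, 0, 1)).dirDeriv (0, 0, 1)
  have h3 := (h1.dirDeriv (0, 0, 1)).dirDeriv (0, 0, 1)
  obtain ⟨K0, hK0⟩ := hb hφ
  obtain ⟨K1, hK1⟩ := hb h1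
  obtain ⟨K2, hK2⟩ := hb h2
  obtain ⟨K3, hK3⟩ := hb h3
  have hs : Summable fun k : ℤ => (1 + (k : ℝ) ^ 2)⁻¹ := by
    refine Summable.of_norm_bounded_eventually (Real.summable_one_div_int_pow (p := 2).mpr one_lt_two)
      ((Set.finite_singleton (0 : ℤ)).subset fun k hk => ?_)
    by_contra hk0
    refine hk ?_
    have : 0 < (k : ℝ) ^ 2 := by
      have : (k : ℝ) ≠ 0 := by exact_mod_cast hk0
      positivity
    change ‖(1 + (k : ℝ) ^ 2)⁻¹‖ ≤ 1 / (k : ℝ) ^ 2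
    rw [Real.norm_of_nonneg (by positivity), ← one_div]
    gcongr
    linarith
  refine ⟨fun m => (K0 + K1 + K2 + K3) * ((1 + (m.1 : ℝ) ^ 2)⁻¹ * (1 + (m.2 : ℝ) ^ 2)⁻¹),
    (hs.mul_of_nonneg hs (fun k => by positivity) fun k => by positivity).mul_left _,
    fun t ht m => ?_⟩
  have e0 := hK0 t ht m
  have e1 := hK1 t ht m
  have e2 := hK2 t ht m
  have e3 := hK3 t ht m
  rw [(h1.dirDeriv (0, 0, 1)).coeffOf_dirDeriv, h1.coeffOf_dirDeriv,
    (hφ.dirDeriv (0, 1, 0)).coeffOf_dirDeriv, hφ.coeffOf_dirDeriv] at e3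
  rw [(hφ.dirDeriv (0, 1, 0)).coeffOf_dirDeriv, hφ.coeffOf_dirDeriv] at e1
  rw [(hφ.dirDeriv (0, 0, 1)).coeffOf_dirDeriv, hφ.coeffOf_dirDeriv] at e2
  simp only [norm_mul, norm_neg, Complex.norm_I, one_mul, Complex.norm_real, Real.norm_eq_abs,
    mul_one, mul_zero, add_zero, zero_add, ← mul_assoc, abs_mul_abs_self] at e1 e2 e3
  rw [mul_assoc _ |(m.1 : ℝ)| |(m.1 : ℝ)|, abs_mul_abs_self] at e3
  change _ ≤ (K0 + K1 + K2 + K3) * ((1 + (m.1 : ℝ) ^ 2)⁻¹ * (1 + (m.2 : ℝ) ^ 2)⁻¹)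
  rw [← mul_inv, ← div_eq_mul_inv, le_div_iff₀ (by positivity)]
  nlinarith

lemma SmoothFamily.box_eq {φ : ℝ → Torus → ℂ} (hφ : SmoothFamily φ) (t : ℝ) (x : Torus) :
    box (φ t) x = HNLS.dirDeriv (0, 1, 0) (HNLS.dirDeriv (0, 1, 0) φ) t x -
      HNLS.dirDeriv (0, 0, 1) (HNLS.dirDeriv (0, 0, 1) φ) t x := by
  have key : ∀ w : ℝ × ℝ, iteratedDeriv 2 (fun h : ℝ => φ t (x + toTorus (h • w))) 0 =
      HNLS.dirDeriv (0, w) (HNLS.dirDeriv (0, w) φ) t x := by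
    intro w
    rw [iteratedDeriv_succ, iteratedDeriv_one]
    have h1 : (deriv fun h : ℝ => φ t (x + toTorus (h • w))) =
        fun h : ℝ => HNLS.dirDeriv (0, w) φ t (x + toTorus (h • w)) := by
      funext h
      have := (hφ.hasDerivAt (0, w) t x h).deriv
      simpa only [mul_zero, add_zero] using this
    have h2 := ((hφ.dirDeriv (0, w)).hasDerivAt (0, w) t x 0).deriv
    simp only [mul_zero, add_zero, zero_smul, toTorus_zero] at h2
    rw [h1, h2]
  rw [← key, ← key]
  have e1 : ∀ h : ℝ, x + toTorus (h • (1, 0)) = (x.1 + (h : AddCircle (2 * Real.pi)), x.2) :=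
    fun h => by simp [toTorus, Prod.ext_iff]
  have e2 : ∀ h : ℝ, x + toTorus (h • (0, 1)) = (x.1, x.2 + (h : AddCircle (2 * Real.pi))) :=
    fun h => by simp [toTorus, Prod.ext_iff]
  simp only [e1, e2, box]

lemma SmoothFamily.deriv_eq {φ : ℝ → Torus → ℂ} (hφ : SmoothFamily φ) (t : ℝ) (x : Torus) :
    deriv (fun τ => φ τ x) t = HNLS.dirDeriv (1, 0) φ t x := by
  have h1 := (hφ.hasDerivAt (1, 0) t x 0).deriv
  simp only [mul_one, smul_zero, toTorus_zero, add_zero] at h1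
  rw [← h1, deriv_comp_const_add (fun τ => φ τ x) t 0, add_zero]

lemma hform_self (n : ℤ × ℤ) : ((hform n n : ℤ) : ℂ) = (n.1 : ℂ) ^ 2 - (n.2 : ℂ) ^ 2 := by
  simp only [hform]; push_cast; ring

/-- The linear part of the equation applied to a test function. -/
def adjointOp (φ : ℝ → Torus → ℂ) (t : ℝ) (x : Torus) : ℂ :=
  -Complex.I * deriv (fun τ => φ τ x) t + box (φ t) x

lemma SmoothFamily.adjointOp {φ : ℝ → Torus → ℂ} (hφ : SmoothFamily φ) :
    SmoothFamily (adjointOp φ) := by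
  have h : lift (HNLS.adjointOp φ) = fun z => -Complex.I * lift (HNLS.dirDeriv (1, 0) φ) z +
      (lift (HNLS.dirDeriv (0, 1, 0) (HNLS.dirDeriv (0, 1, 0) φ)) z -
      lift (HNLS.dirDeriv (0, 0, 1) (HNLS.dirDeriv (0, 0, 1) φ)) z) := by
    funext z
    simp only [lift, HNLS.adjointOp, hφ.deriv_eq, hφ.box_eq]
  rw [SmoothFamily, h]
  exact (contDiff_const.mul (hφ.dirDeriv _)).add
    (((hφ.dirDeriv _).dirDeriv _).sub ((hφ.dirDeriv _).dirDeriv _))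

lemma SmoothFamily.coeffOf_adjointOp {φ : ℝ → Torus → ℂ} (hφ : SmoothFamily φ) (t : ℝ)
    (m : ℤ × ℤ) : coeffOf (HNLS.adjointOp φ) t m =
      -Complex.I * coeffOf (HNLS.dirDeriv (1, 0) φ) t m - (hform m m : ℤ) * coeffOf φ t m := by
  have hi : ∀ {ψ : ℝ → Torus → ℂ}, SmoothFamily ψ →
      Integrable (fun x => ψ t x * character m x) torusMeasure := fun hψ =>
    integrable_of_continuous ((hψ.continuous_apply t).mul (continuous_character m))
  have h0 := hφ.dirDeriv (1, 0)
  have h1 := (hφ.dirDeriv (0, 1, 0)).dirDeriv (0, 1, 0)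
  have h2 := (hφ.dirDeriv (0, 0, 1)).dirDeriv (0, 0, 1)
  have e : coeffOf (HNLS.adjointOp φ) t m = -Complex.I * coeffOf (HNLS.dirDeriv (1, 0) φ) t m +
      (coeffOf (HNLS.dirDeriv (0, 1, 0) (HNLS.dirDeriv (0, 1, 0) φ)) t m -
      coeffOf (HNLS.dirDeriv (0, 0, 1) (HNLS.dirDeriv (0, 0, 1) φ)) t m) := by
    unfold coeffOf
    rw [← integral_const_mul, ← integral_sub (hi h1) (hi h2)]
    refine Eq.trans ?_ (integral_add ((hi h0).const_mul _) ((hi h1).sub (hi h2)))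
    refine integral_congr_ae (Filter.Eventually.of_forall fun x => ?_)
    simp only [HNLS.adjointOp, hφ.deriv_eq, hφ.box_eq]
    ring
  rw [e, (hφ.dirDeriv (0, 1, 0)).coeffOf_dirDeriv, hφ.coeffOf_dirDeriv,
    (hφ.dirDeriv (0, 0, 1)).coeffOf_dirDeriv, hφ.coeffOf_dirDeriv, hform_self]
  push_cast
  linear_combination (coeffOf φ t m * ((m.1 : ℂ) ^ 2 - (m.2 : ℂ) ^ 2)) * Complex.I_sq

/-- Parseval's identity for a continuous function with summable Fourier coefficients. -/
lemma hasSum_integral_mul_of_summable {f : Torus → ℂ} (hf : Integrable f torusMeasure)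
    {g : Torus → ℂ} (hg : Continuous g)
    (hs : Summable fun m => ‖∫ x, g x * character m x ∂torusMeasure‖) :
    HasSum (fun m => (∫ x, g x * character m x ∂torusMeasure) *
      ∫ x, f x * character (-m) x ∂torusMeasure) (∫ x, f x * g x ∂torusMeasure) := by
  set c : ℤ × ℤ → ℂ := fun m => ∫ x, g x * character m x ∂torusMeasure with hc
  have hsum : Summable fun m => c m • chi (-m) := by
    refine Summable.of_norm_bounded hs fun m => ?_
    rw [norm_smul]
    refine mul_le_of_le_one_right (norm_nonneg _) ?_
    exact (ContinuousMap.norm_le _ zero_le_one).mpr fun x => (norm_character _ x).le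
  obtain ⟨G, hG⟩ := hsum
  have hpair : ∀ {k : Torus → ℂ} (hk : Integrable k torusMeasure),
      HasSum (fun m => c m * ∫ x, k x * character (-m) x ∂torusMeasure)
        (∫ x, k x * G x ∂torusMeasure) := fun {k} hk => by
    refine ((pairing k hk).hasSum hG).congr_fun fun m => ?_
    rw [map_smul, smul_eq_mul]; rfl
  -- The absolutely convergent series `G` has the same pairings with characters as `g`, so the two
  -- agree almost everywhere.
  have hGg : ∀ᵐ x ∂torusMeasure, G x = g x := by
    have hd := ae_eq_zero_of_pairing (f := fun x => G x - g x)
      (integrable_of_continuous (G.continuous.sub hg)) fun n => by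
        simp only [sub_mul]
        refine (integral_sub (integrable_of_continuous (G.continuous.mul (continuous_character n)))
          (integrable_of_continuous (hg.mul (continuous_character n)))).trans (sub_eq_zero.mpr ?_)
        have h1 := hpair (integrable_of_continuous (continuous_character n))
        have h2 : HasSum (fun m => c m * ∫ x, character n x * character (-m) x ∂torusMeasure)
            (c n) := by
          have e : ∀ m, c m * ∫ x, character n x * character (-m) x ∂torusMeasure =
              if m = n then c n else 0 := by
            intro m
            simp only [← character_add, integral_character, ← sub_eq_add_neg, sub_eq_zero]
            rcases eq_or_ne m n with rfl | h
            · simp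
            · simp [h, h.symm]
          simp only [e]
          exact hasSum_ite_eq n (c n)
        have h3 := h1.unique h2
        simp only [mul_comm (character n _)] at h3
        exact h3
    filter_upwards [hd] with x hx
    exact sub_eq_zero.mp hx
  have hfg : ∫ x, f x * g x ∂torusMeasure = ∫ x, f x * G x ∂torusMeasure :=
    integral_congr_ae (by filter_upwards [hGg] with x hx; rw [hx])
  rw [hfg]
  exact hpair hf

/-! ### Distributional solutions -/

lemma continuousInFL_iff {s p T : ℝ} {u : ℝ → L1} :
    ContinuousInFL s p T u ↔ ContX s p 0 T fun t => fourierCoefficient (u t) := by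
  simp only [ContinuousInFL, ContX, MemFL, flNorm, weightedNorm_eq_cnorm, fourierCoefficient_sub,
    lt_top_iff_ne_top]

lemma norm_le_toReal_of_enorm_le {z : ℂ} {K : ℝ≥0∞} (hK : K ≠ ⊤) (h : ‖z‖ₑ ≤ K) :
    ‖z‖ ≤ K.toReal := by
  rw [← toReal_enorm]
  exact ENNReal.toReal_mono hK h

lemma ContX.continuousOn_apply {s p t₀ t₁ r : ℝ} {C : ℝ≥0∞} (H : TrilinearBounds s p r C)
    {b : ℝ → ℤ × ℤ → ℂ} (hb : ContX s p t₀ t₁ b) (n : ℤ × ℤ) :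
    ContinuousOn (fun t => b t n) (Set.Icc t₀ t₁) := by
  intro t ht
  have h1 : Filter.Tendsto (fun t' => C * cnorm s p (b t' - b t))
      (nhdsWithin t (Set.Icc t₀ t₁)) (nhds 0) := by
    simpa using ENNReal.Tendsto.const_mul (a := C) (hb.2 t ht) (Or.inr H.ne_top)
  have h2 : Filter.Tendsto (fun t' => b t' n - b t n) (nhdsWithin t (Set.Icc t₀ t₁)) (nhds 0) := by
    rw [tendsto_zero_iff_enorm_tendsto_zero]
    refine tendsto_of_tendsto_of_tendsto_of_le_of_le tendsto_const_nhds h1 (fun _ => zero_le)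
      fun t' => ?_
    exact (le_lnorm H.exponent_pos (fun n => ‖(b t' - b t) n‖ₑ) n).trans (H.embed _)
  have h3 := h2.add_const (b t n)
  simp only [sub_add_cancel, zero_add] at h3
  exact h3

namespace TrilinearBounds

variable {s p r : ℝ} {C : ℝ≥0∞}

/-- Deduced from the continuity of `nonlin`: the gauge at `θ = 0` inserts the phases, its conjugate
removes them, and the resonant part is added back. -/
lemma continuousOn_cubicSum (H : TrilinearBounds s p r C) {T : ℝ} {a : ℝ → ℤ × ℤ → ℂ}
    (ha : ContX s p 0 T a) (n : ℤ × ℤ) :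
    ContinuousOn (fun t => cubicSum (a t) n) (Set.Icc 0 T) := by
  have hg : ∀ m : ℤ × ℤ, Continuous fun t => gauge m t 0 := fun m => by
    unfold gauge; fun_prop
  have hb := ha.mul_unimodular H.one_lt.le (e := fun t m => gauge m t 0)
    (fun t m => enorm_gauge _ _ _) fun m => (hg m).continuousOn
  have h1 := H.continuousOn_nonlin hb n
  simp only [nonlin_gauge] at h1
  have h2 : ContinuousOn (fun t => gaugedSum (a t) n) (Set.Icc 0 T) := by
    refine ((Complex.continuous_conj.comp (hg n)).continuousOn.mul h1).congr fun t _ => ?_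
    change _ = star (gauge n t 0) * _
    rw [← mul_assoc, star_gauge_mul, one_mul]
  have h3 : ContinuousOn (fun t => -Complex.I * (2 * Complex.I * mass (a t) * a t n +
      gaugedSum (a t) n)) (Set.Icc 0 T) :=
    continuousOn_const.mul (((continuousOn_const.mul
      (Complex.continuous_ofReal.comp_continuousOn (H.continuousOn_mass ha))).mul
      (ha.continuousOn_apply H n)).add h2)
  refine h3.congr fun t ht => ?_
  simp only
  rw [← H.cubicSum_eq (ha.1 t ht), ← mul_assoc, neg_mul, Complex.I_mul_I, neg_neg, one_mul]

lemma exists_norm_bound (H : TrilinearBounds s p r C) {T : ℝ} {a : ℝ → ℤ × ℤ → ℂ}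
    (ha : ContX s p 0 T a) : ∃ R : ℝ, ∀ t ∈ Set.Icc 0 T, ∀ n,
      ‖a t n‖ ≤ R ∧ ‖cubicSum (a t) n‖ ≤ R := by
  obtain ⟨R, hR, h⟩ := ha.exists_bound H.one_lt.le
  have hC := H.ne_top
  refine ⟨max (C * R).toReal (C * R ^ 3).toReal, fun t ht n => ⟨?_, ?_⟩⟩
  · refine le_trans (norm_le_toReal_of_enorm_le (by finiteness) ?_) (le_max_left _ _)
    calc _ ≤ C * cnorm s p (a t) :=
          (le_lnorm H.exponent_pos (fun n => ‖a t n‖ₑ) n).trans (H.embed _)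
      _ ≤ _ := by gcongr; exact h t ht
  · refine le_trans (norm_le_toReal_of_enorm_le (by finiteness) ?_) (le_max_right _ _)
    refine (H.enorm_cubicSum_le _ _).trans ?_
    gcongr
    exact h t ht

lemma integral_inner_eq (H : TrilinearBounds s p r C) {f : L1}
    (hf : cnorm s p (fourierCoefficient f) ≠ ⊤) {ψ g : Torus → ℂ} (hψ : Continuous ψ)
    (hg : Continuous g) :
    ∫ x, (f x * ψ x + (‖f x‖ : ℂ) ^ 2 * f x * g x) ∂torusMeasure =
      ∫ x, f x * ψ x ∂torusMeasure + ∫ x, (‖f x‖ : ℂ) ^ 2 * f x * g x ∂torusMeasure :=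
  integral_add (integrable_mul_continuous (L1.integrable_coeFn f) ⟨ψ, hψ⟩)
    (integrable_mul_continuous (H.integrable_cubic hf) ⟨g, hg⟩)

lemma hasSum_inner (H : TrilinearBounds s p r C) {f : L1}
    (hf : cnorm s p (fourierCoefficient f) ≠ ⊤) {φ : ℝ → Torus → ℂ} (hs : SmoothFamily φ) (t : ℝ) :
    HasSum (fun m => coeffOf (adjointOp φ) t m * fourierCoefficient f m +
      coeffOf φ t m * cubicSum (fourierCoefficient f) m) (∫ x, (f x *
      (-Complex.I * deriv (fun τ => φ τ x) t + box (φ t) x) +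
      (‖f x‖ : ℂ) ^ 2 * f x * φ t x) ∂torusMeasure) := by
  obtain ⟨K, hKs, hK⟩ := hs.exists_summable_bound t t
  obtain ⟨K', hK's, hK'⟩ := hs.adjointOp.exists_summable_bound t t
  have ht : t ∈ Set.Icc t t := ⟨le_rfl, le_rfl⟩
  have hi := H.integral_inner_eq hf (hs.adjointOp.continuous_apply t) (hs.continuous_apply t)
  unfold adjointOp at hi
  rw [hi]
  refine ((hasSum_integral_mul_of_summable (L1.integrable_coeFn f)
    (hs.adjointOp.continuous_apply t)
    (hK's.of_nonneg_of_le (fun _ => norm_nonneg _) (hK' t ht))).add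
    (hasSum_integral_mul_of_summable (H.integrable_cubic hf) (hs.continuous_apply t)
      (hKs.of_nonneg_of_le (fun _ => norm_nonneg _) (hK t ht)))).congr_fun fun m => ?_
  simp only [H.integral_cubic hf]
  rfl

/-- Mode by mode, the integrand is the time derivative of `-i` times the product of the coefficients
of `φ` and `u`, which vanishes at both ends. The summable bounds on the coefficients of `φ` justify
exchanging the sum with the time integral. -/
lemma solvesHNLS_of_isFourierSolution (H : TrilinearBounds s p r C) {T : ℝ} (hT : 0 ≤ T)
    {u : ℝ → L1} (hu : IsFourierSolution s p T fun t => fourierCoefficient (u t)) :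
    SolvesHNLS T u := by
  intro φ hφ
  have hs : SmoothFamily φ := hφ.smooth
  obtain ⟨α, β, hα, hβ, hsupp⟩ := hφ.support
  set a : ℝ → ℤ × ℤ → ℂ := fun t => fourierCoefficient (u t) with ha
  obtain ⟨R, hR⟩ := H.exists_norm_bound hu.cont
  obtain ⟨K, hKs, hK⟩ := hs.exists_summable_bound 0 T
  obtain ⟨K', hK's, hK'⟩ := hs.adjointOp.exists_summable_bound 0 T
  set h : ℤ × ℤ → ℝ → ℂ := fun m t => coeffOf (adjointOp φ) t m * a t m +
    coeffOf φ t m * cubicSum (a t) m with hh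
  have hsum : ∀ t ∈ Set.Icc 0 T, HasSum (fun m => h m t) (∫ x, (u t x *
      (-Complex.I * deriv (fun τ => φ τ x) t + box (φ t) x) +
      (‖u t x‖ : ℂ) ^ 2 * u t x * φ t x) ∂torusMeasure) := fun t ht =>
    H.hasSum_inner (hu.cont.1 t ht) hs t
  have hcoeff : ∀ {ψ : ℝ → Torus → ℂ}, SmoothFamily ψ → ∀ m,
      ContinuousOn (fun t => coeffOf ψ t m) (Set.Icc 0 T) := fun hψ m t _ =>
    (hψ.hasDerivAt_coeffOf t m).continuousAt.continuousWithinAt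
  have hcont : ∀ m, ContinuousOn (h m) (Set.Icc 0 T) := fun m =>
    ((hcoeff hs.adjointOp m).mul (hu.cont.continuousOn_apply H m)).add
      ((hcoeff hs m).mul (H.continuousOn_cubicSum hu.cont m))
  have hzero : ∀ t, t ∉ Set.Icc α β → ∀ m, coeffOf φ t m = 0 := fun t ht m => by
    simp [coeffOf, hsupp t ht]
  have hint : ∀ m, ∫ t in (0 : ℝ)..T, h m t = 0 := by
    intro m
    have hF := (integral_eq_iff_hasDerivWithinAt (f := fun t => -Complex.I * (coeffOf φ t m * a t m))
      (hcont m)).mpr (fun t ht => by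
        refine (((hs.hasDerivAt_coeffOf t m).hasDerivWithinAt.mul (hu.deriv t ht m)).const_mul
          (-Complex.I)).congr_deriv ?_
        simp only [hh, hs.coeffOf_adjointOp]
        linear_combination (coeffOf φ t m * ((hform m m : ℤ) * a t m - cubicSum (a t) m)) *
          Complex.I_sq) T ⟨hT, le_rfl⟩
    simpa [hzero T (fun h => absurd h.2 (not_le.mpr hβ)),
      hzero 0 (fun h => absurd h.1 (not_le.mpr hα))] using hF.symm
  have hswap := intervalIntegral.hasSum_integral_of_dominated_convergence (μ := volume)
    (a := 0) (b := T) (F := h) (fun m _ => (K' m + K m) * R)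
    (fun m => by
      rw [Set.uIoc_of_le hT]
      exact ((hcont m).mono Set.Ioc_subset_Icc_self).aestronglyMeasurable measurableSet_Ioc)
    (fun m => Filter.Eventually.of_forall fun t ht => by
      rw [Set.uIoc_of_le hT] at ht
      have ht' := Set.Ioc_subset_Icc_self ht
      obtain ⟨h1, h2⟩ := hR t ht' m
      have hR0 := (norm_nonneg _).trans h1
      refine (norm_add_le _ _).trans ?_
      rw [norm_mul, norm_mul, add_mul]
      exact add_le_add
        (mul_le_mul (hK' t ht' m) h1 (norm_nonneg _) ((norm_nonneg _).trans (hK' t ht' m)))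
        (mul_le_mul (hK t ht' m) h2 (norm_nonneg _) ((norm_nonneg _).trans (hK t ht' m))))
    (Filter.Eventually.of_forall fun t _ => (hK's.add hKs).mul_right R)
    intervalIntegrable_const
    (Filter.Eventually.of_forall fun t ht => by
      rw [Set.uIoc_of_le hT] at ht
      exact hsum t (Set.Ioc_subset_Icc_self ht))
  simp only [hint] at hswap
  exact hswap.unique hasSum_zero

end TrilinearBounds

/-! ### Test functions in time and the fundamental lemma of the calculus of variations -/

/-- Real test functions on `(0, T)`. -/
structure IsTimeTest (T : ℝ) (χ : ℝ → ℝ) : Prop where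
  smooth : ContDiff ℝ ((⊤ : ℕ∞) : WithTop ℕ∞) χ
  support : ∃ a b : ℝ, 0 < a ∧ b < T ∧ ∀ t, t ∉ Set.Icc a b → χ t = 0

lemma IsTimeTest.continuous {T : ℝ} {χ : ℝ → ℝ} (hχ : IsTimeTest T χ) : Continuous χ :=
  hχ.smooth.continuous

lemma IsTimeTest.continuous_deriv {T : ℝ} {χ : ℝ → ℝ} (hχ : IsTimeTest T χ) :
    Continuous (deriv χ) := hχ.smooth.continuous_deriv (by simp)

lemma IsTimeTest.hasDerivAt {T : ℝ} {χ : ℝ → ℝ} (hχ : IsTimeTest T χ) (t : ℝ) :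
    HasDerivAt χ (deriv χ t) t := (hχ.smooth.differentiable (by simp) t).hasDerivAt

lemma IsTimeTest.apply_zero {T : ℝ} {χ : ℝ → ℝ} (hχ : IsTimeTest T χ) : χ 0 = 0 := by
  obtain ⟨a, b, ha, hb, h⟩ := hχ.support
  exact h 0 fun h0 => absurd h0.1 (not_le.mpr ha)

lemma IsTimeTest.apply_right {T : ℝ} {χ : ℝ → ℝ} (hχ : IsTimeTest T χ) : χ T = 0 := by
  obtain ⟨a, b, ha, hb, h⟩ := hχ.support
  exact h T fun h0 => absurd h0.2 (not_le.mpr hb)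

lemma isTimeTest_primitive {T a b : ℝ} (ha : 0 < a) (hb : b < T) {ψ : ℝ → ℝ}
    (hψ : ContDiff ℝ ((⊤ : ℕ∞) : WithTop ℕ∞) ψ) (hsupp : ∀ t, t ∉ Set.Icc a b → ψ t = 0)
    (hint : ∫ t, ψ t = 0) :
    IsTimeTest T (fun t => ∫ x in (0 : ℝ)..t, ψ x) ∧
      deriv (fun t => ∫ x in (0 : ℝ)..t, ψ x) = ψ := by
  have hd : ∀ t, HasDerivAt (fun t => ∫ x in (0 : ℝ)..t, ψ x) (ψ t) t := fun t =>
    intervalIntegral.integral_hasDerivAt_right (hψ.continuous.intervalIntegrable _ _)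
      hψ.continuous.stronglyMeasurable.stronglyMeasurableAtFilter hψ.continuous.continuousAt
  have hd' : deriv (fun t => ∫ x in (0 : ℝ)..t, ψ x) = ψ := funext fun t => (hd t).deriv
  refine ⟨⟨?_, a, b, ha, hb, fun t ht => ?_⟩, hd'⟩
  · rw [contDiff_infty_iff_deriv, hd']
    exact ⟨fun t => (hd t).differentiableAt, hψ⟩
  · rcases lt_or_ge t a with hta | hta
    · refine (intervalIntegral.integral_congr (g := fun _ => (0 : ℝ)) fun x hx => ?_).trans (by simp)
      refine hsupp x fun h => ?_
      rcases Set.mem_uIcc.mp hx with hx | hx <;> linarith [h.1, hx.2]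
    · have htb : b < t := not_le.mp fun h => ht ⟨hta, h⟩
      rw [intervalIntegral.integral_eq_integral_of_support_subset, hint]
      intro x hx
      have : x ∈ Set.Icc a b := by_contra fun h => hx (hsupp x h)
      exact ⟨ha.trans_le this.1, this.2.trans htb.le⟩

/-- The du Bois-Reymond lemma. For a test function `g`, the function `g - (∫ g) η` has integral zero
and so is the derivative of a test function; hence `G` pairs with `g` like the constant `k`. -/
lemma eq_of_integral_deriv_mul_eq_zero {T : ℝ} (hT : 0 < T) {G : ℝ → ℂ}
    (hG : ContinuousOn G (Set.Icc 0 T))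
    (h : ∀ χ, IsTimeTest T χ → ∫ t in (0 : ℝ)..T, ((deriv χ t : ℝ) : ℂ) * G t = 0) :
    ∀ t ∈ Set.Icc 0 T, G t = G 0 := by
  let bump : ContDiffBump (T / 2) := ⟨T / 8, T / 4, by linarith, by linarith⟩
  set η : ℝ → ℝ := bump.normed volume with hη
  have hη1 : ∫ t, η t = 1 := bump.integral_normed
  have hηs : ∀ t, t ∉ Set.Icc (T / 4) (3 * T / 4) → η t = 0 := by
    intro t ht
    by_contra h0
    have h1 : t ∈ Function.support η := h0
    rw [hη, bump.support_normed_eq, Metric.mem_ball, Real.dist_eq, abs_lt] at h1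
    have h2 : bump.rOut = T / 4 := rfl
    rw [h2] at h1
    exact ht ⟨by linarith [h1.1], by linarith [h1.2]⟩
  have hηc : ContDiff ℝ ((⊤ : ℕ∞) : WithTop ℕ∞) η := bump.contDiff_normed
  have hmulint : ∀ {ψ : ℝ → ℝ}, Continuous ψ →
      IntervalIntegrable (fun t => (ψ t : ℂ) * G t) volume 0 T := fun hψ =>
    ((Complex.continuous_ofReal.comp hψ).continuousOn.mul
      (by rwa [Set.uIcc_of_le hT.le])).intervalIntegrable
  set k : ℂ := ∫ t in (0 : ℝ)..T, (η t : ℂ) * G t with hk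
  have hae : ∀ᵐ t, t ∈ Set.Ioo 0 T → G t - k = 0 := by
    refine isOpen_Ioo.ae_eq_zero_of_integral_contDiff_smul_eq_zero
      (((hG.mono Set.Ioo_subset_Icc_self).sub continuousOn_const).locallyIntegrableOn
        measurableSet_Ioo) fun g hg hgc hgs => ?_
    obtain ⟨a, b, ha, hb, hab⟩ : ∃ a b : ℝ, 0 < a ∧ b < T ∧ ∀ t, t ∉ Set.Icc a b → g t = 0 := by
      rcases (tsupport g).eq_empty_or_nonempty with he | hne
      · exact ⟨T / 2, T / 2, by linarith, by linarith, fun t _ => by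
          rw [tsupport_eq_empty_iff.mp he]; rfl⟩
      · obtain ⟨a, ha⟩ := hgc.isCompact.exists_isLeast hne
        obtain ⟨b, hb⟩ := hgc.isCompact.exists_isGreatest hne
        exact ⟨a, b, (hgs ha.1).1, (hgs hb.1).2, fun t ht => by_contra fun h0 =>
          ht ⟨ha.2 (subset_tsupport g h0), hb.2 (subset_tsupport g h0)⟩⟩
    set c : ℝ := ∫ t, g t with hc
    obtain ⟨h1, h2⟩ := isTimeTest_primitive (T := T) (a := min a (T / 4)) (b := max b (3 * T / 4))
      (ψ := fun t => g t - c * η t) (lt_min ha (by linarith)) (max_lt hb (by linarith))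
      (hg.sub (contDiff_const.mul hηc))
      (fun t ht => by
        rw [hab t fun h0 => ht ⟨(min_le_left _ _).trans h0.1, h0.2.trans (le_max_left _ _)⟩,
          hηs t fun h0 => ht ⟨(min_le_right _ _).trans h0.1, h0.2.trans (le_max_right _ _)⟩]
        ring)
      (by
        rw [integral_sub (hg.continuous.integrable_of_hasCompactSupport hgc)
          (bump.integrable_normed.const_mul c), integral_const_mul, hη1, mul_one, sub_self])
    have h3 := h _ h1
    rw [h2] at h3
    have h4 : ∫ t in (0 : ℝ)..T, (g t : ℂ) * G t = c * k := by
      rw [hk, ← intervalIntegral.integral_const_mul, ← sub_eq_zero,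
        ← intervalIntegral.integral_sub (hmulint hg.continuous)
          ((hmulint hηc.continuous).const_mul _), ← h3]
      refine intervalIntegral.integral_congr fun t _ => ?_
      simp only; push_cast; ring
    have hsub : ∀ {F : ℝ → ℂ}, Function.support (fun t => (g t : ℂ) * F t) ⊆ Set.Ioc 0 T := by
      intro F t ht
      have hgt : t ∈ Set.Icc a b := by_contra fun h0 => ht (by simp [hab t h0])
      exact ⟨ha.trans_le hgt.1, hgt.2.trans hb.le⟩
    simp only [Complex.real_smul]
    rw [← intervalIntegral.integral_eq_integral_of_support_subset (hsub (F := fun t => G t - k))]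
    simp only [mul_sub]
    have hgk : IntervalIntegrable (fun t => (g t : ℂ) * k) volume 0 T :=
      ((Complex.continuous_ofReal.comp hg.continuous).mul continuous_const).intervalIntegrable _ _
    rw [intervalIntegral.integral_sub (hmulint hg.continuous) hgk, h4,
      intervalIntegral.integral_eq_integral_of_support_subset (hsub (F := fun _ => k)),
      integral_mul_const, integral_complex_ofReal, ← hc, sub_self]
  have heq : Set.EqOn G (fun _ => k) (Set.Icc 0 T) := by
    refine Measure.eqOn_Icc_of_ae_eq volume hT.ne ?_ hG continuousOn_const
    rw [← restrict_Ioo_eq_restrict_Icc]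
    refine (ae_restrict_iff' measurableSet_Ioo).mpr ?_
    filter_upwards [hae] with t ht hmem
    exact sub_eq_zero.mp (ht hmem)
  intro t ht
  rw [heq ht, heq ⟨le_rfl, hT.le⟩]

/-- Subtracting a primitive of `B` from `A` leaves a continuous function with zero weak derivative,
hence a constant. -/
lemma hasDerivWithinAt_of_weak {T : ℝ} (hT : 0 < T) {A B : ℝ → ℂ}
    (hA : ContinuousOn A (Set.Icc 0 T)) (hB : ContinuousOn B (Set.Icc 0 T))
    (h : ∀ χ, IsTimeTest T χ → ∫ t in (0 : ℝ)..T, (((deriv χ t : ℝ) : ℂ) * A t + χ t * B t) = 0) :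
    ∀ t ∈ Set.Icc 0 T, HasDerivWithinAt A (B t) (Set.Icc 0 T) t := by
  rw [← integral_eq_iff_hasDerivWithinAt hB]
  set P : ℝ → ℂ := fun t => ∫ x in (0 : ℝ)..t, B x with hP
  have hPd : ∀ t ∈ Set.Icc 0 T, HasDerivWithinAt P (B t) (Set.Icc 0 T) t :=
    (integral_eq_iff_hasDerivWithinAt hB).mp fun t _ => by simp [hP]
  have hPc : ContinuousOn P (Set.Icc 0 T) := fun t ht => (hPd t ht).continuousWithinAt
  have hu : Set.uIcc 0 T = Set.Icc 0 T := Set.uIcc_of_le hT.le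
  have hG := eq_of_integral_deriv_mul_eq_zero hT (hA.sub hPc) fun χ hχ => by
    have hχc : Continuous fun t => (χ t : ℂ) := Complex.continuous_ofReal.comp hχ.continuous
    have hχd : Continuous fun t => ((deriv χ t : ℝ) : ℂ) :=
      Complex.continuous_ofReal.comp hχ.continuous_deriv
    have h1 := (integral_eq_iff_hasDerivWithinAt (f := fun t => (χ t : ℂ) * P t)
      (g := fun t => ((deriv χ t : ℝ) : ℂ) * P t + χ t * B t)
      ((hχd.continuousOn.mul hPc).add (hχc.continuousOn.mul hB))).mpr
      (fun t ht => (hχ.hasDerivAt t).ofReal_comp.hasDerivWithinAt.mul (hPd t ht)) T ⟨hT.le, le_rfl⟩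
    simp only [hχ.apply_zero, hχ.apply_right, Complex.ofReal_zero, zero_mul, zero_add] at h1
    have h2 := h χ hχ
    rw [← sub_zero (∫ t in (0 : ℝ)..T, _), h1] at h2
    rw [← intervalIntegral.integral_sub] at h2
    · rw [← h1] at h2
      rw [← h2]
      refine intervalIntegral.integral_congr fun t _ => ?_
      simp only [Pi.sub_apply]; ring
    · exact ContinuousOn.intervalIntegrable (by
        rw [hu]; exact (hχd.continuousOn.mul hA).add (hχc.continuousOn.mul hB))
    · exact ContinuousOn.intervalIntegrable (by
        rw [hu]; exact (hχd.continuousOn.mul hPc).add (hχc.continuousOn.mul hB))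
  intro t ht
  have := hG t ht
  simp only [Pi.sub_apply, hP, intervalIntegral.integral_same, sub_zero] at this
  rw [← this, sub_add_cancel]

/-- The test function `χ(t) e^{-i n·x}`. -/
def waveTest (χ : ℝ → ℝ) (n : ℤ × ℤ) (t : ℝ) (x : Torus) : ℂ := χ t * character (-n) x

lemma IsTimeTest.isTestFunction {T : ℝ} {χ : ℝ → ℝ} (hχ : IsTimeTest T χ) (n : ℤ × ℤ) :
    IsTestFunction T (waveTest χ n) := by
  refine ⟨?_, ?_⟩
  · change ContDiff ℝ _ fun z : ℝ × ℝ × ℝ => (χ z.1 : ℂ) * character (-n) (toTorus z.2)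
    simp only [character_toTorus]
    have h1 : ContDiff ℝ ((⊤ : ℕ∞) : WithTop ℕ∞) fun z : ℝ × ℝ × ℝ => (χ z.1 : ℂ) :=
      Complex.ofRealCLM.contDiff.comp (hχ.smooth.comp contDiff_fst)
    have h2 : ContDiff ℝ ((⊤ : ℕ∞) : WithTop ℕ∞) fun z : ℝ × ℝ × ℝ =>
        (((((-n).1 : ℤ) * z.2.1 + ((-n).2 : ℤ) * z.2.2 : ℝ)) : ℂ) :=
      Complex.ofRealCLM.contDiff.comp ((contDiff_const.mul (contDiff_fst.comp contDiff_snd)).add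
        (contDiff_const.mul (contDiff_snd.comp contDiff_snd)))
    exact h1.mul (h2.mul contDiff_const).cexp
  · obtain ⟨a, b, ha, hb, h⟩ := hχ.support
    exact ⟨a, b, ha, hb, fun t ht x => by simp [waveTest, h t ht]⟩

lemma coeffOf_waveTest (χ : ℝ → ℝ) (n : ℤ × ℤ) (t : ℝ) (m : ℤ × ℤ) :
    coeffOf (waveTest χ n) t m = if m = n then (χ t : ℂ) else 0 := by
  simp only [coeffOf, waveTest, mul_assoc, integral_const_mul, ← character_add, integral_character,
    neg_add_eq_sub, sub_eq_zero]
  simp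

namespace TrilinearBounds

variable {s p r : ℝ} {C : ℝ≥0∞}

/-- Testing with `χ(t) e^{-i n·x}` isolates one mode and gives a weak differential equation in time;
its terms are continuous, so it holds classically. -/
lemma isFourierSolution_of_solvesHNLS (H : TrilinearBounds s p r C) {T : ℝ} (hT : 0 < T)
    {u : ℝ → L1} (hc : ContinuousInFL s p T u) (hu : SolvesHNLS T u) :
    IsFourierSolution s p T fun t => fourierCoefficient (u t) := by
  rw [continuousInFL_iff] at hc
  refine ⟨hc, fun t ht n => ?_⟩
  have hA := hc.continuousOn_apply H n
  refine hasDerivWithinAt_of_weak hT hA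
    ((continuousOn_const.mul hA).add (continuousOn_const.mul (H.continuousOn_cubicSum hc n)))
    (fun χ hχ => ?_) t ht
  have hφ := hχ.isTestFunction n
  have hs : SmoothFamily (waveTest χ n) := hφ.smooth
  have hdt : ∀ t m, coeffOf (dirDeriv (1, 0) (waveTest χ n)) t m =
      if m = n then ((deriv χ t : ℝ) : ℂ) else 0 := by
    intro t m
    refine (hs.hasDerivAt_coeffOf t m).unique ?_
    simp only [coeffOf_waveTest]
    by_cases h : m = n
    · simpa only [h, if_true] using (hχ.hasDerivAt t).ofReal_comp
    · simpa only [h, if_false] using hasDerivAt_const t (0 : ℂ)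
  have h0 := hu _ hφ
  have hinner : Set.EqOn (fun t => ∫ x, (u t x *
      (-Complex.I * deriv (fun τ => waveTest χ n τ x) t + box (waveTest χ n t) x) +
      (‖u t x‖ : ℂ) ^ 2 * u t x * waveTest χ n t x) ∂torusMeasure)
      (fun t => -Complex.I * (((deriv χ t : ℝ) : ℂ) * fourierCoefficient (u t) n +
        χ t * (-Complex.I * (hform n n : ℤ) * fourierCoefficient (u t) n +
          Complex.I * cubicSum (fourierCoefficient (u t)) n))) (Set.uIcc 0 T) := by
    intro t ht
    rw [Set.uIcc_of_le hT.le] at ht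
    refine (H.hasSum_inner (hc.1 t ht) hs t).unique ?_
    simp only [hs.coeffOf_adjointOp, hdt, coeffOf_waveTest]
    refine (hasSum_ite_eq n _).congr_fun fun m => ?_
    by_cases h : m = n
    · subst h
      simp only [if_true]
      linear_combination (-(χ t : ℂ) * ((hform m m : ℤ) * fourierCoefficient (u t) m -
        cubicSum (fourierCoefficient (u t)) m)) * Complex.I_sq
    · simp [h]
  rw [intervalIntegral.integral_congr hinner, intervalIntegral.integral_const_mul] at h0
  exact (mul_eq_zero.mp h0).resolve_left (neg_ne_zero.mpr Complex.I_ne_zero)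

lemma unconditionallyLocallyWellPosed (H : TrilinearBounds s p r C) :
    UnconditionallyLocallyWellPosed s p := by
  intro u₀ hu₀
  rw [MemFL, flNorm, weightedNorm_eq_cnorm] at hu₀
  obtain ⟨T, hT, a, ha, ha0⟩ := H.exists_fourierSolution hu₀.ne
  -- The embedding realizes each sequence `a t` by a function; outside `[0, T]` any value will do.
  have hex : ∀ t, ∃ f : L1, t ∈ Set.Icc 0 T → fourierCoefficient f = a t := by
    intro t
    by_cases ht : t ∈ Set.Icc 0 T
    · obtain ⟨f, hf, -⟩ := H.flEmbedsInL3 (a t) (by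
        rw [weightedNorm_eq_cnorm]; exact (ha.cont.1 t ht).lt_top)
      exact ⟨f, fun _ => hf⟩
    · exact ⟨0, fun h => absurd h ht⟩
  choose u hu using hex
  have h0 : (0 : ℝ) ∈ Set.Icc 0 T := ⟨le_rfl, hT.le⟩
  have huF : IsFourierSolution s p T fun t => fourierCoefficient (u t) := by
    refine ⟨⟨fun t ht => ?_, fun t ht => ?_⟩, fun t ht n => ?_⟩
    · simp only [hu t ht]; exact ha.cont.1 t ht
    · refine (ha.cont.2 t ht).congr' ?_
      filter_upwards [self_mem_nhdsWithin] with t' ht'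
      rw [hu t ht, hu t' ht']
    · rw [hu t ht]
      exact (ha.deriv t ht n).congr (fun t' ht' => by rw [hu t' ht']) (by rw [hu t ht])
  refine ⟨T, hT, u, ⟨continuousInFL_iff.mpr huF.cont, fourierCoefficient_injective ?_,
    H.solvesHNLS_of_isFourierSolution hT.le huF⟩, fun v hv t ht => ?_⟩
  · rw [hu 0 h0, ha0]
  · have hvF := H.isFourierSolution_of_solvesHNLS hT hv.continuous hv.equation
    refine fourierCoefficient_injective (H.fourierSolution_unique hvF huF ?_ t ht)
    rw [hv.initial, hu 0 h0, ha0]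

end TrilinearBounds

end HNLS

end

/-! ### The main theorem. -/

theorem theorem1p2 (s p : ℝ) (hp : 1 < p)
    (hs : (p ≤ 3 ∧ 1 - 1 / p < s) ∨ (3 ≤ p ∧ 4 / 3 - 2 / p < s)) :
    HNLS.FLEmbedsInL3 s p ∧ HNLS.UnconditionallyLocallyWellPosed s p := by
  have hp0 : 0 < p := one_pos.trans hp
  have h1 : 1 - 1 / p < s ∧ 4 / 3 - 2 / p < s := by
    -- The two thresholds differ by a quantity with the sign of `3 - p`, so in each range the
    -- assumed one is the larger and both conditions hold.
    have hdiff : (1 - 1 / p) - (4 / 3 - 2 / p) = (3 - p) / (3 * p) := by field_simp; ring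
    rcases hs with ⟨h3, h⟩ | ⟨h3, h⟩
    · have : 0 ≤ (3 - p) / (3 * p) := div_nonneg (by linarith) (by positivity)
      exact ⟨h, by linarith⟩
    · have : (3 - p) / (3 * p) ≤ 0 := div_nonpos_of_nonpos_of_nonneg (by linarith) (by positivity)
      exact ⟨by linarith, h⟩
  obtain ⟨r, C, H⟩ := HNLS.exists_trilinearBounds hp h1.1 h1.2
  exact ⟨H.flEmbedsInL3, H.unconditionallyLocallyWellPosed⟩
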